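/- **Theorem (Replica Symmetric Bound).** Let $\mathbf P$ be a set of integers $\ge 2$. *Random functions.* For each $p\in\mathbf P$ let $\theta_p:\{-1,1\}^p\to\mathbb R$ be a random function, and let $h:\{-1,1\}\to\mathbb R$ be a random function. Assume that for every $p\in\mathbf P$ there are i.i.d. random functions $f_{p,1},\dots,f_{p,p}:\{-1,1\}\to\mathbb R$ and random variables $(a_p,b_p)$ independent of them such that, almost surely for all $\sigma_1,\dots,\sigma_p\in\{-1,1\}$, $$\exp\theta_p(\sigma_1,\dots,\sigma_p)=a_p\bigl(1+b_pf_{p,1}(\sigma_1)\cdots f_{p,p}(\sigma_p)\bigr),\qquad |b_pf_{p,1}(\sigma_1)\cdots f_{p,p}(\sigma_p)|<1,$$ that $\mathbb E[(-b_p)^n]\ge 0$ for all $n\ge 1$, and that $p$ is even or $f_{p,1},\dots,f_{p,p}\ge 0$ a.s. Assume also that there is a constant $\kappa>0$ with $|\theta_p|\le\kappa$ for all $p\in\mathbf P$ and $|h|\le\kappa$, a.s. *Graphs.* For each $N$ let $d^N_1,\dots,d^N_N\in\mathbb N$ and $E^N=(E^N_p)_{p\in\mathbf P}$ with $E^N_p\in\mathbb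 N$ be such that $\sum_{i=1}^N d^N_i=\sum_{p\in\mathbf P}pE^N_p$. Let $\mu$ be a probability measure on $\mathbb N$ and $\nu$ one on $\mathbf P$. With $\mu_N(k)=\frac1N\#\{i: d^N_i=k\}$ and $\nu_N(p)=E^N_p/\sum_{q}E^N_q$, assume $$\sum_{k}k|\mu_N(k)-\mu(k)|\to0,\quad \sum_{p\in\mathbf P}p|\nu_N(p)-\nu(p)|\to0,\quad \sup_{N\ge1}\frac1N\sum_{i=1}^N(d_i^N)^2<\infty,\quad \sum_n n^2\mu(n)<\infty,\quad \sum_{p\in\mathbf P} p\,\nu(p)<\infty .$$ Let $G^N$ be the random multigraph on $\{1,\dots,N\}$ given by the configuration model: there are $E^N_p$ labelled edges with $p$ half-edges each ($p\in\mathbf P$), vertex $i$ has $d_i^N$ half-edges, and the half-edges of the edges are matched with those of the vertices uniformly at random. For an edge $e$ let $e(1),\dots,e(p)$ be the vertices matched to its half-edges. The free energy is $$F_N=\frac1N\,\mathbb E\log\sum_{\sigma\in\{-1,1\}^N}\exp\Bigl(\sum_{p\in\mathbf P}\ \sum_{e\ p\text{-edge}}\theta_{p,e}(\sigma_{e(1)},\dots,\sigma_{e(p)})+\sum_{i=1}^Nh_i(\sigma_i)\Bigr),$$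 where the $\theta_{p,e}$ are copies of $\theta_p$, the $h_i$ are copies of $h$, and all of these and $G^N$ are independent. *Averages.* Put $\mathcal E_p=\exp\theta_p$ and, for real $x=(x_\ell)_\ell$, $$\langle \mathcal E_p\rangle_x=\frac{\sum_{\epsilon\in\{-1,1\}^p}\mathcal E_p(\epsilon)\,e^{\sum_{\ell=1}^p x_\ell\epsilon_\ell}}{\sum_{\epsilon\in\{-1,1\}^p}e^{\sum_{\ell=1}^p x_\ell\epsilon_\ell}},\qquad U_p(\theta_p,x_1,\dots,x_{p-1},\sigma)=\log\frac{\sum_{\epsilon\in\{-1,1\}^{p-1}}\mathcal E_p(\epsilon,\sigma)\,e^{\sum_{\ell=1}^{p-1} x_\ell\epsilon_\ell}}{\sum_{\epsilon\in\{-1,1\}^{p-1}}e^{\sum_{\ell=1}^{p-1} x_\ell\epsilon_\ell}} .$$ Given a probability measure $\zeta$ on $\mathbb R$, let $U_{p,i}(\sigma;\zeta)=U_p(\theta_{p,i},x^p_{i,1},\dots,x^p_{i,p-1},\sigma)$, where the $\theta_{p,i}$ are independent copies of $\theta_p$ and the $x^p_{i,\ell}$ are i.i.d. with law $\zeta$.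 Let $\rho(p)=p\,\nu(p)/\sum_q q\,\nu(q)$ be the size-biased law of $\nu$. *Conclusion.* For every probability measure $\zeta$ on $\mathbb R$, $$F_N\le\mathbb E\Bigl[\log\sum_{\sigma=\pm1}\exp\Bigl(\sum_{i=1}^dU_{p_i,i}(\sigma;\zeta)+h(\sigma)\Bigr)\Bigr]-\mathbb E[d]\;\mathbb E\Bigl[\frac{p_1-1}{p_1}\log\langle\mathcal E_{p_1}\rangle_x\Bigr]+o_N(1)\qquad(N\to\infty),$$ where $d$ has law $\mu$, $(p_i)_{i\ge1}$ are i.i.d. with law $\rho$, $x=(x_i)_{i\ge1}$ are i.i.d. with law $\zeta$, and $d$, the $p_i$, $x$, $h$, the $\theta_{p,i}$, the $x^p_{i,\ell}$ and the random function in $\mathcal E_{p}$ are all independent. -/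

import Mathlib

open MeasureTheory ProbabilityTheory Filter Topology
open scoped ENNReal

namespace DilutedSpinGlass

noncomputable section

/-- A spin, i.e. an element of `{-1, 1}`. -/
abbrev Spin : Type := ℤˣ

/-- The value `±1` of a spin as a real number. -/
def spinVal (s : Spin) : ℝ := ((s : ℤ) : ℝ)

/-- Interaction functions `{-1, 1}^p → ℝ` of `p` spins. -/
abbrev Interaction (p : ℕ) : Type := (Fin p → Spin) → ℝ

/-- The assumptions on one random interaction `θ` of `p` spins, with its representation by the
random variables `a`, `b` and the random functions `f 0, …, f (p - 1) : {-1, 1} → ℝ`. (No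
integrability of `b ^ n` is asked for: the bound `|b f ⋯ f| < 1` makes `b` almost surely bounded
unless `f` vanishes almost surely, and then `θ` does not depend on `b`.) -/
structure IsPTInteraction {Ω : Type*} [MeasurableSpace Ω] (Pr : Measure Ω) (p : ℕ)
    (θ : Ω → Interaction p) (a b : Ω → ℝ) (f : Fin p → Ω → Spin → ℝ) : Prop where
  measurable_θ : Measurable θ
  measurable_a : Measurable a
  measurable_b : Measurable b
  measurable_f : ∀ j, Measurable (f j)
  iIndepFun_f : iIndepFun f Pr
  identDistrib_f : ∀ j k, IdentDistrib (f j) (f k) Pr Pr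
  indepFun_ab_f : IndepFun (fun ω => (a ω, b ω)) (fun ω j => f j ω) Pr
  exp_θ : ∀ᵐ ω ∂Pr, ∀ σ : Fin p → Spin,
    Real.exp (θ ω σ) = a ω * (1 + b ω * ∏ j, f j ω (σ j))
  moment_nonneg : ∀ n : ℕ, 1 ≤ n → 0 ≤ ∫ ω, (-b ω) ^ n ∂Pr
  abs_lt_one : ∀ᵐ ω ∂Pr, ∀ σ : Fin p → Spin, |b ω * ∏ j, f j ω (σ j)| < 1
  even_or_nonneg : Even p ∨ ∀ j, ∀ᵐ ω ∂Pr, ∀ s : Spin, 0 ≤ f j ω s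

/-! ### Multigraphs, Hamiltonian and free energy

`P` is the set of edge sizes; `E : P →₀ ℕ` gives the number of `p`-edges for every `p ∈ P`. -/

/-- The (labelled) edges: a size `p` and a label among the `E p` edges of size `p`. -/
abbrev Edge {P : Set ℕ} (E : P →₀ ℕ) : Type := (p : E.support) × Fin (E p)

/-- The size of an edge. -/
abbrev Edge.size {P : Set ℕ} {E : P →₀ ℕ} (e : Edge E) : ℕ := ((e.1 : P) : ℕ)

/-- The half-edges of the edges: every edge of size `p` has `p` of them. -/
abbrev EdgeHalf {P : Set ℕ} (E : P →₀ ℕ) : Type := (e : Edge E) × Fin e.size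

/-- The half-edges of the vertices: the vertex `i` has `d i` of them. -/
abbrev VertexHalf {N : ℕ} (d : Fin N → ℕ) : Type := (i : Fin N) × Fin (d i)

/-- The perfect matchings between the half-edges of the edges and those of the vertices. A
uniform random one yields the configuration model. -/
abbrev Matching {P : Set ℕ} {N : ℕ} (d : Fin N → ℕ) (E : P →₀ ℕ) : Type :=
  EdgeHalf E ≃ VertexHalf d

/-- The multigraph of a matching: `graph m e j` is the `j`-th vertex of the edge `e`. -/
def graph {P : Set ℕ} {N : ℕ} {d : Fin N → ℕ} {E : P →₀ ℕ} (m : Matching d E)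
    (e : Edge E) (j : Fin e.size) : Fin N :=
  (m ⟨e, j⟩).1

/-- `-H_G(σ)` for the multigraph `G` in which the `j`-th vertex of the edge `e` is `G e j`. -/
def negHamiltonian {P : Set ℕ} {N : ℕ} {E : P →₀ ℕ} (G : (e : Edge E) → Fin e.size → Fin N)
    (θ : (e : Edge E) → Interaction e.size) (h : Fin N → Spin → ℝ) (σ : Fin N → Spin) : ℝ :=
  (∑ e, θ e (fun j => σ (G e j))) + ∑ i, h i (σ i)

/-- The free energy `F_N = N⁻¹ 𝔼 log ∑_σ exp (-H_G(σ))`, where `G` is drawn from the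
configuration model with vertex degrees `d` and edge numbers `E`, and, independently,
the interactions of the `p`-edges have the law `Θ p`, the fields have the law `η`,
and all of these are independent. -/
def freeEnergy {P : Set ℕ} (Θ : (p : P) → Measure (Interaction p)) (η : Measure (Spin → ℝ))
    {N : ℕ} (d : Fin N → ℕ) (E : P →₀ ℕ) : ℝ :=
  (1 / (N : ℝ)) * ((∑ m : Matching d E,
    ∫ w : ((e : Edge E) → Interaction e.size) × (Fin N → Spin → ℝ),
      Real.log (∑ σ : Fin N → Spin, Real.exp (negHamiltonian (graph m) w.1 w.2 σ))
      ∂((Measure.pi fun e : Edge E => Θ e.1).prod (Measure.pi fun _ : Fin N => η)))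
    / (Fintype.card (Matching d E) : ℝ))

/-! ### The convergence of the degrees and of the edge sizes -/

/-- The empirical distribution `μ_N` of the degrees. -/
def degreeFreq {N : ℕ} (d : Fin N → ℕ) (k : ℕ) : ℝ :=
  (1 / (N : ℝ)) * ∑ i, if d i = k then (1 : ℝ) else 0

/-- The empirical distribution `ν_N` of the edge sizes. -/
def sizeFreq {P : Set ℕ} (E : P →₀ ℕ) (p : P) : ℝ :=
  (E p : ℝ) / ∑ q ∈ E.support, (E q : ℝ)

/-- The mean of `ν` does not vanish, since all the sizes are at least `2`. -/
theorem mean_ne_zero {P : Set ℕ} (hP : ∀ p ∈ P, 2 ≤ p) (ν : PMF P) :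
    ∑' p : P, ((p : ℕ) : ℝ≥0∞) * ν p ≠ 0 := by
  obtain ⟨p, hp⟩ := ν.support_nonempty
  intro h
  have h1 := ENNReal.tsum_eq_zero.1 h p
  have h2 := hP p p.2
  rcases mul_eq_zero.1 h1 with h3 | h3
  · have h4 : (p : ℕ) = 0 := by exact_mod_cast h3
    omega
  · exact (ν.mem_support_iff p).1 hp h3

/-- The size-biased law `ρ(p) = p ν(p) / ∑_q q ν(q)`. -/
def sizeBiased {P : Set ℕ} (hP : ∀ p ∈ P, 2 ≤ p) (ν : PMF P)
    (hν : ∑' p : P, ((p : ℕ) : ℝ≥0∞) * ν p ≠ ⊤) : PMF P :=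
  PMF.normalize (fun p : P => ((p : ℕ) : ℝ≥0∞) * ν p) (mean_ne_zero hP ν) hν

/-! ### The bound -/

/-- The configuration `(ε_1, …, ε_{p-1}, s)`. -/
def snocSpin {p : ℕ} (ε : Fin (p - 1) → Spin) (s : Spin) (j : Fin p) : Spin :=
  if hj : (j : ℕ) < p - 1 then ε ⟨j, hj⟩ else s

/-- The weight `exp (∑_ℓ x_ℓ ε_ℓ)`. -/
def fieldWeight {n : ℕ} (x : Fin n → ℝ) (ε : Fin n → Spin) : ℝ :=
  Real.exp (∑ l, x l * spinVal (ε l))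

/-- The average `⟨F⟩_x`. -/
def avg {p : ℕ} (F : Interaction p) (x : Fin p → ℝ) : ℝ :=
  (∑ ε : Fin p → Spin, F ε * fieldWeight x ε) / ∑ ε : Fin p → Spin, fieldWeight x ε

/-- The average `⟨F⟩_x^-(s)` over all the spins but the last one, which is `s`. -/
def avgMinus {p : ℕ} (F : Interaction p) (x : Fin (p - 1) → ℝ) (s : Spin) : ℝ :=
  (∑ ε : Fin (p - 1) → Spin, F (snocSpin ε s) * fieldWeight x ε) /
    ∑ ε : Fin (p - 1) → Spin, fieldWeight x ε

/-- `𝓔(ε) = exp θ(ε)`. -/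
def boltzmann {p : ℕ} (θ : Interaction p) : Interaction p := fun ε => Real.exp (θ ε)

/-- `U(θ, x_1, …, x_{p-1}, s) = log ⟨𝓔⟩_x^-(s)`. -/
def siteField {p : ℕ} (θ : Interaction p) (x : Fin (p - 1) → ℝ) (s : Spin) : ℝ :=
  Real.log (avgMinus (boltzmann θ) x s)

/-- `𝔼 log ∑_σ exp (∑_{i ≤ k} U_{p_i,i}(σ; ζ) + h(σ))`, where `k` has law `μ`, the `p_i` are i.i.d.
with law `ρ`, the interaction `ϑ_i` in `U_{p_i,i}` has law `Θ p_i` and the coordinates of `x_i` have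
law `ζ`, `h` has law `η`, and everything is independent (given the `p_i`). -/
def siteTerm {P : Set ℕ} (Θ : (p : P) → Measure (Interaction p)) (η : Measure (Spin → ℝ))
    (μ : PMF ℕ) (ρ : PMF P) (ζ : Measure ℝ) : ℝ :=
  ∫ k : ℕ, ∫ p : Fin k → P, ∫ ϑ : (i : Fin k) → Interaction (p i),
    ∫ x : (i : Fin k) → Fin ((p i : ℕ) - 1) → ℝ, ∫ h : Spin → ℝ,
      Real.log (∑ s : Spin, Real.exp ((∑ i, siteField (ϑ i) (x i) s) + h s))
      ∂η ∂(Measure.pi fun _ => Measure.pi fun _ => ζ) ∂(Measure.pi fun i => Θ (p i))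
      ∂(Measure.pi fun _ => ρ.toMeasure) ∂μ.toMeasure

/-- `𝔼 [((p - 1) / p) log ⟨𝓔_p⟩_x]`, where `p` has law `ρ`, the interaction in `𝓔_p` has law `Θ p`
and the coordinates of `x` are i.i.d. with law `ζ`. -/
def edgeTerm {P : Set ℕ} (Θ : (p : P) → Measure (Interaction p))
    (ρ : PMF P) (ζ : Measure ℝ) : ℝ :=
  ∫ p : P, ∫ ϑ : Interaction p, ∫ x : Fin p → ℝ,
      ((((p : ℕ) : ℝ) - 1) / ((p : ℕ) : ℝ)) * Real.log (avg (boltzmann ϑ) x)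
      ∂(Measure.pi fun _ => ζ) ∂(Θ p) ∂ρ.toMeasure

/-- The replica symmetric functional: the right-hand side of the bound, without the error. -/
def rsFunctional {P : Set ℕ} (Θ : (p : P) → Measure (Interaction p)) (η : Measure (Spin → ℝ))
    (μ : PMF ℕ) (ρ : PMF P) (ζ : Measure ℝ) : ℝ :=
  siteTerm Θ η μ ρ ζ - (∫ k : ℕ, (k : ℝ) ∂μ.toMeasure) * edgeTerm Θ ρ ζ

end

end DilutedSpinGlass

/-!
The free energy is bounded by a discrete interpolation in the spirit of Franz-Leone and
Panchenko-Talagrand, carried out directly in the configuration model.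

The uniform matching is generated by putting the interactions one after the other on distinct,
uniformly chosen half-edges of the vertices. A `Factor` is a law of interactions of some arity, and
`meanLogZ` is the mean log-partition function after a list of factors has been placed; it does not
depend on the order of the list. Besides the interactions themselves there are the fields: a field
is a factor of arity one, whose energy is `U_p` with independent cavity fields of law `ζ`.

*One interaction.* Given the current Gibbs measure, adding an interaction changes the log-partition
function by the logarithm of a Gibbs average. Expanding `log (1 + b x)` in powers, `log a` cancels
between the terms compared below, and each remaining term is `-E[(-b) ^ n] / n`, which is at most
zero, times a moment of `p` independent factors. Introducing `n` replicas, the moments of the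
interaction, of the field and of the bulk term `log ⟨exp θ⟩` are the replica means of `A ^ p`,
`A B ^ (p - 1)` and `B ^ p`, and `A ^ p - p A B ^ (p - 1) + (p - 1) B ^ p ≥ 0` if `p` is even or
`A, B ≥ 0`. Hence an interaction has at most `p` times the effect of one field minus `p - 1` bulk
terms (`integral_replica_moment_nonneg`, `integral_log_combination_nonpos`, `integral_logEdge_le`).
This is for half-edges drawn with replacement; drawing distinct ones from the free half-edges costs
an error of order `p ^ 2` divided by their number (`meanLogZ_edge_le`).

*All interactions.* The inequality involves `p` times the effect of the first field, not the effect
of `p` successive fields. Averaging it over a window of `L` additional fields makes the sums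
telescope and turns one into the other (`meanLogZ_replicate_edge_le`). Edges of size larger than `K`
and a few others are removed beforehand, so that half-edges remain free
(`meanLogZ_edgeFactors_le`).

*Fields only.* When only fields remain, the partition function factorizes over the vertices, and
the fields at a vertex sit on half-edges of the edges sampled without replacement
(`meanLogZ_fieldFactors_eq`). A half-edge of an edge chosen at random belongs to an edge with
size-biased size, and sampling without replacement is close to independent sampling
(`abs_average_places_comp_sub_le`, `average_min_le`). Together with the convergence of the degrees
and of the edge sizes (`abs_degree_average_sub_le`, `abs_size_average_sub_le`) this bounds the free
energy for each number of vertices (`freeEnergy_le`); `L` of order `√N` and then `K → ∞` make all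
the errors vanish (`exists_error`).
-/

open MeasureTheory ProbabilityTheory Filter Topology
open scoped ENNReal

namespace DilutedSpinGlass

/-! ### The convexity inequality and its moment form -/

/-- The tangent line inequality for `x ↦ x ^ (q + 1)` at `B`. -/
theorem pow_tangent_nonneg_of_nonneg (q : ℕ) {A B : ℝ} (hA : 0 ≤ A) (hB : 0 ≤ B) :
    0 ≤ A ^ (q + 1) - (q + 1) * (B ^ q * A) + q * B ^ (q + 1) := by
  induction q with
  | zero => simp
  | succ q ih =>
    have h : A ^ (q + 1 + 1) - ((q + 1 : ℕ) + 1) * (B ^ (q + 1) * A) + (q + 1 : ℕ) * B ^ (q + 1 + 1)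
        = A * (A ^ (q + 1) - (q + 1) * (B ^ q * A) + q * B ^ (q + 1))
          + (q + 1) * B ^ q * (A - B) ^ 2 := by
      push_cast; ring
    rw [h]
    positivity

theorem pow_tangent_nonneg (q : ℕ) {A B : ℝ} (h : Even (q + 1) ∨ (0 ≤ A ∧ 0 ≤ B)) :
    0 ≤ A ^ (q + 1) - (q + 1) * (B ^ q * A) + q * B ^ (q + 1) := by
  rcases h with h | ⟨hA, hB⟩
  · have h1 := pow_tangent_nonneg_of_nonneg q (abs_nonneg A) (abs_nonneg B)
    rw [h.pow_abs, h.pow_abs] at h1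
    have h2 : B ^ q * A ≤ |B| ^ q * |A| := by
      rw [← abs_pow, ← abs_mul]; exact le_abs_self _
    have h3 : ((q : ℝ) + 1) * (B ^ q * A) ≤ (q + 1) * (|B| ^ q * |A|) := by gcongr
    linarith
  · exact pow_tangent_nonneg_of_nonneg q hA hB

/-- The convexity inequality for the `n`-th moments of a product of `q + 1` independent random
functions. The first term averages all the factors with the same weights `g`, which couples them,
the third one averages every factor on its own, and the second one averages only the last factor
with `g`. Expanding the `n`-th powers into sums over `n` replicas makes the factors independent
given the replicas, so that the tangent line inequality applies for every choice of the replicas. -/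
theorem integral_replica_moment_nonneg {C S : Type*} [MeasurableSpace C] [Fintype S]
    (χ : Measure C) [IsProbabilityMeasure χ] (F : C → S → ℝ) (X : C → ℝ) (g : S → ℝ)
    (hF : ∀ σ, Measurable fun c => F c σ) (hX : Measurable X) (K : ℝ)
    (hFK : ∀ᵐ c ∂χ, ∀ σ, |F c σ| ≤ K) (hXK : ∀ᵐ c ∂χ, |X c| ≤ K)
    (hg : ∀ σ, 0 ≤ g σ) (hg1 : ∑ σ, g σ = 1) (q n : ℕ)
    (hpos : Even (q + 1) ∨ ((∀ᵐ c ∂χ, ∀ σ, 0 ≤ F c σ) ∧ ∀ᵐ c ∂χ, 0 ≤ X c)) :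
    0 ≤ ∫ c : Fin (q + 1) → C, ((∑ σ, g σ * ∏ j, F (c j) σ) ^ n
        - (q + 1) * ((∏ j : Fin q, X (c j.castSucc)) * ∑ σ, g σ * F (c (Fin.last q)) σ) ^ n
        + q * (∏ j, X (c j)) ^ n) ∂(Measure.pi fun _ => χ) := by
  have hXi : Integrable (fun c => X c ^ n) χ := by
    refine Integrable.of_bound (C := |K| ^ n) (hX.pow_const n).aestronglyMeasurable ?_
    filter_upwards [hXK] with c hc
    rw [norm_pow]
    exact pow_le_pow_left₀ (abs_nonneg _) (hc.trans (le_abs_self K)) _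
  have hFi : ∀ τ : Fin n → S, Integrable (fun c => ∏ l, F c (τ l)) χ := by
    intro τ
    refine Integrable.of_bound (C := |K| ^ n)
      (Finset.measurable_fun_prod _ fun l _ => hF (τ l)).aestronglyMeasurable ?_
    filter_upwards [hFK] with c hc
    rw [norm_prod]
    refine (Finset.prod_le_prod (fun l _ => norm_nonneg _)
      fun l _ => (hc (τ l)).trans (le_abs_self K)).trans ?_
    simp
  have e : ∀ c : Fin (q + 1) → C, ((∑ σ, g σ * ∏ j, F (c j) σ) ^ n
        - (q + 1) * ((∏ j : Fin q, X (c j.castSucc)) * ∑ σ, g σ * F (c (Fin.last q)) σ) ^ n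
        + q * (∏ j, X (c j)) ^ n) = ∑ τ : Fin n → S, (∏ l, g (τ l)) *
        (∏ j, ∏ l, F (c j) (τ l)
          - (q + 1) * ((∏ j : Fin q, X (c j.castSucc) ^ n) * ∏ l, F (c (Fin.last q)) (τ l))
          + q * ∏ j, X (c j) ^ n) := by
    intro c
    have h1 : ∑ τ : Fin n → S, ∏ l, g (τ l) = 1 := by
      rw [← Fintype.sum_pow, hg1, one_pow]
    simp_rw [mul_add, mul_sub, Finset.sum_add_distrib, Finset.sum_sub_distrib]
    rw [← Finset.sum_mul, h1, one_mul, mul_pow, Fintype.sum_pow, Fintype.sum_pow,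
      Finset.prod_pow, Finset.prod_pow]
    congr 2
    · refine Finset.sum_congr rfl fun τ _ => ?_
      rw [Finset.prod_mul_distrib, Finset.prod_comm]
    · rw [Finset.mul_sum, Finset.mul_sum]
      refine Finset.sum_congr rfl fun τ _ => ?_
      rw [Finset.prod_mul_distrib]; ring
  simp_rw [e]
  have i1 : ∀ τ : Fin n → S, Integrable (fun c : Fin (q + 1) → C => ∏ j, ∏ l, F (c j) (τ l))
      (Measure.pi fun _ => χ) := fun τ =>
    Integrable.fintype_prod (f := fun _ c => ∏ l, F c (τ l)) fun _ => hFi τ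
  have i3 : Integrable (fun c : Fin (q + 1) → C => ∏ j, X (c j) ^ n) (Measure.pi fun _ => χ) :=
    Integrable.fintype_prod (f := fun _ c => X c ^ n) fun _ => hXi
  have h2 : ∀ (τ : Fin n → S) (c : Fin (q + 1) → C),
      (∏ j : Fin q, X (c j.castSucc) ^ n) * ∏ l, F (c (Fin.last q)) (τ l)
        = ∏ j : Fin (q + 1), (if j = Fin.last q then fun c => ∏ l, F c (τ l) else
            fun c => X c ^ n) (c j) := by
    intro τ c
    rw [Fin.prod_univ_castSucc]
    simp [Fin.castSucc_ne_last]
  have i2 : ∀ τ : Fin n → S, Integrable (fun c : Fin (q + 1) → C =>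
      (∏ j : Fin q, X (c j.castSucc) ^ n) * ∏ l, F (c (Fin.last q)) (τ l))
      (Measure.pi fun _ => χ) := by
    intro τ
    simp_rw [h2]
    refine Integrable.fintype_prod fun j => ?_
    split_ifs
    exacts [hFi τ, hXi]
  rw [integral_finsetSum]
  swap
  · exact fun τ _ => (((i1 τ).sub ((i2 τ).const_mul _)).add (i3.const_mul _)).const_mul _
  refine Finset.sum_nonneg fun τ _ => ?_
  rw [integral_const_mul]
  refine mul_nonneg (Finset.prod_nonneg fun l _ => hg _) ?_
  have i12 : Integrable (fun c : Fin (q + 1) → C => ∏ j, ∏ l, F (c j) (τ l)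
      - ((q : ℝ) + 1) * ((∏ j : Fin q, X (c j.castSucc) ^ n) * ∏ l, F (c (Fin.last q)) (τ l)))
      (Measure.pi fun _ => χ) := (i1 τ).sub ((i2 τ).const_mul _)
  rw [integral_add i12 (i3.const_mul _),
    integral_sub (i1 τ) ((i2 τ).const_mul _), integral_const_mul, integral_const_mul]
  simp_rw [h2]
  rw [integral_fintype_prod_eq_prod, integral_fintype_prod_eq_pow (fun c => ∏ l, F c (τ l)),
    integral_fintype_prod_eq_pow (fun c => X c ^ n), Fin.prod_univ_castSucc]
  simp only [Fin.castSucc_ne_last, if_false, if_true, Finset.prod_const, Finset.card_univ,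
    Fintype.card_fin]
  refine pow_tangent_nonneg q (hpos.imp_right fun h => ⟨?_, ?_⟩)
  · refine integral_nonneg_of_ae ?_
    filter_upwards [h.1] with c hc
    exact Finset.prod_nonneg fun l _ => hc _
  · refine integral_nonneg_of_ae ?_
    filter_upwards [h.2] with c hc
    exact pow_nonneg hc n

/-- If all the mixed moments of `y₁, y₂, y₃` have the right sign, so has the combination of the
logarithms. The power series of `log (1 + r y)` is integrated term by term for `r < 1`; the uniform
bound on the combination allows for `r → 1` even if the single logarithms are not integrable. -/
theorem integral_log_combination_nonpos {Y : Type*} [MeasurableSpace Y] (π : Measure Y)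
    [IsProbabilityMeasure π] (y₁ y₂ y₃ : Y → ℝ) (h₁ : Measurable y₁) (h₂ : Measurable y₂)
    (h₃ : Measurable y₃) (b₁ : ∀ᵐ c ∂π, |y₁ c| < 1) (b₂ : ∀ᵐ c ∂π, |y₂ c| < 1)
    (b₃ : ∀ᵐ c ∂π, |y₃ c| < 1) (q : ℕ) (K : ℝ)
    (hmom : ∀ n : ℕ, 1 ≤ n →
      0 ≤ ∫ c, ((-y₁ c) ^ n - (q + 1) * (-y₂ c) ^ n + q * (-y₃ c) ^ n) ∂π)
    (hK : ∀ᵐ c ∂π, ∀ r : ℝ, 0 ≤ r → r < 1 → |Real.log (1 + r * y₁ c)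
      - (q + 1) * Real.log (1 + r * y₂ c) + q * Real.log (1 + r * y₃ c)| ≤ K) :
    ∫ c, (Real.log (1 + y₁ c) - (q + 1) * Real.log (1 + y₂ c) + q * Real.log (1 + y₃ c)) ∂π
      ≤ 0 := by
  set D : ℝ → Y → ℝ := fun r c => Real.log (1 + r * y₁ c)
      - (q + 1) * Real.log (1 + r * y₂ c) + q * Real.log (1 + r * y₃ c) with hD
  have hDm : ∀ r, Measurable (D r) := by
    intro r; simp only [hD]; fun_prop
  have hr : ∀ r : ℝ, 0 ≤ r → r < 1 → ∫ c, D r c ∂π ≤ 0 := by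
    intro r hr0 hr1
    set T : ℕ → Y → ℝ := fun n c => r ^ (n + 1) / (n + 1) *
      ((-y₁ c) ^ (n + 1) - (q + 1) * (-y₂ c) ^ (n + 1) + q * (-y₃ c) ^ (n + 1)) with hT
    have hTm : ∀ n, Measurable (T n) := by intro n; simp only [hT]; fun_prop
    have hTb : ∀ n, ∀ᵐ c ∂π, ‖T n c‖ ≤ r ^ n * (2 * q + 2) := by
      intro n
      filter_upwards [b₁, b₂, b₃] with c c₁ c₂ c₃
      have k : ∀ y : ℝ, |y| < 1 → |(-y) ^ (n + 1)| ≤ 1 := by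
        intro y hy
        rw [abs_pow, abs_neg]
        exact pow_le_one₀ (abs_nonneg _) hy.le
      have k0 : |r ^ (n + 1) / ((n : ℝ) + 1)| ≤ r ^ n := by
        rw [abs_of_nonneg (by positivity), div_le_iff₀ (by positivity), pow_succ]
        have : 0 ≤ r ^ n := by positivity
        have : (1 : ℝ) ≤ n + 1 := by linarith [(n.cast_nonneg : (0 : ℝ) ≤ n)]
        nlinarith
      rw [hT, Real.norm_eq_abs, abs_mul]
      refine mul_le_mul k0 ?_ (abs_nonneg _) (by positivity)
      refine (abs_add_le _ _).trans ?_
      refine (add_le_add_left (abs_sub _ _) _).trans ?_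
      rw [abs_mul, abs_mul, abs_of_nonneg (by positivity : (0 : ℝ) ≤ q + 1), Nat.abs_cast]
      have hq : (0 : ℝ) ≤ q := q.cast_nonneg
      nlinarith [k _ c₁, k _ c₂, k _ c₃]
    have hTi : ∀ n, Integrable (T n) π := fun n =>
      Integrable.of_bound (hTm n).aestronglyMeasurable _ (hTb n)
    have hTs : Summable fun n => ∫ c, ‖T n c‖ ∂π := by
      refine Summable.of_nonneg_of_le (fun n => integral_nonneg fun _ => norm_nonneg _)
        (fun n => ?_)
        ((summable_geometric_of_lt_one hr0 hr1).mul_right (2 * (q : ℝ) + 2))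
      calc ∫ c, ‖T n c‖ ∂π ≤ ∫ _, r ^ n * (2 * (q : ℝ) + 2) ∂π :=
            integral_mono_ae (hTi n).norm (integrable_const _) (hTb n)
        _ = _ := by simp
    have hs := hasSum_integral_of_summable_integral_norm hTi hTs
    have e : ∫ c, ∑' n, T n c ∂π = ∫ c, -D r c ∂π := by
      refine integral_congr_ae ?_
      filter_upwards [b₁, b₂, b₃] with c c₁ c₂ c₃
      have k : ∀ y : ℝ, |y| < 1 → HasSum (fun n : ℕ => r ^ (n + 1) / (n + 1) * (-y) ^ (n + 1))
          (-Real.log (1 + r * y)) := by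
        intro y hy
        have : |r * -y| < 1 := by
          rw [abs_mul, abs_neg, abs_of_nonneg hr0]
          nlinarith [abs_nonneg y]
        have h := Real.hasSum_pow_div_log_of_abs_lt_one this
        rw [show 1 - r * -y = 1 + r * y by ring] at h
        have e₃ : (fun n : ℕ => (r * -y) ^ (n + 1) / ((n : ℝ) + 1))
            = fun n : ℕ => r ^ (n + 1) / (n + 1) * (-y) ^ (n + 1) := by
          funext n; rw [mul_pow]; ring
        rwa [e₃] at h
      have h := ((k _ c₁).sub ((k _ c₂).mul_left ((q : ℝ) + 1))).add ((k _ c₃).mul_left (q : ℝ))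
      have h' : HasSum (fun n => T n c) (-D r c) := by
        have e₁ : (fun n => T n c) = fun n : ℕ => r ^ (n + 1) / (n + 1) * (-y₁ c) ^ (n + 1)
            - (q + 1) * (r ^ (n + 1) / (n + 1) * (-y₂ c) ^ (n + 1))
            + q * (r ^ (n + 1) / (n + 1) * (-y₃ c) ^ (n + 1)) := by
          funext n; simp only [hT]; ring
        have e₂ : -D r c = -Real.log (1 + r * y₁ c) - (q + 1) * -Real.log (1 + r * y₂ c)
            + q * -Real.log (1 + r * y₃ c) := by
          simp only [hD]; ring
        rw [e₁, e₂]
        exact h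
      exact h'.tsum_eq
    rw [e, integral_neg] at hs
    have : 0 ≤ -∫ c, D r c ∂π := by
      refine hs.nonneg fun n => ?_
      simp only [hT]
      rw [integral_const_mul]
      exact mul_nonneg (by positivity) (hmom (n + 1) (by omega))
    linarith
  have hlim : Tendsto (fun r => ∫ c, D r c ∂π) (𝓝[<] 1) (𝓝 (∫ c, D 1 c ∂π)) := by
    have hev : ∀ᶠ r : ℝ in 𝓝[<] 1, 0 ≤ r ∧ r < 1 := by
      filter_upwards [Ico_mem_nhdsLT (show (0 : ℝ) < 1 by norm_num)] with r hr using hr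
    refine tendsto_integral_filter_of_dominated_convergence (fun _ => K)
      (Eventually.of_forall fun r => (hDm r).aestronglyMeasurable) ?_ (integrable_const _) ?_
    · filter_upwards [hev] with r hr
      filter_upwards [hK] with c hc
      exact hc r hr.1 hr.2
    · filter_upwards [b₁, b₂, b₃] with c c₁ c₂ c₃
      have k : ∀ y : ℝ, |y| < 1 → Tendsto (fun r : ℝ => Real.log (1 + r * y)) (𝓝[<] 1)
          (𝓝 (Real.log (1 + 1 * y))) := by
        intro y hy
        have : ContinuousAt (fun r : ℝ => Real.log (1 + r * y)) 1 := by
          refine ContinuousAt.log (by fun_prop) ?_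
          have := (abs_lt.1 hy).1
          linarith
        exact this.tendsto.mono_left nhdsWithin_le_nhds
      exact ((k _ c₁).sub ((k _ c₂).const_mul _)).add ((k _ c₃).const_mul _)
  have : ∫ c, D 1 c ∂π ≤ 0 := by
    refine le_of_tendsto hlim ?_
    filter_upwards [Ico_mem_nhdsLT (show (0 : ℝ) < 1 by norm_num)] with r hr'
    exact hr r hr'.1 hr'.2
  simpa only [hD, one_mul] using this

/-! ### The law of an interaction -/

/-- The interaction `θ = log (a (1 + b f₁ ⋯ fₙ))` as a function of `((a, b), (f₁, …, fₙ))`. -/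
noncomputable def productInteraction {n : ℕ} (z : (ℝ × ℝ) × (Fin n → Spin → ℝ)) : Interaction n :=
  fun σ => Real.log (z.1.1 * (1 + z.1.2 * ∏ j, z.2 j (σ j)))

theorem measurable_productInteraction {n : ℕ} :
    Measurable (productInteraction : (ℝ × ℝ) × (Fin n → Spin → ℝ) → Interaction n) := by
  refine measurable_pi_lambda _ fun σ => ?_
  unfold productInteraction
  fun_prop

/-- The almost sure constraints on `((a, b), (f₁, …, fₙ))`. -/
def IsAdmissible {n : ℕ} (κ : ℝ) (z : (ℝ × ℝ) × (Fin n → Spin → ℝ)) : Prop :=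
  0 < z.1.1 ∧ ∀ σ : Fin n → Spin, |z.1.2 * ∏ j, z.2 j (σ j)| < 1 ∧ |productInteraction z σ| ≤ κ

/-- The hypotheses on an interaction, stated for its law `Θ` only: `β` is the law of `(a, b)` and
`φ` the common law of `f₁, …, fₙ`. -/
structure IsProductLaw {n : ℕ} (κ : ℝ) (Θ : Measure (Interaction n)) (β : Measure (ℝ × ℝ))
    (φ : Measure (Spin → ℝ)) : Prop where
  prob_β : IsProbabilityMeasure β
  prob_φ : IsProbabilityMeasure φ
  map_eq : (β.prod (Measure.pi fun _ => φ)).map productInteraction = Θ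
  admissible : ∀ᵐ z ∂β.prod (Measure.pi fun _ : Fin n => φ), IsAdmissible κ z
  moment_nonneg : ∀ k : ℕ, 1 ≤ k → 0 ≤ ∫ ab, (-ab.2) ^ k ∂β
  even_or_nonneg : Even n ∨ ∀ᵐ f ∂φ, ∀ s, 0 ≤ f s
  zero_or_bounded : (∀ᵐ ab ∂β, ab.2 = 0) ∨ ∃ K, ∀ᵐ f ∂φ, ∀ s, |f s| ≤ K

/-- If `|b f₁ ⋯ fₙ| < 1` almost surely and `b` does not vanish, the `f`'s are bounded: otherwise
`|b| ≥ δ` and `|f₁|, …, |fₙ| > K` would occur simultaneously, by independence. -/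
theorem zero_or_bounded_of_abs_lt_one {n : ℕ} (hn : 1 ≤ n) (β : Measure (ℝ × ℝ))
    (φ : Measure (Spin → ℝ)) [IsProbabilityMeasure β] [IsProbabilityMeasure φ]
    (h : ∀ᵐ z ∂β.prod (Measure.pi fun _ : Fin n => φ),
      ∀ σ : Fin n → Spin, |z.1.2 * ∏ j, z.2 j (σ j)| < 1) :
    (∀ᵐ ab ∂β, ab.2 = 0) ∨ ∃ K, ∀ᵐ f ∂φ, ∀ s, |f s| ≤ K := by
  by_cases hb : ∀ k : ℕ, β {ab | ((k : ℝ) + 1)⁻¹ < |ab.2|} = 0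
  · left
    have : ∀ k : ℕ, ∀ᵐ ab ∂β, ¬ ((k : ℝ) + 1)⁻¹ < |ab.2| := by
      intro k; rw [ae_iff]; simpa using hb k
    filter_upwards [ae_all_iff.2 this] with ab hab
    by_contra hne
    obtain ⟨k, hk⟩ := exists_nat_one_div_lt (abs_pos.2 hne)
    exact hab k (by simpa using hk)
  · right
    push Not at hb
    obtain ⟨k, hk⟩ := hb
    refine ⟨k + 1, ?_⟩
    rw [ae_all_iff]
    intro s
    rw [ae_iff]
    have hz : (β.prod (Measure.pi fun _ : Fin n => φ))
        ({ab | ((k : ℝ) + 1)⁻¹ < |ab.2|} ×ˢ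
          (Set.univ.pi fun _ : Fin n => {f : Spin → ℝ | ¬ |f s| ≤ k + 1})) = 0 := by
      refine measure_mono_null ?_ (ae_iff.1 h)
      rintro ⟨ab, f⟩ ⟨h1, h2⟩
      simp only [Set.mem_ofPred_eq, Set.mem_pi, Set.mem_univ, forall_true_left, not_le] at h1 h2 ⊢
      intro hcon
      have h3 := hcon fun _ => s
      rw [abs_mul, Finset.abs_prod] at h3
      have h4 : ((k : ℝ) + 1) ^ n ≤ ∏ j, |f j s| := by
        calc ((k : ℝ) + 1) ^ n = ∏ _j : Fin n, ((k : ℝ) + 1) := by simp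
          _ ≤ _ := Finset.prod_le_prod (fun _ _ => by positivity) fun j _ => (h2 j).le
      have h5 : (k : ℝ) + 1 ≤ ((k : ℝ) + 1) ^ n :=
        le_self_pow₀ (by linarith [(k.cast_nonneg : (0 : ℝ) ≤ k)]) (by omega)
      have h6 : ((k : ℝ) + 1)⁻¹ * (k + 1) ≤ |ab.2| * ∏ j, |f j s| :=
        mul_le_mul h1.le (h5.trans h4) (by positivity) (abs_nonneg _)
      rw [inv_mul_cancel₀ (by positivity)] at h6
      linarith
    rw [Measure.prod_prod, Measure.pi_pi] at hz
    rcases mul_eq_zero.1 hz with h1 | h1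
    · exact absurd h1 hk
    · rw [Finset.prod_const] at h1
      exact eq_zero_of_pow_eq_zero h1

/-- The hypotheses on a random interaction only concern its law. -/
theorem IsPTInteraction.exists_isProductLaw {Ω : Type*} [MeasurableSpace Ω] {Pr : Measure Ω}
    [IsProbabilityMeasure Pr] {n : ℕ} (hn : 1 ≤ n) {θ : Ω → Interaction n} {a b : Ω → ℝ}
    {f : Fin n → Ω → Spin → ℝ} (h : IsPTInteraction Pr n θ a b f) {κ : ℝ}
    (hκ : ∀ᵐ ω ∂Pr, ∀ σ, |θ ω σ| ≤ κ) :
    ∃ β φ, IsProductLaw κ (Pr.map θ) β φ := by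
  have hab : Measurable fun ω => (a ω, b ω) := h.measurable_a.prodMk h.measurable_b
  have hf : Measurable fun ω j => f j ω := measurable_pi_lambda _ h.measurable_f
  set j₀ : Fin n := ⟨0, by omega⟩
  set β := Pr.map fun ω => (a ω, b ω) with hβ
  set φ := Pr.map (f j₀) with hφ
  have pβ : IsProbabilityMeasure β := Measure.isProbabilityMeasure_map hab.aemeasurable
  have pφ : IsProbabilityMeasure φ :=
    Measure.isProbabilityMeasure_map (h.measurable_f j₀).aemeasurable
  have hpi : Pr.map (fun ω j => f j ω) = Measure.pi fun _ : Fin n => φ := by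
    rw [(iIndepFun_iff_map_fun_eq_pi_map fun j => (h.measurable_f j).aemeasurable).1 h.iIndepFun_f]
    congr 1
    funext j
    exact (h.identDistrib_f j j₀).map_eq
  have hjoint : Pr.map (fun ω => ((a ω, b ω), fun j => f j ω))
      = β.prod (Measure.pi fun _ : Fin n => φ) := by
    rw [(indepFun_iff_map_prod_eq_prod_map_map hab.aemeasurable hf.aemeasurable).1
      h.indepFun_ab_f, hpi]
  have hm : Measurable fun ω => ((a ω, b ω), fun j => f j ω) := hab.prodMk hf
  have hθ : ∀ᵐ ω ∂Pr, productInteraction ((a ω, b ω), fun j => f j ω) = θ ω := by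
    filter_upwards [h.exp_θ] with ω hω
    funext σ
    simp only [productInteraction]
    rw [← hω σ, Real.log_exp]
  have adm : ∀ᵐ z ∂β.prod (Measure.pi fun _ : Fin n => φ), IsAdmissible κ z := by
    rw [← hjoint]
    rw [ae_map_iff hm.aemeasurable]
    · filter_upwards [h.exp_θ, h.abs_lt_one, hκ, hθ] with ω h1 h2 h3 h4
      refine ⟨?_, fun σ => ⟨h2 σ, by rw [h4]; exact h3 σ⟩⟩
      have h5 := h1 fun _ => 1
      have h6 := (abs_lt.1 (h2 fun _ => 1)).1
      have h7 := Real.exp_pos (θ ω fun _ => 1)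
      rw [h5] at h7
      exact (pos_iff_pos_of_mul_pos h7).2 (by linarith)
    · have e : {z : (ℝ × ℝ) × (Fin n → Spin → ℝ) | IsAdmissible κ z} = {z | 0 < z.1.1} ∩
          ⋂ σ : Fin n → Spin, ({z | |z.1.2 * ∏ j, z.2 j (σ j)| < 1} ∩
            {z | |productInteraction z σ| ≤ κ}) := by
        ext z; simp [IsAdmissible]
      rw [e]
      have hpm : ∀ σ : Fin n → Spin,
          Measurable fun z : (ℝ × ℝ) × (Fin n → Spin → ℝ) => productInteraction z σ :=
        fun σ => (measurable_pi_apply σ).comp measurable_productInteraction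
      refine (measurableSet_lt measurable_const (by fun_prop)).inter
        (MeasurableSet.iInter fun σ => (measurableSet_lt ?_ measurable_const).inter
          (measurableSet_le (by simpa only [Real.norm_eq_abs] using (hpm σ).norm)
            measurable_const))
      have : Measurable fun z : (ℝ × ℝ) × (Fin n → Spin → ℝ) => z.1.2 * ∏ j, z.2 j (σ j) := by
        fun_prop
      simpa only [Real.norm_eq_abs] using this.norm
  refine ⟨β, φ, pβ, pφ, ?_, adm, ?_, ?_, ?_⟩
  · rw [← hjoint, Measure.map_map measurable_productInteraction hm]
    exact Measure.map_congr hθ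
  · intro k hk
    rw [hβ, integral_map hab.aemeasurable (by fun_prop)]
    exact h.moment_nonneg k hk
  · refine h.even_or_nonneg.imp_right fun hpos => ?_
    rw [hφ, ae_map_iff (h.measurable_f j₀).aemeasurable]
    · exact hpos j₀
    · simp only [Set.ofPred_forall]
      exact MeasurableSet.iInter fun s => measurableSet_le measurable_const (by fun_prop)
  · exact zero_or_bounded_of_abs_lt_one hn β φ (adm.mono fun z hz σ => (hz.2 σ).1)

/-! ### Averages of an admissible interaction -/

/-- Averaging the Boltzmann factors with weights `g` averages the products `f₁ ⋯ fₙ`. -/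
theorem sum_mul_exp_productInteraction {n : ℕ} {κ : ℝ} {z : (ℝ × ℝ) × (Fin n → Spin → ℝ)}
    (hz : IsAdmissible κ z) {S : Type*} [Fintype S] (g : S → ℝ) (hg1 : ∑ σ, g σ = 1)
    (ε : S → Fin n → Spin) :
    ∑ σ, g σ * Real.exp (productInteraction z (ε σ))
      = z.1.1 * (1 + z.1.2 * ∑ σ, g σ * ∏ j, z.2 j (ε σ j)) := by
  have h : ∀ σ, g σ * Real.exp (productInteraction z (ε σ))
      = z.1.1 * g σ + z.1.1 * z.1.2 * (g σ * ∏ j, z.2 j (ε σ j)) := by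
    intro σ
    have h1 := (abs_lt.1 (hz.2 (ε σ)).1).1
    rw [productInteraction, Real.exp_log (mul_pos hz.1 (by linarith))]
    ring
  simp_rw [h, Finset.sum_add_distrib, ← Finset.mul_sum, hg1]
  ring

theorem abs_average_lt_one {n : ℕ} {κ : ℝ} {z : (ℝ × ℝ) × (Fin n → Spin → ℝ)}
    (hz : IsAdmissible κ z) {S : Type*} [Fintype S] (g : S → ℝ) (hg : ∀ σ, 0 ≤ g σ)
    (hg1 : ∑ σ, g σ = 1) (ε : S → Fin n → Spin) :
    |z.1.2 * ∑ σ, g σ * ∏ j, z.2 j (ε σ j)| < 1 := by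
  have h := (convex_Ioo (-1 : ℝ) 1).sum_mem (t := Finset.univ) (w := g)
    (z := fun σ => z.1.2 * ∏ j, z.2 j (ε σ j)) (fun σ _ => hg σ) hg1
    (fun σ _ => abs_lt.1 (hz.2 (ε σ)).1)
  rw [abs_lt, Finset.mul_sum]
  simp only [smul_eq_mul, mul_left_comm (g _)] at h
  exact h

/-- The logarithm of an average of `exp ∘ θ` is bounded like `θ`. -/
theorem abs_log_average_exp_le {S : Type*} [Fintype S] {κ : ℝ} (g t : S → ℝ) (hg : ∀ σ, 0 ≤ g σ)
    (hg1 : ∑ σ, g σ = 1) (ht : ∀ σ, |t σ| ≤ κ) :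
    |Real.log (∑ σ, g σ * Real.exp (t σ))| ≤ κ := by
  have h := (convex_Icc (Real.exp (-κ)) (Real.exp κ)).sum_mem (t := Finset.univ) (w := g)
    (z := fun σ => Real.exp (t σ)) (fun σ _ => hg σ) hg1
    (fun σ _ => ⟨Real.exp_le_exp.2 (abs_le.1 (ht σ)).1, Real.exp_le_exp.2 (abs_le.1 (ht σ)).2⟩)
  simp only [smul_eq_mul] at h
  have hpos := (Real.exp_pos _).trans_le h.1
  rw [abs_le]
  exact ⟨(Real.le_log_iff_exp_le hpos).2 h.1, (Real.log_le_iff_le_exp hpos).2 h.2⟩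

/-- Shrinking `u, u'` by a factor `r < 1` does not spoil a bound on `log ((1 + u) / (1 + u'))`, as
`1 + r u` is the average of `1` and `1 + u` with the weights `1 - r` and `r`. -/
theorem abs_log_sub_log_shrink_le {κ a u u' r : ℝ} (ha : 0 < a) (hu : |u| < 1) (hu' : |u'| < 1)
    (h : |Real.log (a * (1 + u))| ≤ κ) (h' : |Real.log (a * (1 + u'))| ≤ κ) (hr : 0 ≤ r)
    (hr1 : r < 1) : |Real.log (1 + r * u) - Real.log (1 + r * u')| ≤ 2 * κ := by
  have key : ∀ u u' : ℝ, |u| < 1 → |u'| < 1 → |Real.log (a * (1 + u))| ≤ κ →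
      |Real.log (a * (1 + u'))| ≤ κ → Real.log (1 + r * u) ≤ 2 * κ + Real.log (1 + r * u') := by
    intro u u' hu hu' h h'
    have hu := (abs_lt.1 hu).1
    have hu' := (abs_lt.1 hu').1
    have hκ : 0 ≤ κ := (abs_nonneg _).trans h
    have p1 : 0 < a * (1 + u) := mul_pos ha (by linarith)
    have p2 : 0 < a * (1 + u') := mul_pos ha (by linarith)
    have q1 : 0 < 1 + r * u := by nlinarith
    have q2 : 0 < 1 + r * u' := by nlinarith
    have e1 := (Real.log_le_iff_le_exp p1).1 (abs_le.1 h).2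
    have e2 := (Real.le_log_iff_exp_le p2).1 (abs_le.1 h').1
    have e3 : 1 + u ≤ Real.exp (2 * κ) * (1 + u') := by
      have : a * (1 + u) ≤ a * (Real.exp (2 * κ) * (1 + u')) := by
        calc a * (1 + u) ≤ Real.exp κ := e1
          _ = Real.exp (2 * κ) * Real.exp (-κ) := by rw [← Real.exp_add]; ring_nf
          _ ≤ Real.exp (2 * κ) * (a * (1 + u')) := by gcongr
          _ = _ := by ring
      exact le_of_mul_le_mul_left this ha
    have e4 : 1 ≤ Real.exp (2 * κ) := Real.one_le_exp (by linarith)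
    rw [Real.log_le_iff_le_exp q1, Real.exp_add, Real.exp_log q2]
    nlinarith
  rw [abs_le]
  constructor
  · linarith [key u' u hu' hu h' h]
  · linarith [key u u' hu hu' h h']

/-! ### Averages with respect to fields -/

/-- The average of a function of one spin in the field `x`. -/
noncomputable def spinAvg (f : Spin → ℝ) (x : ℝ) : ℝ :=
  (∑ s, f s * Real.exp (x * spinVal s)) / ∑ s, Real.exp (x * spinVal s)

/-- The Gibbs weights of independent spins in the fields `x`. -/
noncomputable def fieldProb {n : ℕ} (x : Fin n → ℝ) (ε : Fin n → Spin) : ℝ :=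
  fieldWeight x ε / ∑ ε : Fin n → Spin, fieldWeight x ε

theorem fieldProb_nonneg {n : ℕ} (x : Fin n → ℝ) (ε : Fin n → Spin) : 0 ≤ fieldProb x ε :=
  div_nonneg (Real.exp_pos _).le (Finset.sum_nonneg fun _ _ => (Real.exp_pos _).le)

theorem sum_fieldProb {n : ℕ} (x : Fin n → ℝ) : ∑ ε, fieldProb x ε = 1 := by
  simp only [fieldProb]
  rw [← Finset.sum_div, div_self]
  exact (Finset.sum_pos (fun _ _ => Real.exp_pos _) Finset.univ_nonempty).ne'

theorem avg_eq_sum_fieldProb {n : ℕ} (F : Interaction n) (x : Fin n → ℝ) :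
    avg F x = ∑ ε, fieldProb x ε * F ε := by
  rw [avg, Finset.sum_div]
  exact Finset.sum_congr rfl fun ε _ => by rw [fieldProb]; ring

theorem avgMinus_eq_sum_fieldProb {n : ℕ} (F : Interaction n) (x : Fin (n - 1) → ℝ) (s : Spin) :
    avgMinus F x s = ∑ ε, fieldProb x ε * F (snocSpin ε s) := by
  rw [avgMinus, Finset.sum_div]
  exact Finset.sum_congr rfl fun ε _ => by rw [fieldProb]; ring

theorem sum_fieldProb_mul_prod {n : ℕ} (x : Fin n → ℝ) (f : Fin n → Spin → ℝ) :
    ∑ ε, fieldProb x ε * ∏ j, f j (ε j) = ∏ j, spinAvg (f j) (x j) := by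
  have hw : ∀ ε : Fin n → Spin, fieldWeight x ε = ∏ j, Real.exp (x j * spinVal (ε j)) := by
    intro ε; rw [fieldWeight, Real.exp_sum]
  simp only [fieldProb, spinAvg, Finset.prod_div_distrib, hw]
  rw [Finset.prod_univ_sum, Finset.prod_univ_sum]
  simp only [Fintype.piFinset_univ, div_mul_eq_mul_div]
  rw [← Finset.sum_div]
  congr 1
  refine Finset.sum_congr rfl fun ε _ => ?_
  rw [Finset.prod_mul_distrib, mul_comm]

theorem spinAvg_eq_sum (f : Spin → ℝ) (x : ℝ) :
    spinAvg f x = ∑ s, (Real.exp (x * spinVal s) / ∑ t, Real.exp (x * spinVal t)) * f s := by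
  rw [spinAvg, Finset.sum_div]
  exact Finset.sum_congr rfl fun s _ => by ring

theorem spinAvg_nonneg {f : Spin → ℝ} (hf : ∀ s, 0 ≤ f s) (x : ℝ) : 0 ≤ spinAvg f x :=
  div_nonneg (Finset.sum_nonneg fun s _ => mul_nonneg (hf s) (Real.exp_pos _).le)
    (Finset.sum_nonneg fun _ _ => (Real.exp_pos _).le)

theorem abs_spinAvg_le {f : Spin → ℝ} {K : ℝ} (hf : ∀ s, |f s| ≤ K) (x : ℝ) :
    |spinAvg f x| ≤ K := by
  have hp : 0 < ∑ t : Spin, Real.exp (x * spinVal t) :=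
    Finset.sum_pos (fun _ _ => Real.exp_pos _) Finset.univ_nonempty
  have h := (convex_Icc (-K) K).sum_mem (t := Finset.univ)
    (w := fun s => Real.exp (x * spinVal s) / ∑ t, Real.exp (x * spinVal t)) (z := f)
    (fun s _ => by positivity) (by rw [← Finset.sum_div, div_self hp.ne'])
    (fun s _ => abs_le.1 (hf s))
  rw [spinAvg_eq_sum, abs_le]
  simp only [smul_eq_mul] at h
  exact h

theorem prod_snocSpin {q : ℕ} (f : Fin (q + 1) → Spin → ℝ) (ε : Fin q → Spin) (s : Spin) :
    ∏ j, f j (snocSpin (p := q + 1) ε s j)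
      = (∏ j : Fin q, f j.castSucc (ε j)) * f (Fin.last q) s := by
  rw [Fin.prod_univ_castSucc]
  simp [snocSpin]

theorem measurable_avg {n : ℕ} :
    Measurable fun z : Interaction n × (Fin n → ℝ) => avg (boltzmann z.1) z.2 := by
  unfold avg boltzmann fieldWeight
  fun_prop

theorem measurable_avgMinus {n : ℕ} (s : Spin) : Measurable
    fun z : Interaction n × (Fin (n - 1) → ℝ) => avgMinus (boltzmann z.1) z.2 s := by
  unfold avgMinus boltzmann fieldWeight
  fun_prop

theorem abs_log_avg_le {n : ℕ} {κ : ℝ} {θ : Interaction n} (hθ : ∀ σ, |θ σ| ≤ κ)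
    (x : Fin n → ℝ) : |Real.log (avg (boltzmann θ) x)| ≤ κ := by
  rw [avg_eq_sum_fieldProb]
  exact abs_log_average_exp_le _ _ (fieldProb_nonneg x) (sum_fieldProb x) hθ

theorem abs_siteField_le {n : ℕ} {κ : ℝ} {θ : Interaction n} (hθ : ∀ σ, |θ σ| ≤ κ)
    (x : Fin (n - 1) → ℝ) (s : Spin) : |siteField θ x s| ≤ κ := by
  rw [siteField, avgMinus_eq_sum_fieldProb]
  exact abs_log_average_exp_le _ _ (fieldProb_nonneg x) (sum_fieldProb x) fun ε => hθ _

theorem avgMinus_pos {n : ℕ} (θ : Interaction n) (x : Fin (n - 1) → ℝ) (s : Spin) :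
    0 < avgMinus (boltzmann θ) x s :=
  div_pos (Finset.sum_pos (fun _ _ => mul_pos (Real.exp_pos _) (Real.exp_pos _))
    Finset.univ_nonempty) (Finset.sum_pos (fun _ _ => Real.exp_pos _) Finset.univ_nonempty)

/-! ### Replacing one interaction by fields, at independent half-edges -/

section OneStep

variable {H S : Type*} [Fintype S]

/-- `log ⟨exp θ(σ_{v_1}, …, σ_{v_n})⟩` for the weights `g`; `ev σ h` is the spin at `h`. -/
noncomputable def logEdge {n : ℕ} (g : S → ℝ) (ev : S → H → Spin) (θ : Interaction n)
    (v : Fin n → H) : ℝ :=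
  Real.log (∑ σ, g σ * Real.exp (θ fun j => ev σ (v j)))

/-- `log ⟨exp U(σ_h)⟩` for the weights `g`, where `U` is the field of `θ` and `x`. -/
noncomputable def logField {n : ℕ} (g : S → ℝ) (ev : S → H → Spin) (θ : Interaction n)
    (x : Fin (n - 1) → ℝ) (h : H) : ℝ :=
  Real.log (∑ σ, g σ * avgMinus (boltzmann θ) x (ev σ h))

theorem measurable_logEdge [Finite H] [MeasurableSpace H] [MeasurableSingletonClass H]
    {n : ℕ} (g : S → ℝ) (ev : S → H → Spin) :
    Measurable fun z : Interaction n × (Fin n → H) => logEdge g ev z.1 z.2 := by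
  refine measurable_from_prod_countable_left fun v => ?_
  unfold logEdge
  exact (Finset.measurable_fun_sum _ fun σ _ =>
    ((measurable_pi_apply (fun j => ev σ (v j))).exp).const_mul (g σ)).log

theorem measurable_logField [Finite H] [MeasurableSpace H] [MeasurableSingletonClass H]
    {n : ℕ} (g : S → ℝ) (ev : S → H → Spin) : Measurable
    fun z : (Interaction n × (Fin (n - 1) → ℝ)) × H => logField g ev z.1.1 z.1.2 z.2 := by
  refine measurable_from_prod_countable_left fun v => ?_
  unfold logField
  exact (Finset.measurable_fun_sum _ fun σ _ =>
    (measurable_avgMinus (ev σ v)).const_mul (g σ)).log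

theorem abs_logEdge_le {n : ℕ} {κ : ℝ} {g : S → ℝ} (hg : ∀ σ, 0 ≤ g σ) (hg1 : ∑ σ, g σ = 1)
    (ev : S → H → Spin) {θ : Interaction n} (hθ : ∀ σ, |θ σ| ≤ κ) (v : Fin n → H) :
    |logEdge g ev θ v| ≤ κ :=
  abs_log_average_exp_le _ _ hg hg1 fun _ => hθ _

theorem logField_eq {n : ℕ} (g : S → ℝ) (ev : S → H → Spin) (θ : Interaction n)
    (x : Fin (n - 1) → ℝ) (h : H) : logField g ev θ x h
      = Real.log (∑ σ, g σ * Real.exp (siteField θ x (ev σ h))) := by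
  unfold logField siteField
  simp only [Real.exp_log (avgMinus_pos θ x _)]

theorem abs_logField_le {n : ℕ} {κ : ℝ} {g : S → ℝ} (hg : ∀ σ, 0 ≤ g σ) (hg1 : ∑ σ, g σ = 1)
    (ev : S → H → Spin) {θ : Interaction n} (hθ : ∀ σ, |θ σ| ≤ κ) (x : Fin (n - 1) → ℝ) (h : H) :
    |logField g ev θ x h| ≤ κ := by
  rw [logField_eq]
  exact abs_log_average_exp_le _ _ hg hg1 fun _ => abs_siteField_le hθ _ _

variable {q : ℕ} {κ : ℝ} {Θ : Measure (Interaction (q + 1))} {β : Measure (ℝ × ℝ)}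
  {φ : Measure (Spin → ℝ)}

/-- Pointwise form of the three logarithms, for the triples `c j = (f j, (v j, x j))`. -/
theorem log_averages_eq {z : (ℝ × ℝ) × (Fin (q + 1) → Spin → ℝ)} (hz : IsAdmissible κ z)
    {g : S → ℝ} (hg : ∀ σ, 0 ≤ g σ) (hg1 : ∑ σ, g σ = 1) (ev : S → H → Spin)
    (v : Fin (q + 1) → H) (x : Fin (q + 1) → ℝ) :
    ∃ y₁ y₂ y₃ : ℝ, y₁ = z.1.2 * (∑ σ, g σ * ∏ j, z.2 j (ev σ (v j))) ∧
      y₂ = z.1.2 * ((∏ j : Fin q, spinAvg (z.2 j.castSucc) (x j.castSucc)) *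
        ∑ σ, g σ * z.2 (Fin.last q) (ev σ (v (Fin.last q)))) ∧
      y₃ = z.1.2 * ∏ j, spinAvg (z.2 j) (x j) ∧
      |y₁| < 1 ∧ |y₂| < 1 ∧ |y₃| < 1 ∧
      logEdge g ev (productInteraction z) v = Real.log (z.1.1 * (1 + y₁)) ∧
      logField g ev (productInteraction z) (fun j : Fin q => x j.castSucc) (v (Fin.last q))
        = Real.log (z.1.1 * (1 + y₂)) ∧
      Real.log (avg (boltzmann (productInteraction z)) x) = Real.log (z.1.1 * (1 + y₃)) := by
  set x' : Fin q → ℝ := fun j : Fin q => x j.castSucc with hx'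
  -- the weights of the second average live on pairs of a configuration and the other spins
  set g₂ : S × (Fin q → Spin) → ℝ := fun w => g w.1 * fieldProb x' w.2 with hg₂
  have g₂0 : ∀ w, 0 ≤ g₂ w := fun w => mul_nonneg (hg _) (fieldProb_nonneg _ _)
  have g₂1 : ∑ w, g₂ w = 1 := by
    rw [Fintype.sum_prod_type]
    simp only [hg₂, ← Finset.mul_sum]
    have : ∑ ε, fieldProb x' ε = 1 := sum_fieldProb x'
    simp only [this, mul_one, hg1]
  set ε₂ : S × (Fin q → Spin) → Fin (q + 1) → Spin :=
    fun w => snocSpin (p := q + 1) w.2 (ev w.1 (v (Fin.last q))) with hε₂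
  have e₂ : ∑ w, g₂ w * ∏ j, z.2 j (ε₂ w j)
      = (∏ j : Fin q, spinAvg (z.2 j.castSucc) (x j.castSucc)) *
        ∑ σ, g σ * z.2 (Fin.last q) (ev σ (v (Fin.last q))) := by
    rw [Fintype.sum_prod_type, Finset.mul_sum]
    refine Finset.sum_congr rfl fun σ _ => ?_
    simp only [hg₂, hε₂, prod_snocSpin]
    have h : ∑ ε, fieldProb x' ε * ∏ j : Fin q, z.2 j.castSucc (ε j)
        = ∏ j : Fin q, spinAvg (z.2 j.castSucc) (x j.castSucc) :=
      sum_fieldProb_mul_prod (n := q) x' fun j => z.2 j.castSucc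
    rw [← h, Finset.sum_mul]
    exact Finset.sum_congr rfl fun ε _ => by ring
  have e₃ := sum_fieldProb_mul_prod x z.2
  refine ⟨_, _, _, rfl, rfl, rfl, abs_average_lt_one hz g hg hg1 fun σ j => ev σ (v j), ?_, ?_,
    ?_, ?_, ?_⟩
  · rw [← e₂]; exact abs_average_lt_one hz g₂ g₂0 g₂1 ε₂
  · rw [← e₃]
    exact abs_average_lt_one hz (fieldProb x) (fieldProb_nonneg x) (sum_fieldProb x) fun ε => ε
  · rw [logEdge, sum_mul_exp_productInteraction hz g hg1 fun σ j => ev σ (v j)]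
  · rw [← e₂, ← sum_mul_exp_productInteraction hz g₂ g₂1 ε₂, logField, Fintype.sum_prod_type]
    congr 1
    refine Finset.sum_congr rfl fun σ _ => ?_
    rw [avgMinus_eq_sum_fieldProb, Finset.mul_sum]
    exact Finset.sum_congr rfl fun ε _ => by simp only [hg₂, hε₂, boltzmann]; ring
  · rw [← e₃, ← sum_mul_exp_productInteraction hz (fieldProb x) (sum_fieldProb x) fun ε => ε,
      avg_eq_sum_fieldProb]
    rfl

/-- Regrouping independent triples `(f j, (v j, x j))` into three independent families. -/
theorem measurePreserving_regroup {A B C D : Type*} [MeasurableSpace A] [MeasurableSpace B]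
    [MeasurableSpace C] [MeasurableSpace D] (β : Measure A) (φ : Measure B) (l : Measure C)
    (ζ : Measure D) [IsProbabilityMeasure β] [IsProbabilityMeasure φ] [IsProbabilityMeasure l]
    [IsProbabilityMeasure ζ] (n : ℕ) :
    MeasurePreserving (fun y : A × (Fin n → B × (C × D)) => (((y.1, fun j => (y.2 j).1) :
        A × (Fin n → B)), ((fun j => (y.2 j).2.1, fun j => (y.2 j).2.2) :
          (Fin n → C) × (Fin n → D))))
      (β.prod (Measure.pi fun _ => φ.prod (l.prod ζ)))
      ((β.prod (Measure.pi fun _ => φ)).prod ((Measure.pi fun _ => l).prod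
        (Measure.pi fun _ => ζ))) := by
  have m₁ := measurePreserving_arrowProdEquivProdArrow B (C × D) (Fin n)
    (fun _ => φ) (fun _ => l.prod ζ)
  have m₂ := measurePreserving_arrowProdEquivProdArrow C D (Fin n) (fun _ => l) (fun _ => ζ)
  have m₃ := (MeasurePreserving.id β).prod
    (((MeasurePreserving.id (Measure.pi fun _ : Fin n => φ)).prod m₂).comp m₁)
  have m₄ := (measurePreserving_prodAssoc β (Measure.pi fun _ : Fin n => φ)
    ((Measure.pi fun _ : Fin n => l).prod (Measure.pi fun _ : Fin n => ζ))).symm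
  exact m₄.comp m₃

theorem measurable_log_avg_prod {H : Type*} [MeasurableSpace H] (q : ℕ) :
    Measurable fun z : Interaction (q + 1) × ((Fin (q + 1) → H) × (Fin (q + 1) → ℝ)) =>
      Real.log (avg (boltzmann z.1) z.2.2) :=
  (measurable_avg.comp (measurable_fst.prodMk measurable_snd.snd)).log

section Measurability

variable [Finite H] [MeasurableSpace H] [MeasurableSingletonClass H]

theorem measurable_logEdge_prod (g : S → ℝ) (ev : S → H → Spin) (q : ℕ) :
    Measurable fun z : Interaction (q + 1) × ((Fin (q + 1) → H) × (Fin (q + 1) → ℝ)) =>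
      logEdge g ev z.1 z.2.1 :=
  (measurable_logEdge g ev).comp (measurable_fst.prodMk measurable_snd.fst)

theorem measurable_logField_prod (g : S → ℝ) (ev : S → H → Spin) (q : ℕ) :
    Measurable fun z : Interaction (q + 1) × ((Fin (q + 1) → H) × (Fin (q + 1) → ℝ)) =>
      logField g ev z.1 (fun j : Fin q => z.2.2 j.castSucc) (z.2.1 (Fin.last q)) := by
  have h : Measurable fun z : Interaction (q + 1) × ((Fin (q + 1) → H) × (Fin (q + 1) → ℝ)) =>
      ((z.1, (fun j : Fin q => z.2.2 j.castSucc)), z.2.1 (Fin.last q)) := by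
    refine (measurable_fst.prodMk ?_).prodMk ?_
    · exact measurable_pi_lambda _ fun j =>
        (measurable_pi_apply (Fin.castSucc j)).comp measurable_snd.snd
    · exact (measurable_pi_apply (Fin.last q)).comp measurable_snd.fst
  have h' : Measurable fun z : (Interaction (q + 1) × (Fin (q + 1 - 1) → ℝ)) × H =>
      logField (n := q + 1) g ev z.1.1 z.1.2 z.2 := measurable_logField (n := q + 1) g ev
  have h'' : Measurable fun z : (Interaction (q + 1) × (Fin q → ℝ)) × H =>
      logField (n := q + 1) g ev z.1.1 z.1.2 z.2 := h'
  have := h''.comp h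
  simp only [Function.comp_def] at this
  exact this

end Measurability

/-- Compared with `q + 1` fields, an interaction contributes at most the bulk term, when all the
half-edges are drawn independently. -/
theorem integral_logEdge_le [Finite H] [MeasurableSpace H] [MeasurableSingletonClass H]
    (hΘ : IsProductLaw κ Θ β φ) (l : Measure H) [IsProbabilityMeasure l]
    (ζ : Measure ℝ) [IsProbabilityMeasure ζ] {g : S → ℝ} (hg : ∀ σ, 0 ≤ g σ)
    (hg1 : ∑ σ, g σ = 1) (ev : S → H → Spin) :
    ∫ z : Interaction (q + 1) × ((Fin (q + 1) → H) × (Fin (q + 1) → ℝ)),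
      (logEdge g ev z.1 z.2.1
        - (q + 1) * logField g ev z.1 (fun j : Fin q => z.2.2 j.castSucc) (z.2.1 (Fin.last q))
        + q * Real.log (avg (boltzmann z.1) z.2.2))
      ∂(Θ.prod ((Measure.pi fun _ => l).prod (Measure.pi fun _ => ζ))) ≤ 0 := by
  have := hΘ.prob_β
  have := hΘ.prob_φ
  set χ : Measure ((Spin → ℝ) × (H × ℝ)) := φ.prod (l.prod ζ) with hχ
  set π := β.prod (Measure.pi fun _ : Fin (q + 1) => χ) with hπ
  set u : (ℝ × ℝ) × (Fin (q + 1) → (Spin → ℝ) × (H × ℝ)) → (ℝ × ℝ) × (Fin (q + 1) → Spin → ℝ) :=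
    fun y => (y.1, fun j => (y.2 j).1) with hu
  set w : (ℝ × ℝ) × (Fin (q + 1) → (Spin → ℝ) × (H × ℝ)) →
    (Fin (q + 1) → H) × (Fin (q + 1) → ℝ) :=
    fun y => (fun j => (y.2 j).2.1, fun j => (y.2 j).2.2) with hw
  have hΨ : MeasurePreserving (fun y => (u y, w y)) π
      ((β.prod (Measure.pi fun _ => φ)).prod ((Measure.pi fun _ => l).prod
        (Measure.pi fun _ => ζ))) :=
    measurePreserving_regroup β φ l ζ (q + 1)
  have hΘ' : MeasurePreserving (fun y => (productInteraction (u y), w y)) π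
      (Θ.prod ((Measure.pi fun _ => l).prod (Measure.pi fun _ => ζ))) := by
    have m₁ : MeasurePreserving productInteraction (β.prod (Measure.pi fun _ => φ)) Θ :=
      ⟨measurable_productInteraction, hΘ.map_eq⟩
    exact (m₁.prod (MeasurePreserving.id _)).comp hΨ
  have hadm : ∀ᵐ y ∂π, IsAdmissible κ (u y) :=
    (measurePreserving_fst.comp hΨ).quasiMeasurePreserving.ae hΘ.admissible
  have hmeas : Measurable fun z : Interaction (q + 1) × ((Fin (q + 1) → H) × (Fin (q + 1) → ℝ)) =>
      (logEdge g ev z.1 z.2.1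
        - (q + 1) * logField g ev z.1 (fun j : Fin q => z.2.2 j.castSucc) (z.2.1 (Fin.last q))
        + q * Real.log (avg (boltzmann z.1) z.2.2)) :=
    ((measurable_logEdge_prod g ev q).sub
      ((measurable_logField_prod g ev q).const_mul _)).add ((measurable_log_avg_prod q).const_mul _)
  rw [← hΘ'.map_eq, integral_map hΘ'.measurable.aemeasurable hmeas.aestronglyMeasurable]
  -- the functions of the triples `(f j, (v j, x j))` that enter the moments
  set F : (Spin → ℝ) × (H × ℝ) → S → ℝ := fun c σ => c.1 (ev σ c.2.1) with hF
  set X : (Spin → ℝ) × (H × ℝ) → ℝ := fun c => spinAvg c.1 c.2.2 with hX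
  have hFm : ∀ σ, Measurable fun c => F c σ := by
    intro σ
    have h : Measurable fun d : ((Spin → ℝ) × ℝ) × H => d.1.1 (ev σ d.2) :=
      measurable_from_prod_countable_left fun h =>
        (measurable_pi_apply (ev σ h)).comp measurable_fst
    have h' : Measurable fun c : (Spin → ℝ) × (H × ℝ) => ((c.1, c.2.2), c.2.1) := by fun_prop
    have := h.comp h'
    simp only [Function.comp_def] at this
    exact this
  have hXm : Measurable X := by
    simp only [hX]; unfold spinAvg; fun_prop
  set y₁ : (ℝ × ℝ) × (Fin (q + 1) → (Spin → ℝ) × (H × ℝ)) → ℝ :=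
    fun y => y.1.2 * (∑ σ, g σ * ∏ j, F (y.2 j) σ) with hy₁
  set y₂ : (ℝ × ℝ) × (Fin (q + 1) → (Spin → ℝ) × (H × ℝ)) → ℝ :=
    fun y => y.1.2 * ((∏ j : Fin q, X (y.2 j.castSucc)) * ∑ σ, g σ * F (y.2 (Fin.last q)) σ)
    with hy₂
  set y₃ : (ℝ × ℝ) × (Fin (q + 1) → (Spin → ℝ) × (H × ℝ)) → ℝ :=
    fun y => y.1.2 * ∏ j, X (y.2 j) with hy₃
  have hFm' : ∀ (j : Fin (q + 1)) (σ : S), Measurable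
      fun y : (ℝ × ℝ) × (Fin (q + 1) → (Spin → ℝ) × (H × ℝ)) => F (y.2 j) σ :=
    fun j σ => (hFm σ).comp ((measurable_pi_apply j).comp measurable_snd)
  have hXm' : ∀ j : Fin (q + 1), Measurable
      fun y : (ℝ × ℝ) × (Fin (q + 1) → (Spin → ℝ) × (H × ℝ)) => X (y.2 j) :=
    fun j => hXm.comp ((measurable_pi_apply j).comp measurable_snd)
  have key : ∀ᵐ y ∂π, 0 < (u y).1.1 ∧ (|y₁ y| < 1 ∧ |y₂ y| < 1 ∧ |y₃ y| < 1) ∧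
      |Real.log ((u y).1.1 * (1 + y₁ y))| ≤ κ ∧ |Real.log ((u y).1.1 * (1 + y₂ y))| ≤ κ ∧
      |Real.log ((u y).1.1 * (1 + y₃ y))| ≤ κ ∧
      logEdge g ev (productInteraction (u y)) (w y).1 = Real.log ((u y).1.1 * (1 + y₁ y)) ∧
      logField g ev (productInteraction (u y)) (fun j : Fin q => (w y).2 j.castSucc)
        ((w y).1 (Fin.last q)) = Real.log ((u y).1.1 * (1 + y₂ y)) ∧
      Real.log (avg (boltzmann (productInteraction (u y))) (w y).2)
        = Real.log ((u y).1.1 * (1 + y₃ y)) := by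
    filter_upwards [hadm] with y hy
    obtain ⟨t₁, t₂, t₃, e₁, e₂, e₃, l₁, l₂, l₃, d₁, d₂, d₃⟩ :=
      log_averages_eq hy hg hg1 ev (w y).1 (w y).2
    have f₁ : y₁ y = t₁ := e₁.symm
    have f₂ : y₂ y = t₂ := e₂.symm
    have f₃ : y₃ y = t₃ := e₃.symm
    rw [f₁, f₂, f₃]
    have hb : ∀ σ, |productInteraction (u y) σ| ≤ κ := fun σ => (hy.2 σ).2
    refine ⟨hy.1, ⟨l₁, l₂, l₃⟩, ?_, ?_, ?_, d₁, d₂, d₃⟩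
    · rw [← d₁]; exact abs_logEdge_le hg hg1 ev hb _
    · rw [← d₂]; exact abs_logField_le hg hg1 ev hb _ _
    · rw [← d₃]; exact abs_log_avg_le hb _
  have hcongr : ∫ y, (logEdge g ev (productInteraction (u y)) (w y).1
        - (q + 1) * logField g ev (productInteraction (u y))
          (fun j : Fin q => (w y).2 j.castSucc) ((w y).1 (Fin.last q))
        + q * Real.log (avg (boltzmann (productInteraction (u y))) (w y).2)) ∂π
      = ∫ y, (Real.log (1 + y₁ y) - (q + 1) * Real.log (1 + y₂ y)
        + q * Real.log (1 + y₃ y)) ∂π := by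
    refine integral_congr_ae ?_
    filter_upwards [key] with y hy
    obtain ⟨ha, ⟨l₁, l₂, l₃⟩, -, -, -, d₁, d₂, d₃⟩ := hy
    rw [d₁, d₂, d₃, Real.log_mul ha.ne' (by linarith [(abs_lt.1 l₁).1]),
      Real.log_mul ha.ne' (by linarith [(abs_lt.1 l₂).1]),
      Real.log_mul ha.ne' (by linarith [(abs_lt.1 l₃).1])]
    ring
  rw [hcongr]
  refine integral_log_combination_nonpos π y₁ y₂ y₃ ?_ ?_ ?_ (key.mono fun y hy => hy.2.1.1)
    (key.mono fun y hy => hy.2.1.2.1) (key.mono fun y hy => hy.2.1.2.2) q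
    ((q + 1) * (2 * κ)) ?_ ?_
  · exact measurable_fst.snd.mul (Finset.measurable_fun_sum _ fun σ _ =>
      (Finset.measurable_fun_prod _ fun j _ => hFm' j σ).const_mul _)
  · exact measurable_fst.snd.mul ((Finset.measurable_fun_prod _ fun j _ => hXm' _).mul
      (Finset.measurable_fun_sum _ fun σ _ => (hFm' _ σ).const_mul _))
  · exact measurable_fst.snd.mul (Finset.measurable_fun_prod _ fun j _ => hXm' j)
  · intro n hn
    have e : ∀ y : (ℝ × ℝ) × (Fin (q + 1) → (Spin → ℝ) × (H × ℝ)),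
        (-y₁ y) ^ n - (q + 1) * (-y₂ y) ^ n + q * (-y₃ y) ^ n
        = (-y.1.2) ^ n * ((∑ σ, g σ * ∏ j, F (y.2 j) σ) ^ n
        - (q + 1) * ((∏ j : Fin q, X (y.2 j.castSucc)) * ∑ σ, g σ * F (y.2 (Fin.last q)) σ) ^ n
        + q * (∏ j, X (y.2 j)) ^ n) := by
      intro y
      simp only [hy₁, hy₂, hy₃, ← neg_mul, mul_pow]
      ring
    simp_rw [e]
    rw [hπ, integral_prod_mul (fun ab : ℝ × ℝ => (-ab.2) ^ n) fun c : Fin (q + 1) → _ =>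
      (∑ σ, g σ * ∏ j, F (c j) σ) ^ n
        - (q + 1) * ((∏ j : Fin q, X (c j.castSucc)) * ∑ σ, g σ * F (c (Fin.last q)) σ) ^ n
        + q * (∏ j, X (c j)) ^ n]
    rcases hΘ.zero_or_bounded with h0 | ⟨K, hK⟩
    · have : ∫ ab, (-ab.2) ^ n ∂β = 0 := by
        rw [integral_eq_zero_of_ae]
        filter_upwards [h0] with ab hab
        simp [hab, Nat.one_le_iff_ne_zero.1 hn]
      rw [this, zero_mul]
    · refine mul_nonneg (hΘ.moment_nonneg n hn) ?_
      have hq : Measure.QuasiMeasurePreserving Prod.fst χ φ := Measure.quasiMeasurePreserving_fst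
      refine integral_replica_moment_nonneg χ F X g hFm hXm K ?_ ?_ hg hg1 q n
        (hΘ.even_or_nonneg.imp_right fun hp => ⟨?_, ?_⟩)
      · filter_upwards [hq.ae hK] with c hc σ using hc _
      · filter_upwards [hq.ae hK] with c hc using abs_spinAvg_le hc _
      · filter_upwards [hq.ae hp] with c hc σ using hc _
      · filter_upwards [hq.ae hp] with c hc using spinAvg_nonneg hc _
  · filter_upwards [key] with y hy r hr hr1
    obtain ⟨ha, ⟨l₁, l₂, l₃⟩, k₁, k₂, k₃, -⟩ := hy
    have b₁ := abs_log_sub_log_shrink_le ha l₁ l₂ k₁ k₂ hr hr1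
    have b₃ := abs_log_sub_log_shrink_le ha l₃ l₂ k₃ k₂ hr hr1
    have e : Real.log (1 + r * y₁ y) - (q + 1) * Real.log (1 + r * y₂ y)
        + q * Real.log (1 + r * y₃ y) = (Real.log (1 + r * y₁ y) - Real.log (1 + r * y₂ y))
        + q * (Real.log (1 + r * y₃ y) - Real.log (1 + r * y₂ y)) := by ring
    rw [e]
    refine (abs_add_le _ _).trans ?_
    rw [abs_mul, Nat.abs_cast]
    have := mul_le_mul_of_nonneg_left b₃ (q.cast_nonneg : (0 : ℝ) ≤ q)
    linarith

end OneStep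

/-! ### Random factors placed on distinct random half-edges -/

theorem abs_sum_div_card_le {α : Type*} (s : Finset α) (f : α → ℝ) {c : ℝ} (hc : 0 ≤ c)
    (h : ∀ i ∈ s, |f i| ≤ c) : |(∑ i ∈ s, f i) / s.card| ≤ c := by
  rw [abs_div, Nat.abs_cast]
  refine div_le_of_le_mul₀ (by positivity) hc ?_
  calc |∑ i ∈ s, f i| ≤ ∑ i ∈ s, |f i| := Finset.abs_sum_le_sum_abs _ _
    _ ≤ ∑ _i ∈ s, c := Finset.sum_le_sum h
    _ = c * s.card := by simp [mul_comm]

/-- A random interaction of `arity` spins, given by its law. Both the interactions of the edges and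
the cavity fields (of arity one) are factors in this sense. -/
structure Factor where
  /-- the number of spins -/
  arity : ℕ
  /-- the law of the interaction -/
  law : Measure (Interaction arity)

/-- The law of the factor is a probability measure on interactions bounded by `κ`. -/
def Factor.IsBounded (κ : ℝ) (t : Factor) : Prop :=
  IsProbabilityMeasure t.law ∧ ∀ᵐ θ ∂t.law, ∀ σ, |θ σ| ≤ κ

/-- The number of half-edges that the factors in a list occupy. -/
def totalArity (l : List Factor) : ℕ := (l.map Factor.arity).sum

@[simp] theorem totalArity_nil : totalArity [] = 0 := rfl

@[simp] theorem totalArity_cons (t : Factor) (l : List Factor) :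
    totalArity (t :: l) = t.arity + totalArity l := by simp [totalArity]

@[simp] theorem totalArity_append (l l' : List Factor) :
    totalArity (l ++ l') = totalArity l + totalArity l' := by simp [totalArity]

@[simp] theorem totalArity_replicate (n : ℕ) (t : Factor) :
    totalArity (List.replicate n t) = n * t.arity := by simp [totalArity]

section Placement

variable {ι H : Type*} [Fintype ι] [DecidableEq ι] [Fintype H] [DecidableEq H]

/-- The log-partition function of the energy `u`. -/
noncomputable def logZ (u : (ι → Spin) → ℝ) : ℝ := Real.log (∑ σ, Real.exp (u σ))

theorem sum_exp_pos (u : (ι → Spin) → ℝ) : 0 < ∑ σ, Real.exp (u σ) :=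
  Finset.sum_pos (fun _ _ => Real.exp_pos _) Finset.univ_nonempty

theorem abs_logZ_sub_le {u u' : (ι → Spin) → ℝ} {c : ℝ} (h : ∀ σ, |u σ - u' σ| ≤ c) :
    |logZ u - logZ u'| ≤ c := by
  have key : ∀ u u' : (ι → Spin) → ℝ, (∀ σ, |u σ - u' σ| ≤ c) → logZ u ≤ c + logZ u' := by
    intro u u' h
    rw [logZ, Real.log_le_iff_le_exp (sum_exp_pos u), Real.exp_add, logZ,
      Real.exp_log (sum_exp_pos u'), Finset.mul_sum]
    refine Finset.sum_le_sum fun σ _ => ?_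
    rw [← Real.exp_add, Real.exp_le_exp]
    linarith [(abs_le.1 (h σ)).2]
  rw [abs_le]
  constructor
  · linarith [key u' u fun σ => by rw [abs_sub_comm]; exact h σ]
  · linarith [key u u' h]

/-- The energy `u` with the interaction `θ` added at the half-edges `v`. -/
def attach (s : H → ι) (u : (ι → Spin) → ℝ) {r : ℕ} (v : Fin r → H) (θ : Interaction r) :
    (ι → Spin) → ℝ :=
  fun σ => u σ + θ fun j => σ (s (v j))

/-- The placements of a factor of arity `r` on distinct half-edges outside `A`. -/
def places (A : Finset H) (r : ℕ) : Finset (Fin r → H) :=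
  Finset.univ.filter fun v => Function.Injective v ∧ ∀ j, v j ∉ A

theorem mem_places {A : Finset H} {r : ℕ} {v : Fin r → H} :
    v ∈ places A r ↔ Function.Injective v ∧ ∀ j, v j ∉ A := by simp [places]

theorem card_places (A : Finset H) (r : ℕ) :
    (places A r).card = (Fintype.card H - A.card).descFactorial r := by
  have e : {v : Fin r → H // Function.Injective v ∧ ∀ j, v j ∉ A} ≃ (Fin r ↪ {h // h ∉ A}) :=
    { toFun := fun v => ⟨fun j => ⟨v.1 j, v.2.2 j⟩, fun i j hij => v.2.1 (congrArg Subtype.val hij)⟩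
      invFun := fun w => ⟨fun j => (w j).1, fun i j hij => w.2 (Subtype.ext hij),
        fun j => (w j).2⟩
      left_inv := fun v => rfl
      right_inv := fun w => rfl }
  rw [places, ← Fintype.card_subtype, Fintype.card_congr e, Fintype.card_embedding_eq,
    Fintype.card_fin]
  congr 1
  rw [Fintype.card_subtype_compl]
  simp

theorem card_union_image {A : Finset H} {r : ℕ} {v : Fin r → H} (hv : v ∈ places A r) :
    (A ∪ Finset.univ.image v).card = A.card + r := by
  rw [mem_places] at hv
  rw [Finset.card_union_of_disjoint, Finset.card_image_of_injective _ hv.1, Finset.card_univ,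
    Fintype.card_fin]
  rw [Finset.disjoint_right]
  intro h hh
  obtain ⟨j, -, rfl⟩ := Finset.mem_image.1 hh
  exact hv.2 j

/-- The mean log-partition function after placing the factors of the list one after the other, each
of them on a uniform random tuple of distinct half-edges outside the set of the half-edges used so
far, which is `A` at the beginning. -/
noncomputable def meanLogZ (s : H → ι) : List Factor → Finset H → ((ι → Spin) → ℝ) → ℝ
  | [], _, u => logZ u
  | t :: l, A, u => (∑ v ∈ places A t.arity,
      ∫ θ, meanLogZ s l (A ∪ Finset.univ.image v) (attach s u v θ) ∂t.law) /
        ((places A t.arity).card : ℝ)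

theorem continuous_attach {ι H : Type*} (s : H → ι) {r : ℕ} (v : Fin r → H) :
    Continuous fun z : ((ι → Spin) → ℝ) × Interaction r => attach s z.1 v z.2 := by
  unfold attach; fun_prop

theorem continuous_of_abs_sub_le {f : ((ι → Spin) → ℝ) → ℝ}
    (h : ∀ u u' c, (∀ σ, |u σ - u' σ| ≤ c) → |f u - f u'| ≤ c) : Continuous f := by
  refine LipschitzWith.continuous (K := 1) (LipschitzWith.of_dist_le_mul fun u u' => ?_)
  rw [NNReal.coe_one, one_mul, Real.dist_eq]
  exact h u u' _ fun σ => by rw [← Real.dist_eq]; exact dist_le_pi_dist u u' σ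

theorem integrable_comp_attach {ι H : Type*} [Fintype ι] [DecidableEq ι] {f : ((ι → Spin) → ℝ) → ℝ}
    (h : ∀ u u' c, (∀ σ, |u σ - u' σ| ≤ c) → |f u - f u'| ≤ c) {κ : ℝ} {t : Factor}
    (ht : t.IsBounded κ) (s : H → ι) (u : (ι → Spin) → ℝ) (v : Fin t.arity → H) :
    Integrable (fun θ => f (attach s u v θ)) t.law := by
  have := ht.1
  have hc : Continuous fun θ => f (attach s u v θ) :=
    (continuous_of_abs_sub_le h).comp ((continuous_attach s v).comp (by fun_prop :
      Continuous fun θ : Interaction t.arity => (u, θ)))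
  refine Integrable.of_bound hc.measurable.aestronglyMeasurable (|f u| + κ) ?_
  filter_upwards [ht.2] with θ hθ
  have h1 := h (attach s u v θ) u κ fun σ => by simpa [attach] using hθ _
  rw [Real.norm_eq_abs]
  have h2 := abs_sub_abs_le_abs_sub (f (attach s u v θ)) (f u)
  linarith

theorem abs_meanLogZ_sub_le (s : H → ι) {κ : ℝ} {l : List Factor} (hl : ∀ t ∈ l, t.IsBounded κ)
    (A : Finset H) (u u' : (ι → Spin) → ℝ) (c : ℝ) (h : ∀ σ, |u σ - u' σ| ≤ c) :
    |meanLogZ s l A u - meanLogZ s l A u'| ≤ c := by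
  induction l generalizing A u u' c with
  | nil => exact abs_logZ_sub_le h
  | cons t l ih =>
    have hl' : ∀ t ∈ l, t.IsBounded κ := fun t ht => hl t (List.mem_cons_of_mem _ ht)
    have ht := hl t List.mem_cons_self
    have := ht.1
    have hc : 0 ≤ c := (abs_nonneg _).trans (h fun _ => 1)
    simp only [meanLogZ]
    rw [← sub_div, ← Finset.sum_sub_distrib]
    refine abs_sum_div_card_le _ _ hc fun v _ => ?_
    rw [← integral_sub (integrable_comp_attach (fun u u' c h => ih hl' _ u u' c h) ht s u v)
      (integrable_comp_attach (fun u u' c h => ih hl' _ u u' c h) ht s u' v), ← Real.norm_eq_abs]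
    refine (norm_integral_le_of_norm_le_const (C := c) (Eventually.of_forall fun θ => ?_)).trans
      (by simp)
    exact ih hl' _ _ _ _ fun σ => by simpa [attach] using h σ

theorem continuous_meanLogZ (s : H → ι) {κ : ℝ} {l : List Factor}
    (hl : ∀ t ∈ l, t.IsBounded κ) (A : Finset H) : Continuous (meanLogZ s l A) :=
  continuous_of_abs_sub_le fun u u' c h => abs_meanLogZ_sub_le s hl A u u' c h

theorem integrable_meanLogZ_attach (s : H → ι) {κ : ℝ} {l : List Factor}
    (hl : ∀ t ∈ l, t.IsBounded κ) {t : Factor} (ht : t.IsBounded κ) (A : Finset H)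
    (u : (ι → Spin) → ℝ) (v : Fin t.arity → H) :
    Integrable (fun θ => meanLogZ s l A (attach s u v θ)) t.law :=
  integrable_comp_attach (fun u u' c h => abs_meanLogZ_sub_le s hl A u u' c h) ht s u v

theorem integrable_meanLogZ_attach_attach (s : H → ι) {κ : ℝ} {l : List Factor}
    (hl : ∀ t ∈ l, t.IsBounded κ) {t t' : Factor} (ht : t.IsBounded κ) (ht' : t'.IsBounded κ)
    (A : Finset H) (u : (ι → Spin) → ℝ) (v : Fin t.arity → H) (v' : Fin t'.arity → H) :
    Integrable (fun z : Interaction t.arity × Interaction t'.arity =>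
      meanLogZ s l A (attach s (attach s u v z.1) v' z.2)) (t.law.prod t'.law) := by
  have := ht.1
  have := ht'.1
  have hc : Continuous fun z : Interaction t.arity × Interaction t'.arity =>
      meanLogZ s l A (attach s (attach s u v z.1) v' z.2) := by
    refine (continuous_meanLogZ s hl A).comp ?_
    unfold attach; fun_prop
  refine Integrable.of_bound hc.measurable.aestronglyMeasurable (|meanLogZ s l A u| + (κ + κ)) ?_
  have q₁ : Measure.QuasiMeasurePreserving Prod.fst (t.law.prod t'.law) t.law :=
    Measure.quasiMeasurePreserving_fst
  have q₂ : Measure.QuasiMeasurePreserving Prod.snd (t.law.prod t'.law) t'.law :=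
    Measure.quasiMeasurePreserving_snd
  filter_upwards [q₁.ae ht.2, q₂.ae ht'.2] with z h₁ h₂
  have h1 := abs_meanLogZ_sub_le s hl A (attach s (attach s u v z.1) v' z.2) u (κ + κ) fun σ => by
    have : attach s (attach s u v z.1) v' z.2 σ - u σ
        = (z.1 fun j => σ (s (v j))) + z.2 fun j => σ (s (v' j)) := by
      simp only [attach]; ring
    rw [this]
    exact (abs_add_le _ _).trans (add_le_add (h₁ _) (h₂ _))
  rw [Real.norm_eq_abs]
  have h2 := abs_sub_abs_le_abs_sub (meanLogZ s l A (attach s (attach s u v z.1) v' z.2))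
    (meanLogZ s l A u)
  linarith

theorem meanLogZ_cons_cons (s : H → ι) {κ : ℝ} {l : List Factor}
    (hl : ∀ t ∈ l, t.IsBounded κ) {t t' : Factor} (ht : t.IsBounded κ) (ht' : t'.IsBounded κ)
    (A : Finset H) (u : (ι → Spin) → ℝ) : meanLogZ s (t :: t' :: l) A u
      = (∑ v ∈ places A t.arity, ∑ v' ∈ places (A ∪ Finset.univ.image v) t'.arity,
          ∫ θ, ∫ θ', meanLogZ s l (A ∪ Finset.univ.image v ∪ Finset.univ.image v')
            (attach s (attach s u v θ) v' θ') ∂t'.law ∂t.law) /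
        (((Fintype.card H - A.card).descFactorial (t.arity + t'.arity) : ℕ) : ℝ) := by
  have := ht.1
  have := ht'.1
  simp only [meanLogZ]
  have h : ∀ v ∈ places A t.arity,
      ∫ θ, (∑ v' ∈ places (A ∪ Finset.univ.image v) t'.arity,
        ∫ θ', meanLogZ s l (A ∪ Finset.univ.image v ∪ Finset.univ.image v')
            (attach s (attach s u v θ) v' θ') ∂t'.law) /
          ((places (A ∪ Finset.univ.image v) t'.arity).card : ℝ) ∂t.law
      = (∑ v' ∈ places (A ∪ Finset.univ.image v) t'.arity,
          ∫ θ, ∫ θ', meanLogZ s l (A ∪ Finset.univ.image v ∪ Finset.univ.image v')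
            (attach s (attach s u v θ) v' θ') ∂t'.law ∂t.law) /
        (((Fintype.card H - A.card - t.arity).descFactorial t'.arity : ℕ) : ℝ) := by
    intro v hv
    rw [integral_div, card_places, card_union_image hv, Nat.sub_add_eq, integral_finsetSum]
    intro v' _
    exact (integrable_meanLogZ_attach_attach s hl ht ht' _ u v v').integral_prod_left
  rw [Finset.sum_congr rfl h, ← Finset.sum_div, div_div, card_places]
  congr 1
  have h' := Nat.descFactorial_mul_descFactorial (n := Fintype.card H - A.card)
    (Nat.le_add_right t.arity t'.arity)
  rw [Nat.add_sub_cancel_left] at h'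
  rw [← Nat.cast_mul, ← h']

theorem meanLogZ_swap (s : H → ι) {κ : ℝ} {l : List Factor}
    (hl : ∀ t ∈ l, t.IsBounded κ) {t t' : Factor} (ht : t.IsBounded κ) (ht' : t'.IsBounded κ)
    (A : Finset H) (u : (ι → Spin) → ℝ) :
    meanLogZ s (t :: t' :: l) A u = meanLogZ s (t' :: t :: l) A u := by
  have := ht.1
  have := ht'.1
  rw [meanLogZ_cons_cons s hl ht ht', meanLogZ_cons_cons s hl ht' ht, add_comm t'.arity]
  congr 1
  rw [Finset.sum_comm' (t' := places A t'.arity)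
    (s' := fun v' => places (A ∪ Finset.univ.image v') t.arity)]
  · refine Finset.sum_congr rfl fun v' _ => Finset.sum_congr rfl fun v _ => ?_
    rw [integral_integral_swap (integrable_meanLogZ_attach_attach s hl ht ht' _ u v v')]
    refine integral_congr_ae (Eventually.of_forall fun θ' =>
      integral_congr_ae (Eventually.of_forall fun θ => ?_))
    have e : attach s (attach s u v θ) v' θ' = attach s (attach s u v' θ') v θ := by
      funext σ; simp only [attach]; ring
    simp only [e, Finset.union_right_comm]
  · intro v v'
    simp only [mem_places, Finset.mem_union, Finset.mem_image, Finset.mem_univ, true_and, not_or,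
      not_exists]
    constructor
    · rintro ⟨⟨h₁, h₂⟩, h₃, h₄⟩
      exact ⟨⟨h₁, fun j => ⟨h₂ j, fun i hi => (h₄ i).2 j hi.symm⟩⟩, h₃, fun j => (h₄ j).1⟩
    · rintro ⟨⟨h₁, h₂⟩, h₃, h₄⟩
      exact ⟨⟨h₁, fun j => (h₂ j).1⟩, h₃, fun j => ⟨h₄ j, fun i hi => (h₂ i).2 j hi.symm⟩⟩

/-- The factors may be placed in any order. -/
theorem meanLogZ_perm (s : H → ι) {κ : ℝ} {l l' : List Factor} (h : l.Perm l')
    (hl : ∀ t ∈ l, t.IsBounded κ) (A : Finset H) (u : (ι → Spin) → ℝ) :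
    meanLogZ s l A u = meanLogZ s l' A u := by
  induction h generalizing A u with
  | nil => rfl
  | cons t h ih =>
    simp only [meanLogZ]
    congr 1
    refine Finset.sum_congr rfl fun v _ => integral_congr_ae (Eventually.of_forall fun θ => ?_)
    exact ih (fun t ht => hl t (List.mem_cons_of_mem _ ht)) _ _
  | swap t t' l =>
    simp only [List.mem_cons, forall_eq_or_imp] at hl
    exact meanLogZ_swap s hl.2.2 hl.1 hl.2.1 A u
  | trans h₁ _ ih₁ ih₂ =>
    rw [ih₁ hl, ih₂ fun t ht => hl t (h₁.mem_iff.2 ht)]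

/-- A linear inequality between lists of factors that holds for every energy and every set of the
given number of used half-edges remains true after a common initial list is added. -/
theorem sum_mul_meanLogZ_append_le (s : H → ι) {κ : ℝ} {K : Type*} [Fintype K] (c : K → ℝ)
    (x : K → List Factor) (hx : ∀ k, ∀ t ∈ x k, t.IsBounded κ) {l : List Factor}
    (hl : ∀ t ∈ l, t.IsBounded κ) (C : ℝ) (A : Finset H) (u : (ι → Spin) → ℝ)
    (hfit : A.card + totalArity l ≤ Fintype.card H)
    (h : ∀ (A' : Finset H) (u' : (ι → Spin) → ℝ), A'.card = A.card + totalArity l →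
      ∑ k, c k * meanLogZ s (x k) A' u' ≤ C) :
    ∑ k, c k * meanLogZ s (l ++ x k) A u ≤ C := by
  induction l generalizing A u with
  | nil => exact h A u (by simp)
  | cons t l ih =>
    have hl' : ∀ t ∈ l, t.IsBounded κ := fun t ht => hl t (List.mem_cons_of_mem _ ht)
    have ht := hl t List.mem_cons_self
    have := ht.1
    rw [totalArity_cons] at hfit h
    have hb : ∀ k, ∀ t ∈ l ++ x k, t.IsBounded κ := by
      intro k t ht
      rcases List.mem_append.1 ht with ht | ht
      exacts [hl' t ht, hx k t ht]
    have hpos : (0 : ℝ) < (places A t.arity).card := by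
      rw [card_places, Nat.cast_pos]
      exact Nat.descFactorial_pos.2 (by omega)
    simp only [List.cons_append, meanLogZ, ← mul_div_assoc]
    rw [← Finset.sum_div, div_le_iff₀ hpos]
    simp only [Finset.mul_sum]
    rw [Finset.sum_comm]
    calc _ ≤ ∑ v ∈ places A t.arity, C := Finset.sum_le_sum fun v hv => ?_
      _ = _ := by simp [mul_comm]
    have hi : ∀ k ∈ Finset.univ, Integrable (fun θ => c k *
        meanLogZ s (l ++ x k) (A ∪ Finset.univ.image v) (attach s u v θ)) t.law :=
      fun k _ => (integrable_meanLogZ_attach s (hb k) ht _ u v).const_mul _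
    simp only [← integral_const_mul]
    rw [← integral_finsetSum _ hi]
    have hcard := card_union_image hv
    calc _ ≤ ∫ _, C ∂t.law := integral_mono (integrable_finsetSum _ hi) (integrable_const _)
          fun θ => ih hl' _ _ (by omega) fun A' u' hA' => h A' u' (by omega)
      _ = C := by simp

end Placement

/-! ### Sampling with and without replacement -/

theorem one_sub_le_descFactorial_div (m k : ℕ) (hm : 0 < m) :
    1 - (k : ℝ) ^ 2 / m ≤ (m.descFactorial k : ℝ) / (m : ℝ) ^ k := by
  have hm' : (0 : ℝ) < m := by exact_mod_cast hm
  rcases le_or_gt k m with hkm | hkm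
  · have h1 : (((m + 1 - k : ℕ) : ℝ)) ^ k ≤ (m.descFactorial k : ℝ) := by
      exact_mod_cast Nat.pow_sub_le_descFactorial m k
    rw [Nat.cast_sub (by omega)] at h1
    push_cast at h1
    have hk' : (k : ℝ) ≤ m := by exact_mod_cast hkm
    have hk0 : (0 : ℝ) ≤ k := k.cast_nonneg
    have hq : (k : ℝ) / m ≤ 1 := (div_le_one hm').2 hk'
    have h2 := one_add_mul_le_pow (a := -((k : ℝ) / m)) (by linarith) k
    calc 1 - (k : ℝ) ^ 2 / m = 1 + k * -((k : ℝ) / m) := by ring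
      _ ≤ (1 + -((k : ℝ) / m)) ^ k := h2
      _ = (((m : ℝ) - k) ^ k) / (m : ℝ) ^ k := by
          rw [← div_pow]; congr 1; field_simp; ring
      _ ≤ _ := by
          refine div_le_div_of_nonneg_right ((pow_le_pow_left₀ (by linarith) ?_ k).trans h1)
            (by positivity)
          linarith
  · have hk' : (m : ℝ) ≤ k := by exact_mod_cast hkm.le
    have hm1 : (1 : ℝ) ≤ m := by exact_mod_cast hm
    have : 1 ≤ (k : ℝ) ^ 2 / m := by rw [le_div_iff₀ hm']; nlinarith
    have h0 : (0 : ℝ) ≤ (m.descFactorial k : ℝ) / (m : ℝ) ^ k := by positivity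
    linarith

theorem abs_average_sub_average_le {α : Type*} {S T : Finset α} (hST : S ⊆ T) (f : α → ℝ) {c : ℝ}
    (hc : 0 ≤ c) (hf : ∀ v ∈ T, |f v| ≤ c) (hT : T.Nonempty) :
    |(∑ v ∈ S, f v) / (S.card : ℝ) - (∑ v ∈ T, f v) / (T.card : ℝ)|
      ≤ 2 * c * (1 - (S.card : ℝ) / T.card) := by
  classical
  have ht : (0 : ℝ) < T.card := by exact_mod_cast hT.card_pos
  have hst : (S.card : ℝ) ≤ T.card := by exact_mod_cast Finset.card_le_card hST
  have hx : |∑ v ∈ S, f v| ≤ c * S.card := by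
    calc _ ≤ ∑ v ∈ S, |f v| := Finset.abs_sum_le_sum_abs _ _
      _ ≤ ∑ _v ∈ S, c := Finset.sum_le_sum fun v hv => hf v (hST hv)
      _ = _ := by simp [mul_comm]
  have hy : |∑ v ∈ T \ S, f v| ≤ c * (T.card - S.card) := by
    calc _ ≤ ∑ v ∈ T \ S, |f v| := Finset.abs_sum_le_sum_abs _ _
      _ ≤ ∑ _v ∈ T \ S, c := Finset.sum_le_sum fun v hv => hf v (Finset.sdiff_subset hv)
      _ = _ := by
        rw [Finset.sum_const, Finset.card_sdiff_of_subset hST, nsmul_eq_mul,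
          Nat.cast_sub (Finset.card_le_card hST), mul_comm]
  rw [← Finset.sum_sdiff hST]
  set x := ∑ v ∈ S, f v
  set y := ∑ v ∈ T \ S, f v
  rcases Nat.eq_zero_or_pos S.card with h0 | h0
  · have hx0 : x = 0 := by
      rw [h0] at hx; simpa using hx
    rw [hx0, h0]
    simp only [zero_div, zero_sub, add_zero, abs_neg, Nat.cast_zero, sub_zero, mul_one]
    rw [abs_div, Nat.abs_cast, div_le_iff₀ ht]
    rw [h0] at hy
    simp only [Nat.cast_zero, sub_zero] at hy
    nlinarith
  · have hs : (0 : ℝ) < S.card := by exact_mod_cast h0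
    have e : x / (S.card : ℝ) - (y + x) / (T.card : ℝ)
        = x * ((T.card - S.card) / (S.card * T.card)) - y / T.card := by
      field_simp; ring
    rw [e]
    have p : 0 ≤ ((T.card : ℝ) - S.card) / (S.card * T.card) :=
      div_nonneg (by linarith) (by positivity)
    calc _ ≤ |x * ((T.card - S.card) / (S.card * T.card))| + |y / T.card| := abs_sub _ _
      _ = |x| * ((T.card - S.card) / (S.card * T.card)) + |y| / T.card := by
          rw [abs_mul, abs_of_nonneg p, abs_div, Nat.abs_cast]
      _ ≤ (c * S.card) * ((T.card - S.card) / (S.card * T.card))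
          + (c * (T.card - S.card)) / T.card := by gcongr
      _ = _ := by field_simp; ring

/-- Averages over injective tuples and over all tuples of elements outside `A` are close. -/
theorem abs_average_places_sub_le {H : Type*} [Fintype H] [DecidableEq H] (A : Finset H) (k : ℕ)
    (f : (Fin k → H) → ℝ) {c : ℝ} (hf : ∀ v, |f v| ≤ c) (hA : 0 < Aᶜ.card) :
    |(∑ v ∈ places A k, f v) / ((places A k).card : ℝ)
      - (∑ v ∈ Fintype.piFinset fun _ : Fin k => Aᶜ, f v) / (Aᶜ.card : ℝ) ^ k|
      ≤ 2 * c * ((k : ℝ) ^ 2 / Aᶜ.card) := by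
  obtain ⟨h₀, hh₀⟩ := Finset.card_pos.1 hA
  have hc : 0 ≤ c := (abs_nonneg _).trans (hf fun _ => h₀)
  have hsub : places A k ⊆ Fintype.piFinset fun _ : Fin k => Aᶜ := by
    intro v hv
    rw [Fintype.mem_piFinset]
    exact fun j => Finset.mem_compl.2 ((mem_places.1 hv).2 j)
  have hcard : (Fintype.piFinset fun _ : Fin k => Aᶜ).card = Aᶜ.card ^ k := by simp
  have h := abs_average_sub_average_le hsub f hc (fun v _ => hf v)
    ⟨fun _ => h₀, Fintype.mem_piFinset.2 fun _ => hh₀⟩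
  rw [hcard, Nat.cast_pow] at h
  refine h.trans (mul_le_mul_of_nonneg_left ?_ (by linarith))
  have h1 := one_sub_le_descFactorial_div Aᶜ.card k hA
  rw [card_places, ← Finset.card_compl]
  linarith

/-! ### Replacing one interaction by fields, at distinct half-edges -/

/-- The law of the cavity field `U(θ, x₁, …, x_{n-1}, ·)`, as an interaction of one spin. -/
noncomputable def fieldLaw {n : ℕ} (Θ : Measure (Interaction n)) (ζ : Measure ℝ) :
    Measure (Interaction 1) :=
  (Θ.prod (Measure.pi fun _ : Fin (n - 1) => ζ)).map fun z ε => siteField z.1 z.2 (ε 0)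

/-- The factor of an edge. -/
def edgeFactor {n : ℕ} (Θ : Measure (Interaction n)) : Factor := ⟨n, Θ⟩

/-- The factor of a cavity field. -/
noncomputable def fieldFactor {n : ℕ} (Θ : Measure (Interaction n)) (ζ : Measure ℝ) : Factor :=
  ⟨1, fieldLaw Θ ζ⟩

/-- The mean `𝔼 log ⟨exp θ⟩_x`. -/
noncomputable def bulkTerm {n : ℕ} (Θ : Measure (Interaction n)) (ζ : Measure ℝ) : ℝ :=
  ∫ θ, ∫ x : Fin n → ℝ, Real.log (avg (boltzmann θ) x) ∂(Measure.pi fun _ => ζ) ∂Θ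

theorem measurableSet_bounded {n : ℕ} (κ : ℝ) :
    MeasurableSet {θ : Interaction n | ∀ σ, |θ σ| ≤ κ} := by
  have : {θ : Interaction n | ∀ σ, |θ σ| ≤ κ} = ⋂ σ, {θ | ‖θ σ‖ ≤ κ} := by
    ext θ; simp
  rw [this]
  exact MeasurableSet.iInter fun σ =>
    measurableSet_le (measurable_pi_apply σ).norm measurable_const

theorem IsProductLaw.isBounded {n : ℕ} {κ : ℝ} {Θ : Measure (Interaction n)}
    {β : Measure (ℝ × ℝ)} {φ : Measure (Spin → ℝ)} (h : IsProductLaw κ Θ β φ) :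
    (edgeFactor Θ).IsBounded κ := by
  have := h.prob_β
  have := h.prob_φ
  refine ⟨?_, ?_⟩
  · change IsProbabilityMeasure Θ
    rw [← h.map_eq]
    exact Measure.isProbabilityMeasure_map measurable_productInteraction.aemeasurable
  · change ∀ᵐ θ ∂Θ, ∀ σ : Fin n → Spin, |θ σ| ≤ κ
    rw [← h.map_eq, ae_map_iff measurable_productInteraction.aemeasurable
      (measurableSet_bounded κ)]
    exact h.admissible.mono fun z hz σ => (hz.2 σ).2

theorem measurable_siteField {n : ℕ} : Measurable
    fun (z : Interaction n × (Fin (n - 1) → ℝ)) (ε : Fin 1 → Spin) => siteField z.1 z.2 (ε 0) :=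
  measurable_pi_lambda _ fun ε => (measurable_avgMinus (ε 0)).log

theorem isBounded_fieldFactor {n : ℕ} {κ : ℝ} {Θ : Measure (Interaction n)}
    (h : (edgeFactor Θ).IsBounded κ) (ζ : Measure ℝ) [IsProbabilityMeasure ζ] :
    (fieldFactor Θ ζ).IsBounded κ := by
  have h1 : IsProbabilityMeasure Θ := h.1
  have h2 : ∀ᵐ θ ∂Θ, ∀ σ, |θ σ| ≤ κ := h.2
  refine ⟨Measure.isProbabilityMeasure_map measurable_siteField.aemeasurable, ?_⟩
  change ∀ᵐ θ ∂fieldLaw Θ ζ, ∀ σ : Fin 1 → Spin, |θ σ| ≤ κ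
  rw [fieldLaw, ae_map_iff measurable_siteField.aemeasurable (measurableSet_bounded κ)]
  have q₁ : Measure.QuasiMeasurePreserving Prod.fst
    (Θ.prod (Measure.pi fun _ : Fin (n - 1) => ζ)) Θ := Measure.quasiMeasurePreserving_fst
  filter_upwards [q₁.ae h2] with z hz σ using abs_siteField_le hz _ _

theorem abs_bulkTerm_le {n : ℕ} {κ : ℝ} {Θ : Measure (Interaction n)}
    (h : (edgeFactor Θ).IsBounded κ) (ζ : Measure ℝ) [IsProbabilityMeasure ζ] :
    |bulkTerm Θ ζ| ≤ κ := by
  have h1 : IsProbabilityMeasure Θ := h.1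
  have h2 : ∀ᵐ θ ∂Θ, ∀ σ, |θ σ| ≤ κ := h.2
  rw [bulkTerm, ← Real.norm_eq_abs]
  refine (norm_integral_le_of_norm_le_const (C := κ) ?_).trans (by simp)
  filter_upwards [h2] with θ hθ
  refine (norm_integral_le_of_norm_le_const (C := κ) (Eventually.of_forall fun x => ?_)).trans
    (by simp)
  exact abs_log_avg_le hθ x

section Uniform

variable {H : Type*} [Fintype H] [DecidableEq H] [MeasurableSpace H] [MeasurableSingletonClass H]

theorem integral_uniform (B : Finset H) (hB : B.Nonempty) (f : H → ℝ) :
    ∫ h, f h ∂(PMF.uniformOfFinset B hB).toMeasure = (∑ h ∈ B, f h) / B.card := by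
  rw [integral_fintype (Integrable.of_finite)]
  have : ∀ h, (PMF.uniformOfFinset B hB).toMeasure.real {h} • f h
      = if h ∈ B then (B.card : ℝ)⁻¹ * f h else 0 := by
    intro h
    rw [measureReal_def, PMF.toMeasure_apply_singleton _ _ (measurableSet_singleton h),
      PMF.uniformOfFinset_apply]
    split_ifs <;> simp
  simp_rw [this]
  rw [Finset.sum_ite_mem, Finset.univ_inter, ← Finset.mul_sum, div_eq_inv_mul]

theorem integral_pi_uniform (B : Finset H) (hB : B.Nonempty) (n : ℕ) (f : (Fin n → H) → ℝ) :
    ∫ v, f v ∂(Measure.pi fun _ : Fin n => (PMF.uniformOfFinset B hB).toMeasure)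
      = (∑ v ∈ Fintype.piFinset fun _ : Fin n => B, f v) / (B.card : ℝ) ^ n := by
  rw [integral_fintype (Integrable.of_finite)]
  have : ∀ v : Fin n → H,
      (Measure.pi fun _ : Fin n => (PMF.uniformOfFinset B hB).toMeasure).real {v} • f v
      = if v ∈ Fintype.piFinset fun _ : Fin n => B then ((B.card : ℝ) ^ n)⁻¹ * f v else 0 := by
    intro v
    rw [measureReal_def, Measure.pi_singleton, ENNReal.toReal_prod]
    simp only [PMF.toMeasure_apply_singleton _ _ (measurableSet_singleton _),
      PMF.uniformOfFinset_apply, Fintype.mem_piFinset]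
    split_ifs with h
    · simp [h]
    · push Not at h
      obtain ⟨j, hj⟩ := h
      rw [Finset.prod_eq_zero (Finset.mem_univ j) (by simp [hj]), zero_smul]
  simp_rw [this]
  rw [Finset.sum_ite_mem, Finset.univ_inter, ← Finset.mul_sum, div_eq_inv_mul]

end Uniform

section OneStepPlacement

variable {ι H : Type*} [Fintype ι] [DecidableEq ι] [Fintype H] [DecidableEq H]

/-- The Gibbs weights of the energy `u`. -/
noncomputable def gibbs (u : (ι → Spin) → ℝ) (σ : ι → Spin) : ℝ :=
  Real.exp (u σ) / ∑ σ, Real.exp (u σ)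

theorem gibbs_nonneg (u : (ι → Spin) → ℝ) (σ : ι → Spin) : 0 ≤ gibbs u σ :=
  div_nonneg (Real.exp_pos _).le (sum_exp_pos u).le

theorem sum_gibbs (u : (ι → Spin) → ℝ) : ∑ σ, gibbs u σ = 1 := by
  simp only [gibbs]
  rw [← Finset.sum_div, div_self (sum_exp_pos u).ne']

theorem logZ_sub_logZ (u w : (ι → Spin) → ℝ) :
    logZ (fun σ => u σ + w σ) - logZ u = Real.log (∑ σ, gibbs u σ * Real.exp (w σ)) := by
  rw [logZ, logZ, ← Real.log_div (sum_exp_pos _).ne' (sum_exp_pos u).ne', Finset.sum_div]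
  congr 1
  refine Finset.sum_congr rfl fun σ _ => ?_
  rw [Real.exp_add, gibbs]; ring

theorem average_sub_const {α : Type*} {s : Finset α} (hs : s.Nonempty) (f : α → ℝ) (c : ℝ) :
    (∑ v ∈ s, f v) / (s.card : ℝ) - c = (∑ v ∈ s, (f v - c)) / (s.card : ℝ) := by
  have : (s.card : ℝ) ≠ 0 := by exact_mod_cast hs.card_pos.ne'
  rw [Finset.sum_sub_distrib, Finset.sum_const, nsmul_eq_mul]
  field_simp

theorem meanLogZ_singleton_sub (s : H → ι) {κ : ℝ} {t : Factor} (ht : t.IsBounded κ)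
    (A : Finset H) (u : (ι → Spin) → ℝ) (h : (places A t.arity).Nonempty) :
    meanLogZ s [t] A u - logZ u = (∑ v ∈ places A t.arity,
      ∫ θ, Real.log (∑ σ, gibbs u σ * Real.exp (θ fun j => σ (s (v j)))) ∂t.law) /
        ((places A t.arity).card : ℝ) := by
  have := ht.1
  rw [meanLogZ, average_sub_const h]
  congr 1
  refine Finset.sum_congr rfl fun v _ => ?_
  have hi : Integrable (fun θ => logZ (attach s u v θ)) t.law :=
    integrable_comp_attach (fun u u' c h => abs_logZ_sub_le h) ht s u v
  have h1 : logZ u = ∫ _, logZ u ∂t.law := by simp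
  simp only [meanLogZ]
  rw [h1, ← integral_sub hi (integrable_const _)]
  refine integral_congr_ae (Eventually.of_forall fun θ => ?_)
  exact logZ_sub_logZ u fun σ => θ fun j => σ (s (v j))

/-- Placing one more factor changes the mean log-partition function by at most `κ`. -/
theorem abs_meanLogZ_append_singleton_sub_le (s : H → ι) {κ : ℝ} {l : List Factor}
    (hl : ∀ t ∈ l, t.IsBounded κ) {t : Factor} (ht : t.IsBounded κ) (A : Finset H)
    (u : (ι → Spin) → ℝ) (hfit : A.card + totalArity l + t.arity ≤ Fintype.card H) :
    |meanLogZ s (l ++ [t]) A u - meanLogZ s l A u| ≤ κ := by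
  have := ht.1
  have hκ : 0 ≤ κ := by
    obtain ⟨θ, hθ⟩ := ht.2.exists
    exact (abs_nonneg _).trans (hθ fun _ => 1)
  have base : ∀ (A' : Finset H) (u' : (ι → Spin) → ℝ), A'.card = A.card + totalArity l →
      |meanLogZ s [t] A' u' - meanLogZ s [] A' u'| ≤ κ := by
    intro A' u' hA'
    have hne : (places A' t.arity).Nonempty := by
      rw [← Finset.card_pos, card_places]
      exact Nat.descFactorial_pos.2 (by omega)
    change |meanLogZ s [t] A' u' - logZ u'| ≤ κ
    rw [meanLogZ_singleton_sub s ht A' u' hne]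
    refine abs_sum_div_card_le _ _ hκ fun v _ => ?_
    rw [← Real.norm_eq_abs]
    refine (norm_integral_le_of_norm_le_const (C := κ) ?_).trans (by simp)
    filter_upwards [ht.2] with θ hθ
    exact abs_log_average_exp_le _ _ (gibbs_nonneg u') (sum_gibbs u') fun σ => hθ _
  have hx : ∀ k : Bool, ∀ t' ∈ (if k then [t] else []), t'.IsBounded κ := by
    rintro (_ | _) t' h
    · simp at h
    · simp only [if_true, List.mem_singleton] at h; rwa [h]
  have h1 := sum_mul_meanLogZ_append_le s (fun k : Bool => if k then 1 else -1)
    (fun k => if k then [t] else []) hx hl κ A u (by omega) fun A' u' hA' => by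
      have := (abs_le.1 (base A' u' hA')).2
      simp only [Fintype.sum_bool, if_true, Bool.false_eq_true, if_false]
      linarith
  have h2 := sum_mul_meanLogZ_append_le s (fun k : Bool => if k then -1 else 1)
    (fun k => if k then [t] else []) hx hl κ A u (by omega) fun A' u' hA' => by
      have := (abs_le.1 (base A' u' hA')).1
      simp only [Fintype.sum_bool, if_true, Bool.false_eq_true, if_false]
      linarith
  simp only [Fintype.sum_bool, if_true, Bool.false_eq_true, if_false, List.append_nil] at h1 h2
  rw [abs_le]
  constructor <;> linarith

theorem abs_meanLogZ_append_sub_le (s : H → ι) {κ : ℝ} {l l' : List Factor}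
    (hl : ∀ t ∈ l, t.IsBounded κ) (hl' : ∀ t ∈ l', t.IsBounded κ) (A : Finset H)
    (u : (ι → Spin) → ℝ) (hfit : A.card + totalArity (l ++ l') ≤ Fintype.card H) :
    |meanLogZ s (l ++ l') A u - meanLogZ s l A u| ≤ κ * l'.length := by
  induction l' generalizing l with
  | nil => simp
  | cons t l' ih =>
    have ht := hl' t List.mem_cons_self
    have hlt : ∀ t' ∈ l ++ [t], t'.IsBounded κ := by
      intro t' h
      rcases List.mem_append.1 h with h | h
      · exact hl t' h
      · rw [List.mem_singleton.1 h]; exact ht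
    simp only [totalArity_append, totalArity_cons] at hfit
    have h1 := ih hlt (fun t h => hl' t (List.mem_cons_of_mem _ h))
      (by simp only [totalArity_append, totalArity_cons, totalArity_nil]; omega)
    have h2 := abs_meanLogZ_append_singleton_sub_le s hl ht A u (by omega)
    rw [List.append_assoc, List.singleton_append] at h1
    have h3 := abs_sub_le (meanLogZ s (l ++ t :: l') A u) (meanLogZ s (l ++ [t]) A u)
      (meanLogZ s l A u)
    rw [List.length_cons]
    push_cast
    linarith

theorem measurePreserving_init (ζ : Measure ℝ) [IsProbabilityMeasure ζ] (q : ℕ) :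
    MeasurePreserving (fun (x : Fin (q + 1) → ℝ) (j : Fin q) => x j.castSucc)
      (Measure.pi fun _ => ζ) (Measure.pi fun _ => ζ) := by
  have h := measurePreserving_snd.comp
    (measurePreserving_piFinSuccAbove (fun _ : Fin (q + 1) => ζ) (Fin.last q))
  convert h using 1
  funext x j
  simp [MeasurableEquiv.piFinSuccAbove, Fin.insertNthEquiv, Fin.init]

/-- The convexity inequality for one interaction of `q + 1` spins placed outside `A`, when the
half-edges are drawn with replacement. -/
theorem average_logEdge_le {q : ℕ} {κ : ℝ} {Θ : Measure (Interaction (q + 1))}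
    {β : Measure (ℝ × ℝ)} {φ : Measure (Spin → ℝ)} (hΘ : IsProductLaw κ Θ β φ) (ζ : Measure ℝ)
    [IsProbabilityMeasure ζ] {S : Type*} [Fintype S] {g : S → ℝ} (hg : ∀ σ, 0 ≤ g σ)
    (hg1 : ∑ σ, g σ = 1) (ev : S → H → Spin) (B : Finset H) (hB : B.Nonempty) :
    (∑ v ∈ Fintype.piFinset fun _ : Fin (q + 1) => B, ∫ θ, logEdge g ev θ v ∂Θ)
        / (B.card : ℝ) ^ (q + 1)
      - (q + 1) * ((∑ h ∈ B, ∫ z : Interaction (q + 1) × (Fin (q + 1 - 1) → ℝ),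
          logField g ev z.1 z.2 h ∂(Θ.prod (Measure.pi fun _ => ζ))) / B.card)
      + q * bulkTerm Θ ζ ≤ 0 := by
  let _ : MeasurableSpace H := ⊤
  have hbd := hΘ.isBounded
  have pΘ : IsProbabilityMeasure Θ := hbd.1
  have bΘ : ∀ᵐ θ ∂Θ, ∀ σ : Fin (q + 1) → Spin, |θ σ| ≤ κ := hbd.2
  set l := (PMF.uniformOfFinset B hB).toMeasure with hl
  set πv := Measure.pi fun _ : Fin (q + 1) => l with hπv
  set πx := Measure.pi fun _ : Fin (q + 1) => ζ with hπx
  have h := integral_logEdge_le hΘ l ζ hg hg1 ev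
  have hae : ∀ᵐ z ∂Θ.prod (πv.prod πx), ∀ σ, |z.1 σ| ≤ κ :=
    Measure.quasiMeasurePreserving_fst.ae bΘ
  have i₁ : Integrable (fun z : Interaction (q + 1) × ((Fin (q + 1) → H) × (Fin (q + 1) → ℝ)) =>
      logEdge g ev z.1 z.2.1) (Θ.prod (πv.prod πx)) :=
    Integrable.of_bound (measurable_logEdge_prod g ev q).aestronglyMeasurable κ
      (hae.mono fun z hz => abs_logEdge_le hg hg1 ev hz _)
  have i₂ : Integrable (fun z : Interaction (q + 1) × ((Fin (q + 1) → H) × (Fin (q + 1) → ℝ)) =>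
      logField g ev z.1 (fun j : Fin q => z.2.2 j.castSucc) (z.2.1 (Fin.last q)))
      (Θ.prod (πv.prod πx)) :=
    Integrable.of_bound (measurable_logField_prod g ev q).aestronglyMeasurable κ
      (hae.mono fun z hz => abs_logField_le hg hg1 ev hz _ _)
  have i₃ : Integrable (fun z : Interaction (q + 1) × ((Fin (q + 1) → H) × (Fin (q + 1) → ℝ)) =>
      Real.log (avg (boltzmann z.1) z.2.2)) (Θ.prod (πv.prod πx)) :=
    Integrable.of_bound (measurable_log_avg_prod q).aestronglyMeasurable κ
      (hae.mono fun z hz => abs_log_avg_le hz _)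
  have i₁₂ : Integrable (fun z : Interaction (q + 1) × ((Fin (q + 1) → H) × (Fin (q + 1) → ℝ)) =>
      logEdge g ev z.1 z.2.1 - ((q : ℝ) + 1) *
        logField g ev z.1 (fun j : Fin q => z.2.2 j.castSucc) (z.2.1 (Fin.last q)))
      (Θ.prod (πv.prod πx)) := i₁.sub (i₂.const_mul _)
  rw [integral_add i₁₂ (i₃.const_mul _), integral_sub i₁ (i₂.const_mul _), integral_const_mul,
    integral_const_mul] at h
  have e₁ : ∫ z : Interaction (q + 1) × ((Fin (q + 1) → H) × (Fin (q + 1) → ℝ)),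
      logEdge g ev z.1 z.2.1 ∂(Θ.prod (πv.prod πx))
      = (∑ v ∈ Fintype.piFinset fun _ : Fin (q + 1) => B, ∫ θ, logEdge g ev θ v ∂Θ)
        / (B.card : ℝ) ^ (q + 1) := by
    have m : MeasurePreserving (Prod.map id Prod.fst) (Θ.prod (πv.prod πx)) (Θ.prod πv) :=
      (MeasurePreserving.id Θ).prod measurePreserving_fst
    have hm := measurable_logEdge (n := q + 1) g ev
    have e : ∫ z : Interaction (q + 1) × ((Fin (q + 1) → H) × (Fin (q + 1) → ℝ)),
        logEdge g ev z.1 z.2.1 ∂(Θ.prod (πv.prod πx))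
        = ∫ z : Interaction (q + 1) × (Fin (q + 1) → H), logEdge g ev z.1 z.2 ∂(Θ.prod πv) := by
      rw [← m.map_eq, integral_map m.measurable.aemeasurable hm.aestronglyMeasurable]
      rfl
    rw [e, integral_prod_symm, hπv, hl, integral_pi_uniform]
    refine Integrable.of_bound hm.aestronglyMeasurable κ ?_
    have : ∀ᵐ z ∂Θ.prod πv, ∀ σ, |z.1 σ| ≤ κ := Measure.quasiMeasurePreserving_fst.ae bΘ
    exact this.mono fun z hz => abs_logEdge_le hg hg1 ev hz _
  have e₂ : ∫ z : Interaction (q + 1) × ((Fin (q + 1) → H) × (Fin (q + 1) → ℝ)),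
      logField g ev z.1 (fun j : Fin q => z.2.2 j.castSucc) (z.2.1 (Fin.last q))
        ∂(Θ.prod (πv.prod πx))
      = (∑ h ∈ B, ∫ z : Interaction (q + 1) × (Fin (q + 1 - 1) → ℝ),
          logField g ev z.1 z.2 h ∂(Θ.prod (Measure.pi fun _ => ζ))) / B.card := by
    set πx' := Measure.pi fun _ : Fin q => ζ with hπx'
    have m₁ : MeasurePreserving (Prod.map id (Prod.map (Function.eval (Fin.last q))
        (fun (x : Fin (q + 1) → ℝ) (j : Fin q) => x j.castSucc))) (Θ.prod (πv.prod πx))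
        (Θ.prod (l.prod πx')) :=
      (MeasurePreserving.id Θ).prod
        ((measurePreserving_eval (fun _ : Fin (q + 1) => l) (Fin.last q)).prod
          (measurePreserving_init ζ q))
    have m₂ : MeasurePreserving (Prod.map id Prod.swap) (Θ.prod (l.prod πx'))
        (Θ.prod (πx'.prod l)) := (MeasurePreserving.id Θ).prod Measure.measurePreserving_swap
    have m₃ := (measurePreserving_prodAssoc Θ πx' l).symm
    have m := (m₃.comp m₂).comp m₁
    have hm : Measurable fun z : (Interaction (q + 1) × (Fin q → ℝ)) × H =>
      logField (n := q + 1) g ev z.1.1 z.1.2 z.2 := measurable_logField (n := q + 1) g ev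
    have e : ∫ z : Interaction (q + 1) × ((Fin (q + 1) → H) × (Fin (q + 1) → ℝ)),
      logField g ev z.1 (fun j : Fin q => z.2.2 j.castSucc) (z.2.1 (Fin.last q))
        ∂(Θ.prod (πv.prod πx))
        = ∫ z : (Interaction (q + 1) × (Fin q → ℝ)) × H,
          logField (n := q + 1) g ev z.1.1 z.1.2 z.2 ∂((Θ.prod πx').prod l) := by
      rw [← m.map_eq, integral_map m.measurable.aemeasurable hm.aestronglyMeasurable]
      rfl
    rw [e, integral_prod_symm, hl, integral_uniform]
    · rfl
    refine Integrable.of_bound hm.aestronglyMeasurable κ ?_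
    have : ∀ᵐ z ∂(Θ.prod πx').prod l, ∀ σ, |z.1.1 σ| ≤ κ :=
      (measurePreserving_fst.comp measurePreserving_fst).quasiMeasurePreserving.ae bΘ
    exact this.mono fun z hz => abs_logField_le (n := q + 1) hg hg1 ev hz _ _
  have e₃ : ∫ z : Interaction (q + 1) × ((Fin (q + 1) → H) × (Fin (q + 1) → ℝ)),
      Real.log (avg (boltzmann z.1) z.2.2) ∂(Θ.prod (πv.prod πx)) = bulkTerm Θ ζ := by
    have m : MeasurePreserving (Prod.map id Prod.snd) (Θ.prod (πv.prod πx)) (Θ.prod πx) :=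
      (MeasurePreserving.id Θ).prod measurePreserving_snd
    have hm := (measurable_avg (n := q + 1)).log
    have e : ∫ z : Interaction (q + 1) × ((Fin (q + 1) → H) × (Fin (q + 1) → ℝ)),
        Real.log (avg (boltzmann z.1) z.2.2) ∂(Θ.prod (πv.prod πx))
        = ∫ z : Interaction (q + 1) × (Fin (q + 1) → ℝ),
          Real.log (avg (boltzmann z.1) z.2) ∂(Θ.prod πx) := by
      rw [← m.map_eq, integral_map m.measurable.aemeasurable hm.aestronglyMeasurable]
      rfl
    rw [e, integral_prod]
    · rfl
    refine Integrable.of_bound hm.aestronglyMeasurable κ ?_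
    have : ∀ᵐ z ∂Θ.prod πx, ∀ σ, |z.1 σ| ≤ κ := Measure.quasiMeasurePreserving_fst.ae bΘ
    exact this.mono fun z hz => abs_log_avg_le hz _
  rw [e₁, e₂, e₃] at h
  exact h

/-- The effect of one more interaction of `n` spins is at most `n` times the effect of one more
field minus `n - 1` bulk terms, up to the error of sampling half-edges with replacement. -/
theorem meanLogZ_edge_le {n : ℕ} (hn : 1 ≤ n) {κ : ℝ} {Θ : Measure (Interaction n)}
    {β : Measure (ℝ × ℝ)} {φ : Measure (Spin → ℝ)} (hΘ : IsProductLaw κ Θ β φ) (ζ : Measure ℝ)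
    [IsProbabilityMeasure ζ] (s : H → ι) (A : Finset H) (u : (ι → Spin) → ℝ)
    (hfit : A.card + n ≤ Fintype.card H) :
    meanLogZ s [edgeFactor Θ] A u - logZ u
      ≤ n * (meanLogZ s [fieldFactor Θ ζ] A u - logZ u) - (n - 1) * bulkTerm Θ ζ
        + 2 * κ * ((n : ℝ) ^ 2 / (Fintype.card H - A.card : ℕ)) := by
  obtain ⟨q, rfl⟩ : ∃ q, n = q + 1 := ⟨n - 1, by omega⟩
  have hbd := hΘ.isBounded
  have pΘ : IsProbabilityMeasure Θ := hbd.1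
  have bΘ : ∀ᵐ θ ∂Θ, ∀ σ : Fin (q + 1) → Spin, |θ σ| ≤ κ := hbd.2
  have hBc : Aᶜ.card = Fintype.card H - A.card := Finset.card_compl A
  have hB : Aᶜ.Nonempty := Finset.card_pos.1 (by omega)
  set ev : (ι → Spin) → H → Spin := fun σ h => σ (s h) with hev
  have hg := gibbs_nonneg u
  have hg1 := sum_gibbs u
  have h := average_logEdge_le hΘ ζ hg hg1 ev Aᶜ hB
  have hf1 : meanLogZ s [fieldFactor Θ ζ] A u - logZ u
      = (∑ h ∈ Aᶜ, ∫ z : Interaction (q + 1) × (Fin (q + 1 - 1) → ℝ),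
          logField (gibbs u) ev z.1 z.2 h ∂(Θ.prod (Measure.pi fun _ => ζ))) / Aᶜ.card := by
    have hne : (places A 1).Nonempty := by
      rw [← Finset.card_pos, card_places]
      exact Nat.descFactorial_pos.2 (by omega)
    have h1 := meanLogZ_singleton_sub s (isBounded_fieldFactor hbd ζ) A u hne
    have hc : (places A 1).card = Aᶜ.card := by
      rw [card_places, Nat.descFactorial_one, hBc]
    rw [h1]
    change (∑ v ∈ places A 1, ∫ θ, _ ∂fieldLaw Θ ζ) / ((places A 1).card : ℝ) = _
    rw [hc]
    congr 1
    refine Finset.sum_bij (fun v _ => v 0) ?_ ?_ ?_ ?_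
    · exact fun v hv => Finset.mem_compl.2 ((mem_places.1 hv).2 0)
    · intro v _ v' _ hvv
      funext j; rw [Subsingleton.elim j 0]; exact hvv
    · intro h hh
      exact ⟨fun _ => h, mem_places.2 ⟨fun i j _ => Subsingleton.elim i j,
        fun _ => Finset.mem_compl.1 hh⟩, rfl⟩
    · intro v _
      have hm : Measurable fun θ : Interaction 1 =>
          Real.log (∑ σ, gibbs u σ * Real.exp (θ fun j => σ (s (v j)))) := by fun_prop
      have e : ∫ θ : Interaction 1, Real.log (∑ σ, gibbs u σ * Real.exp (θ fun j => σ (s (v j))))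
          ∂fieldLaw Θ ζ = ∫ z : Interaction (q + 1) × (Fin (q + 1 - 1) → ℝ),
            logField (gibbs u) ev z.1 z.2 (v 0) ∂(Θ.prod (Measure.pi fun _ => ζ)) := by
        rw [fieldLaw, integral_map measurable_siteField.aemeasurable hm.aestronglyMeasurable]
        refine integral_congr_ae (Eventually.of_forall fun z => ?_)
        simp only [logField_eq, hev]
      exact e
  have he1 : |(meanLogZ s [edgeFactor Θ] A u - logZ u)
      - (∑ v ∈ Fintype.piFinset fun _ : Fin (q + 1) => Aᶜ,
          ∫ θ, logEdge (gibbs u) ev θ v ∂Θ) / (Aᶜ.card : ℝ) ^ (q + 1)|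
      ≤ 2 * κ * (((q + 1 : ℕ) : ℝ) ^ 2 / Aᶜ.card) := by
    have hne : (places A (q + 1)).Nonempty := by
      rw [← Finset.card_pos, card_places]
      exact Nat.descFactorial_pos.2 (by omega)
    have h1 := meanLogZ_singleton_sub s hbd A u hne
    rw [h1]
    refine abs_average_places_sub_le A (q + 1) (fun v => ∫ θ, logEdge (gibbs u) ev θ v ∂Θ) ?_
      (Finset.card_pos.2 hB)
    intro v
    rw [← Real.norm_eq_abs]
    refine (norm_integral_le_of_norm_le_const (C := κ) ?_).trans (by simp)
    filter_upwards [bΘ] with θ hθ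
    exact abs_logEdge_le hg hg1 ev hθ v
  rw [← hf1] at h
  rw [hBc] at he1 h
  have := (abs_le.1 he1).2
  push_cast at this h ⊢
  linarith

end OneStepPlacement

/-! ### Replacing all the interactions by fields -/

/-- For a sequence with increments bounded by `κ`, the window sums are almost affine: `n` steps
from `k` change them by about `n` times the first step. -/
theorem abs_windowSum_sub_le {f : ℕ → ℝ} {κ : ℝ} {k L n : ℕ}
    (h : ∀ j < k + L + n, |f (j + 1) - f j| ≤ κ) :
    |(∑ s ∈ Finset.range L, f (k + n + s)) - (∑ s ∈ Finset.range L, f (k + s))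
      - n * ((∑ s ∈ Finset.range L, f (k + 1 + s)) - ∑ s ∈ Finset.range L, f (k + s))|
      ≤ κ * (n : ℝ) ^ 2 := by
  have hshift : ∀ k, (∑ s ∈ Finset.range L, f (k + 1 + s)) - ∑ s ∈ Finset.range L, f (k + s)
      = f (k + L) - f k := by
    intro k
    have h1 := Finset.sum_range_succ' (fun s => f (k + s)) L
    rw [Finset.sum_range_succ] at h1
    have h2 : ∀ s, f (k + 1 + s) = f (k + (s + 1)) := fun s => by congr 1; omega
    simp only [h2, add_zero] at h1 ⊢
    linarith
  have hdist : ∀ i j, i + j ≤ k + L + n → |f (i + j) - f i| ≤ κ * j := by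
    intro i j
    induction j with
    | zero => simp
    | succ j ih =>
      intro hj
      have h1 := ih (by omega)
      have h2 := h (i + j) (by omega)
      have h3 := abs_sub_le (f (i + (j + 1))) (f (i + j)) (f i)
      rw [← add_assoc] at h3 ⊢
      push_cast
      linarith
  rw [hshift]
  induction n with
  | zero => simp
  | succ n ih =>
    have h1 := ih (fun j hj => h j (by omega)) fun i j hij => hdist i j (by omega)
    have h2 := hshift (k + n)
    have h3 := hdist k n (by omega)
    have h4 := hdist (k + L) n (by omega)
    rw [show k + L + n = k + n + L by omega] at h4
    rw [show k + (n + 1) = k + n + 1 by omega]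
    rw [abs_le] at h1 h3 h4 ⊢
    have hκ : 0 ≤ κ := (abs_nonneg _).trans (h 0 (by omega))
    push_cast
    constructor <;> nlinarith

section Interpolation

variable {ι H : Type*} [Fintype ι] [DecidableEq ι] [Fintype H] [DecidableEq H]

/-- `meanLogZ_edge_le` after a list of factors that leaves at least `L` half-edges free. -/
theorem meanLogZ_append_edge_le {n : ℕ} (hn : 1 ≤ n) {κ : ℝ} (hκ : 0 ≤ κ)
    {Θ : Measure (Interaction n)} {β : Measure (ℝ × ℝ)} {φ : Measure (Spin → ℝ)}
    (hΘ : IsProductLaw κ Θ β φ) (ζ : Measure ℝ) [IsProbabilityMeasure ζ] (s : H → ι)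
    {l : List Factor} (hl : ∀ t ∈ l, t.IsBounded κ) (u : (ι → Spin) → ℝ) {L : ℕ} (hL : 1 ≤ L)
    (hfit : totalArity l + n + L ≤ Fintype.card H) :
    meanLogZ s (l ++ [edgeFactor Θ]) ∅ u ≤ meanLogZ s l ∅ u
      + n * (meanLogZ s (l ++ [fieldFactor Θ ζ]) ∅ u - meanLogZ s l ∅ u)
      - (n - 1) * bulkTerm Θ ζ + 2 * κ * ((n : ℝ) ^ 2 / L) := by
  have hbd := hΘ.isBounded
  have hL' : (0 : ℝ) < L := by exact_mod_cast hL
  have hx : ∀ k : Fin 3, ∀ t ∈ (![[edgeFactor Θ], [fieldFactor Θ ζ], []] : Fin 3 → List Factor) k,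
      t.IsBounded κ := by
    intro k t
    fin_cases k
    · simp only [Fin.zero_eta, Matrix.cons_val_zero, List.mem_singleton]
      rintro rfl; exact hbd
    · simp only [Fin.mk_one, Matrix.cons_val_one, Matrix.cons_val_zero, List.mem_singleton]
      rintro rfl; exact isBounded_fieldFactor hbd ζ
    · simp
  have h := sum_mul_meanLogZ_append_le s (![1, -(n : ℝ), n - 1] : Fin 3 → ℝ)
    ![[edgeFactor Θ], [fieldFactor Θ ζ], []] hx hl
    (-(n - 1) * bulkTerm Θ ζ + 2 * κ * ((n : ℝ) ^ 2 / L)) ∅ u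
    (by simp only [Finset.card_empty]; omega) fun A' u' hA' => by
      rw [Finset.card_empty, zero_add] at hA'
      have h1 := meanLogZ_edge_le hn hΘ ζ s A' u' (by omega)
      have h2 : (n : ℝ) ^ 2 / (Fintype.card H - A'.card : ℕ) ≤ (n : ℝ) ^ 2 / L := by
        refine div_le_div_of_nonneg_left (by positivity) hL' ?_
        exact_mod_cast (by omega : L ≤ Fintype.card H - A'.card)
      have h3 := mul_le_mul_of_nonneg_left h2 (by linarith : 0 ≤ 2 * κ)
      have h4 : meanLogZ s [] A' u' = logZ u' := rfl
      simp only [Fin.sum_univ_three, Matrix.cons_val_zero, Matrix.cons_val_one, Matrix.cons_val]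
      rw [h4]
      linarith
  simp only [Fin.sum_univ_three, Matrix.cons_val_zero, Matrix.cons_val_one, Matrix.cons_val,
    List.append_nil] at h
  linarith

/-- Replacing `m` interactions with the same law by `n * m` fields. The inequality for one
interaction compares it with `n` times the effect of the first field and not with the effect of `n`
fields; averaging over a window of `L` additional fields makes the two comparable, at the price of
placing these additional fields in the beginning and of removing them in the end. -/
theorem meanLogZ_replicate_edge_le {n : ℕ} (hn : 1 ≤ n) {κ : ℝ} (hκ : 0 ≤ κ)
    {Θ : Measure (Interaction n)} {β : Measure (ℝ × ℝ)} {φ : Measure (Spin → ℝ)}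
    (hΘ : IsProductLaw κ Θ β φ) (ζ : Measure ℝ) [IsProbabilityMeasure ζ] (s : H → ι)
    {l : List Factor} (hl : ∀ t ∈ l, t.IsBounded κ) (u : (ι → Spin) → ℝ) {L : ℕ} (hL : 1 ≤ L)
    (m : ℕ) (hfit : totalArity l + m * n + 2 * L ≤ Fintype.card H) :
    meanLogZ s (l ++ List.replicate m (edgeFactor Θ)) ∅ u
      ≤ meanLogZ s (l ++ List.replicate (m * n) (fieldFactor Θ ζ)) ∅ u
        - m * (n - 1) * bulkTerm Θ ζ + 2 * κ * L + 3 * κ * (n : ℝ) ^ 2 * m / L := by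
  have hbe := hΘ.isBounded
  have hbf := isBounded_fieldFactor hbe ζ
  set e := edgeFactor Θ with he
  set f := fieldFactor Θ ζ with hf
  have ae : e.arity = n := rfl
  have af : f.arity = 1 := rfl
  have hL' : (0 : ℝ) < L := by exact_mod_cast hL
  set g : ℕ → ℕ → ℝ := fun i j =>
    meanLogZ s (l ++ (List.replicate i e ++ List.replicate j f)) ∅ u with hg
  have hbd : ∀ i j, ∀ t ∈ l ++ (List.replicate i e ++ List.replicate j f), t.IsBounded κ := by
    intro i j t ht
    simp only [List.mem_append, List.mem_replicate] at ht
    rcases ht with ht | ⟨-, rfl⟩ | ⟨-, rfl⟩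
    exacts [hl t ht, hbe, hbf]
  have har : ∀ i j, totalArity (l ++ (List.replicate i e ++ List.replicate j f))
      = totalArity l + i * n + j := by
    intro i j
    simp [ae, af, add_assoc]
  have happ : ∀ i j, l ++ (List.replicate i e ++ List.replicate (j + 1) f)
      = l ++ (List.replicate i e ++ List.replicate j f) ++ [f] := by
    intro i j; simp [List.replicate_succ']
  have F₂ : ∀ i j, totalArity l + i * n + j + 1 ≤ Fintype.card H → |g i (j + 1) - g i j| ≤ κ := by
    intro i j hij
    simp only [hg]
    rw [happ]
    exact abs_meanLogZ_append_singleton_sub_le s (hbd i j) hbf ∅ u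
      (by rw [har, Finset.card_empty]; omega)
  have F₃ : ∀ i j, totalArity l + i * n + j + n + L ≤ Fintype.card H →
      g (i + 1) j ≤ g i j + n * (g i (j + 1) - g i j) - (n - 1) * bulkTerm Θ ζ
        + 2 * κ * ((n : ℝ) ^ 2 / L) := by
    intro i j hij
    have hp : (l ++ (List.replicate (i + 1) e ++ List.replicate j f)).Perm
        (l ++ (List.replicate i e ++ List.replicate j f) ++ [e]) := by
      rw [List.replicate_succ, List.cons_append]
      exact List.perm_middle.trans (List.perm_append_singleton _ _).symm
    have h := meanLogZ_append_edge_le hn hκ hΘ ζ s (hbd i j) u hL (by rw [har]; omega)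
    simp only [hg]
    rw [meanLogZ_perm s hp (hbd _ _), happ]
    exact h
  set a : ℕ → ℕ → ℝ := fun i k => ∑ t ∈ Finset.range L, g i (k + t) with ha
  have step : ∀ i k, totalArity l + (i + 1) * n + k + 2 * L ≤ Fintype.card H →
      a (i + 1) k ≤ a i (k + n) - L * (n - 1) * bulkTerm Θ ζ + 3 * κ * (n : ℝ) ^ 2 := by
    intro i k hik
    rw [Nat.add_mul, one_mul] at hik
    have h1 : a (i + 1) k ≤ ∑ t ∈ Finset.range L, (g i (k + t)
        + n * (g i (k + t + 1) - g i (k + t)) - (n - 1) * bulkTerm Θ ζ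
        + 2 * κ * ((n : ℝ) ^ 2 / L)) := by
      refine Finset.sum_le_sum fun t ht => F₃ i (k + t) ?_
      have := Finset.mem_range.1 ht
      omega
    have h2 := abs_windowSum_sub_le (f := g i) (κ := κ) (k := k) (L := L) (n := n)
      fun j hj => F₂ i j (by omega)
    have h3 : ∀ t, g i (k + 1 + t) = g i (k + t + 1) := fun t => by congr 1; omega
    simp only [h3] at h2
    rw [Finset.sum_add_distrib, Finset.sum_sub_distrib, Finset.sum_add_distrib, ← Finset.mul_sum,
      Finset.sum_sub_distrib, Finset.sum_const, Finset.sum_const, Finset.card_range,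
      nsmul_eq_mul, nsmul_eq_mul] at h1
    have h4 : (L : ℝ) * (2 * κ * ((n : ℝ) ^ 2 / L)) = 2 * κ * (n : ℝ) ^ 2 := by field_simp
    rw [h4] at h1
    have h5 := (abs_le.1 h2).1
    simp only [ha] at h1 ⊢
    linarith
  have total : ∀ j, j ≤ m → a m 0 ≤ a (m - j) (j * n) - j * (L * (n - 1) * bulkTerm Θ ζ)
      + j * (3 * κ * (n : ℝ) ^ 2) := by
    intro j
    induction j with
    | zero => intro _; simp
    | succ j ih =>
      intro hj
      have h1 := ih (by omega)
      obtain ⟨i, hi⟩ : ∃ i, m = i + j + 1 := ⟨m - j - 1, by omega⟩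
      have h2 := step i (j * n) (by
        have : totalArity l + (i + 1) * n + j * n = totalArity l + m * n := by rw [hi]; ring
        omega)
      rw [show m - j = i + 1 by omega] at h1
      rw [show m - (j + 1) = i by omega, show (j + 1) * n = j * n + n by ring]
      push_cast
      linarith
  have hend := total m le_rfl
  rw [Nat.sub_self] at hend
  have near : ∀ i k, totalArity l + i * n + k + L ≤ Fintype.card H → ∀ t ≤ L,
      |g i (k + t) - g i k| ≤ κ * t := by
    intro i k hik t
    induction t with
    | zero => simp
    | succ t ih =>
      intro ht
      have h1 := ih (by omega)
      have h2 := F₂ i (k + t) (by omega)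
      have h3 := abs_sub_le (g i (k + (t + 1))) (g i (k + t)) (g i k)
      rw [← add_assoc] at h3 ⊢
      push_cast
      linarith
  have start : L * g m 0 ≤ a m 0 + L * (κ * L) := by
    have : ∑ t ∈ Finset.range L, g m 0 ≤ ∑ t ∈ Finset.range L, (g m (0 + t) + κ * L) := by
      refine Finset.sum_le_sum fun t ht => ?_
      have ht' := (Finset.mem_range.1 ht).le
      have h1 := (abs_le.1 (near m 0 (by omega) t ht')).1
      have h2 : κ * t ≤ κ * L := by gcongr
      linarith
    rw [Finset.sum_add_distrib, Finset.sum_const, Finset.sum_const, Finset.card_range,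
      nsmul_eq_mul, nsmul_eq_mul] at this
    exact this
  have finish : a 0 (m * n) ≤ L * g 0 (m * n) + L * (κ * L) := by
    have : ∑ t ∈ Finset.range L, g 0 (m * n + t) ≤ ∑ t ∈ Finset.range L, (g 0 (m * n) + κ * L) := by
      refine Finset.sum_le_sum fun t ht => ?_
      have ht' := (Finset.mem_range.1 ht).le
      have h1 := (abs_le.1 (near 0 (m * n) (by omega) t ht')).2
      have h2 : κ * t ≤ κ * L := by gcongr
      linarith
    rw [Finset.sum_const, Finset.card_range, nsmul_eq_mul, mul_add] at this
    exact this
  have e₁ : g m 0 = meanLogZ s (l ++ List.replicate m e) ∅ u := by simp [hg]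
  have e₂ : g 0 (m * n) = meanLogZ s (l ++ List.replicate (m * n) f) ∅ u := by simp [hg]
  rw [← e₁, ← e₂]
  have : (L : ℝ) * g m 0 ≤ L * (g 0 (m * n) - m * (n - 1) * bulkTerm Θ ζ + 2 * κ * L
      + 3 * κ * (n : ℝ) ^ 2 * m / L) := by
    have h1 : (L : ℝ) * (3 * κ * (n : ℝ) ^ 2 * m / L) = 3 * κ * (n : ℝ) ^ 2 * m := by field_simp
    rw [mul_add, h1]
    linarith
  exact le_of_mul_le_mul_left this hL'

variable {P : Set ℕ} (Θ : (p : P) → Measure (Interaction p)) (ζ : Measure ℝ)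

/-- The factors of edges with the given sizes. -/
def edgeFactors (q : List P) : List Factor := q.map fun p : P => edgeFactor (Θ p)

/-- The cavity fields that replace edges with the given sizes. -/
noncomputable def fieldFactors (q : List P) : List Factor :=
  q.flatMap fun p : P => List.replicate p (fieldFactor (Θ p) ζ)

theorem totalArity_edgeFactors (q : List P) :
    totalArity (edgeFactors Θ q) = (q.map fun p : P => (p : ℕ)).sum := by
  simp [totalArity, edgeFactors, edgeFactor, Function.comp_def]

theorem totalArity_fieldFactors (q : List P) :
    totalArity (fieldFactors Θ ζ q) = (q.map fun p : P => (p : ℕ)).sum := by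
  induction q with
  | nil => rfl
  | cons p q ih =>
    rw [fieldFactors, List.flatMap_cons, totalArity_append, totalArity_replicate, List.map_cons,
      List.sum_cons]
    exact congrArg₂ _ (mul_one _) ih

theorem length_fieldFactors (q : List P) :
    (fieldFactors Θ ζ q).length = (q.map fun p : P => (p : ℕ)).sum := by
  simp [fieldFactors, List.length_flatMap]

theorem fieldFactors_replicate (m : ℕ) (p : P) :
    fieldFactors Θ ζ (List.replicate m p) = List.replicate (m * p) (fieldFactor (Θ p) ζ) := by
  induction m with
  | zero => simp [fieldFactors]
  | succ m ih =>
    rw [fieldFactors] at ih ⊢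
    rw [List.replicate_succ, List.flatMap_cons, ih, List.replicate_append_replicate]
    congr 1; ring

theorem fieldFactors_append (q q' : List P) :
    fieldFactors Θ ζ (q ++ q') = fieldFactors Θ ζ q ++ fieldFactors Θ ζ q' := by
  simp [fieldFactors]

theorem edgeFactors_append (q q' : List P) :
    edgeFactors Θ (q ++ q') = edgeFactors Θ q ++ edgeFactors Θ q' := by
  simp [edgeFactors]

theorem edgeFactors_perm {q q' : List P} (h : q.Perm q') :
    (edgeFactors Θ q).Perm (edgeFactors Θ q') := h.map _

theorem fieldFactors_perm {q q' : List P} (h : q.Perm q') :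
    (fieldFactors Θ ζ q).Perm (fieldFactors Θ ζ q') := h.flatMap_right _

variable {Θ} {κ : ℝ}

theorem isBounded_edgeFactors (hΘ : ∀ p, (edgeFactor (Θ p)).IsBounded κ) (q : List P) :
    ∀ t ∈ edgeFactors Θ q, t.IsBounded κ := by
  intro t ht
  obtain ⟨p, -, rfl⟩ := List.mem_map.1 ht
  exact hΘ p

theorem isBounded_fieldFactors [IsProbabilityMeasure ζ]
    (hΘ : ∀ p, (edgeFactor (Θ p)).IsBounded κ) (q : List P) :
    ∀ t ∈ fieldFactors Θ ζ q, t.IsBounded κ := by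
  intro t ht
  obtain ⟨p, -, hp⟩ := List.mem_flatMap.1 ht
  rw [List.eq_of_mem_replicate hp]
  exact isBounded_fieldFactor (hΘ p) ζ

theorem isBounded_append {l l' : List Factor} (h : ∀ t ∈ l, t.IsBounded κ)
    (h' : ∀ t ∈ l', t.IsBounded κ) : ∀ t ∈ l ++ l', t.IsBounded κ := by
  intro t ht
  rcases List.mem_append.1 ht with ht | ht
  exacts [h t ht, h' t ht]

/-- Replacing the edges with sizes in a list `ps` by fields, one size after the other. -/
theorem meanLogZ_edgeFactors_le_of_mem [IsProbabilityMeasure ζ] (hP : ∀ p ∈ P, 2 ≤ p)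
    (hκ : 0 ≤ κ) (hΘ : ∀ p, ∃ β φ, IsProductLaw κ (Θ p) β φ) (s : H → ι)
    (u : (ι → Spin) → ℝ) {K L : ℕ} (hL : 1 ≤ L) (ps : List P) (hps : ∀ p ∈ ps, (p : ℕ) ≤ K)
    (q : List P) (hq : ∀ p ∈ q, p ∈ ps) {l : List Factor} (hl : ∀ t ∈ l, t.IsBounded κ)
    (hfit : totalArity l + (q.map fun p : P => (p : ℕ)).sum + 2 * L ≤ Fintype.card H) :
    meanLogZ s (l ++ edgeFactors Θ q) ∅ u ≤ meanLogZ s (l ++ fieldFactors Θ ζ q) ∅ u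
      - (q.map fun p : P => (((p : ℕ) : ℝ) - 1) * bulkTerm (Θ p) ζ).sum
      + ps.length * (2 * κ * L) + 3 * κ * (K : ℝ) ^ 2 * q.length / L := by
  classical
  have hbd : ∀ p, (edgeFactor (Θ p)).IsBounded κ := fun p => by
    obtain ⟨β, φ, h⟩ := hΘ p; exact h.isBounded
  have hL' : (0 : ℝ) < L := by exact_mod_cast hL
  induction ps generalizing q l with
  | nil =>
    have : q = [] := List.eq_nil_iff_forall_not_mem.2 fun p hp => by simpa using hq p hp
    subst this
    simp [edgeFactors, fieldFactors]
  | cons p ps ih =>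
    set m := q.count p with hm
    set q' := q.filter fun x => !(x == p) with hq'
    have hperm : (List.replicate m p ++ q').Perm q := by
      have := List.filter_append_perm (fun x => x == p) q
      rwa [List.filter_beq] at this
    have hsum : (q.map fun p : P => (p : ℕ)).sum = m * p + (q'.map fun p : P => (p : ℕ)).sum := by
      rw [← (hperm.map _).sum_eq]; simp
    have hsum' : (q.map fun p : P => (((p : ℕ) : ℝ) - 1) * bulkTerm (Θ p) ζ).sum
        = m * ((((p : ℕ) : ℝ) - 1) * bulkTerm (Θ p) ζ)
          + (q'.map fun p : P => (((p : ℕ) : ℝ) - 1) * bulkTerm (Θ p) ζ).sum := by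
      rw [← (hperm.map _).sum_eq]; simp
    have hlen : q.length = m + q'.length := by rw [← hperm.length_eq]; simp
    have hpE : (edgeFactors Θ q).Perm
        (edgeFactors Θ q' ++ List.replicate m (edgeFactor (Θ p))) := by
      refine (hperm.symm.map _).trans ?_
      rw [List.map_append, List.map_replicate]
      exact List.perm_append_comm
    have hpF : (fieldFactors Θ ζ q).Perm
        (List.replicate (m * p) (fieldFactor (Θ p) ζ) ++ fieldFactors Θ ζ q') := by
      rw [← fieldFactors_replicate, ← fieldFactors_append]
      exact hperm.symm.flatMap_right _
    have hp : (p : ℕ) ≤ K := hps p List.mem_cons_self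
    obtain ⟨β, φ, hpl⟩ := hΘ p
    have bE := isBounded_edgeFactors hbd q'
    have bf : ∀ t ∈ List.replicate (m * p) (fieldFactor (Θ p) ζ), t.IsBounded κ := fun t ht => by
      rw [List.eq_of_mem_replicate ht]; exact isBounded_fieldFactor (hbd p) ζ
    have h1 := meanLogZ_replicate_edge_le (by have := hP p p.2; omega) hκ hpl ζ s
      (isBounded_append hl bE) u hL m (by
        rw [totalArity_append, totalArity_edgeFactors]; omega)
    have h2 := ih (fun x hx => hps x (List.mem_cons_of_mem _ hx)) q' (fun x hx => by
        have hx' := List.mem_filter.1 hx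
        have := hq x hx'.1
        rcases List.mem_cons.1 this with h | h
        · simp [h] at hx'
        · exact h) (isBounded_append hl bf) (by
        rw [totalArity_append, totalArity_replicate]
        change totalArity l + m * p * 1 + _ + _ ≤ _
        omega)
    have e₁ : meanLogZ s (l ++ edgeFactors Θ q) ∅ u = meanLogZ s (l ++ edgeFactors Θ q'
        ++ List.replicate m (edgeFactor (Θ p))) ∅ u := by
      refine meanLogZ_perm s ?_ (isBounded_append hl (isBounded_edgeFactors hbd q)) ∅ u
      rw [List.append_assoc]
      exact hpE.append_left l
    have e₂ : meanLogZ s (l ++ edgeFactors Θ q' ++ List.replicate (m * p)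
        (fieldFactor (Θ p) ζ)) ∅ u = meanLogZ s (l ++ List.replicate (m * p)
        (fieldFactor (Θ p) ζ) ++ edgeFactors Θ q') ∅ u := by
      refine meanLogZ_perm s ?_ (isBounded_append (isBounded_append hl bE) bf) ∅ u
      rw [List.append_assoc, List.append_assoc]
      exact List.perm_append_comm.append_left l
    have e₃ : meanLogZ s (l ++ fieldFactors Θ ζ q) ∅ u = meanLogZ s (l ++ List.replicate (m * p)
        (fieldFactor (Θ p) ζ) ++ fieldFactors Θ ζ q') ∅ u := by
      refine meanLogZ_perm s ?_ (isBounded_append hl (isBounded_fieldFactors ζ hbd q)) ∅ u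
      rw [List.append_assoc]
      exact hpF.append_left l
    rw [e₁, e₃, hsum', hlen]
    rw [e₂] at h1
    have h3 : 3 * κ * ((p : ℕ) : ℝ) ^ 2 * m / L ≤ 3 * κ * (K : ℝ) ^ 2 * m / L := by
      have : ((p : ℕ) : ℝ) ≤ K := by exact_mod_cast hp
      gcongr
    have h4 : 3 * κ * (K : ℝ) ^ 2 * ((m + q'.length : ℕ) : ℝ) / L
        = 3 * κ * (K : ℝ) ^ 2 * m / L + 3 * κ * (K : ℝ) ^ 2 * q'.length / L := by
      push_cast; ring
    rw [h4, List.length_cons]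
    push_cast
    linarith

/-- Replacing all the edges by fields. The edges of size larger than `K` and up to `L` other ones
are removed in the beginning and their fields are placed in the end, so that there are enough free
half-edges in between. -/
theorem meanLogZ_edgeFactors_le [IsProbabilityMeasure ζ] (hP : ∀ p ∈ P, 2 ≤ p)
    (hκ : 0 ≤ κ) (hΘ : ∀ p, ∃ β φ, IsProductLaw κ (Θ p) β φ) (s : H → ι)
    (u : (ι → Spin) → ℝ) (K : ℕ) {L : ℕ} (hL : 1 ≤ L) (q : List P)
    (hfit : (q.map fun p : P => (p : ℕ)).sum ≤ Fintype.card H) :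
    meanLogZ s (edgeFactors Θ q) ∅ u ≤ meanLogZ s (fieldFactors Θ ζ q) ∅ u
      - (q.map fun p : P => (((p : ℕ) : ℝ) - 1) * bulkTerm (Θ p) ζ).sum
      + 3 * κ * ((((q.filter fun p : P => K < p).map fun p : P => (p : ℕ)).sum : ℕ) + K * L)
      + (K + 1) * (2 * κ * L) + 3 * κ * (K : ℝ) ^ 2 * q.length / L := by
  classical
  have hbd : ∀ p, (edgeFactor (Θ p)).IsBounded κ := fun p => by
    obtain ⟨β, φ, h⟩ := hΘ p; exact h.isBounded
  have hL' : (0 : ℝ) < L := by exact_mod_cast hL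
  set big := q.filter fun p : P => decide (K < (p : ℕ)) with hbig
  set small := q.filter fun p : P => !decide (K < (p : ℕ)) with hsmall
  set R := big ++ small.take L with hR
  set q' := small.drop L with hq'
  have hsm : ∀ p ∈ small, (p : ℕ) ≤ K := by
    intro p hp
    have := (List.mem_filter.1 hp).2
    simpa using this
  have hperm : (q' ++ R).Perm q := by
    refine List.perm_append_comm.trans ?_
    rw [hR, List.append_assoc, List.take_append_drop]
    exact List.filter_append_perm _ q
  have hsum : (q.map fun p : P => (p : ℕ)).sum
      = (q'.map fun p : P => (p : ℕ)).sum + (R.map fun p : P => (p : ℕ)).sum := by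
    rw [← (hperm.map _).sum_eq]; simp
  have hsum' : (q.map fun p : P => (((p : ℕ) : ℝ) - 1) * bulkTerm (Θ p) ζ).sum
      = (q'.map fun p : P => (((p : ℕ) : ℝ) - 1) * bulkTerm (Θ p) ζ).sum
        + (R.map fun p : P => (((p : ℕ) : ℝ) - 1) * bulkTerm (Θ p) ζ).sum := by
    rw [← (hperm.map _).sum_eq]; simp
  have hlen : (q'.length : ℝ) ≤ q.length := by
    rw [← hperm.length_eq]
    exact_mod_cast (by simp : q'.length ≤ (q' ++ R).length)
  set r := (R.map fun p : P => (p : ℕ)).sum with hr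
  have hr1 : r ≤ (big.map fun p : P => (p : ℕ)).sum + K * L := by
    rw [hr, hR, List.map_append, List.sum_append]
    gcongr
    have h1 : ((small.take L).map fun p : P => (p : ℕ)).sum ≤ (small.take L).length • K := by
      have := List.sum_le_card_nsmul ((small.take L).map fun p : P => (p : ℕ)) K (by
        intro x hx
        obtain ⟨p, hp, rfl⟩ := List.mem_map.1 hx
        exact hsm p (List.mem_of_mem_take hp))
      simpa using this
    refine h1.trans ?_
    rw [smul_eq_mul, mul_comm]
    exact Nat.mul_le_mul_left K (List.length_take_le L small)
  have hRlen : R.length ≤ r := by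
    have : ∀ R : List P, R.length ≤ (R.map fun p : P => (p : ℕ)).sum := by
      intro R
      induction R with
      | nil => simp
      | cons p R ih =>
        have := hP p p.2
        simp only [List.length_cons, List.map_cons, List.sum_cons]
        omega
    exact this R
  have hRbulk : |(R.map fun p : P => (((p : ℕ) : ℝ) - 1) * bulkTerm (Θ p) ζ).sum| ≤ κ * r := by
    have : ∀ R : List P, |(R.map fun p : P => (((p : ℕ) : ℝ) - 1) * bulkTerm (Θ p) ζ).sum|
        ≤ κ * ((R.map fun p : P => (p : ℕ)).sum : ℕ) := by
      intro R
      induction R with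
      | nil => simp
      | cons p R ih =>
        have hp2 : (2 : ℝ) ≤ ((p : ℕ) : ℝ) := by exact_mod_cast hP p p.2
        have hb := abs_bulkTerm_le (hbd p) ζ
        simp only [List.map_cons, List.sum_cons]
        refine (abs_add_le _ _).trans ?_
        rw [abs_mul, abs_of_nonneg (by linarith : (0 : ℝ) ≤ ((p : ℕ) : ℝ) - 1)]
        rw [Nat.cast_add]
        nlinarith
    exact this R
  have bE' := isBounded_edgeFactors hbd q'
  have bF' := isBounded_fieldFactors ζ hbd q'
  have hE : meanLogZ s (edgeFactors Θ q) ∅ u ≤ meanLogZ s (edgeFactors Θ q') ∅ u + κ * r := by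
    have h1 := abs_meanLogZ_append_sub_le s bE' (isBounded_edgeFactors hbd R) ∅ u (by
      rw [← edgeFactors_append, totalArity_edgeFactors, (hperm.map _).sum_eq, Finset.card_empty]
      omega)
    rw [← edgeFactors_append,
      meanLogZ_perm s (edgeFactors_perm Θ hperm) (isBounded_edgeFactors hbd _)] at h1
    have h2 : (edgeFactors Θ R).length = R.length := by simp [edgeFactors]
    have h3 : κ * ((edgeFactors Θ R).length : ℝ) ≤ κ * r := by
      rw [h2]
      exact mul_le_mul_of_nonneg_left (by exact_mod_cast hRlen) hκ
    have := (abs_le.1 h1).2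
    linarith
  have hF : meanLogZ s (fieldFactors Θ ζ q') ∅ u ≤ meanLogZ s (fieldFactors Θ ζ q) ∅ u
      + κ * r := by
    have h1 := abs_meanLogZ_append_sub_le s bF' (isBounded_fieldFactors ζ hbd R) ∅ u (by
      rw [← fieldFactors_append, totalArity_fieldFactors, (hperm.map _).sum_eq, Finset.card_empty]
      omega)
    rw [← fieldFactors_append, meanLogZ_perm s (fieldFactors_perm Θ ζ hperm)
      (isBounded_fieldFactors ζ hbd _), length_fieldFactors] at h1
    have := (abs_le.1 h1).1
    linarith
  have hmid : meanLogZ s (edgeFactors Θ q') ∅ u ≤ meanLogZ s (fieldFactors Θ ζ q') ∅ u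
      - (q'.map fun p : P => (((p : ℕ) : ℝ) - 1) * bulkTerm (Θ p) ζ).sum
      + (K + 1) * (2 * κ * L) + 3 * κ * (K : ℝ) ^ 2 * q'.length / L := by
    rcases List.eq_nil_or_concat q' with h0 | ⟨_, _, h0⟩
    · have : (0 : ℝ) ≤ (K + 1) * (2 * κ * L) := by positivity
      rw [h0]
      simpa [edgeFactors, fieldFactors] using this
    · have hLs : L < small.length := by
        by_contra hcon
        have : q' = [] := List.drop_eq_nil_of_le (by omega)
        rw [this] at h0
        simp at h0
      have hr2 : 2 * L ≤ r := by
        have h1 : (small.take L).length • 2 ≤ ((small.take L).map fun p : P => (p : ℕ)).sum := by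
          have := List.card_nsmul_le_sum ((small.take L).map fun p : P => (p : ℕ)) 2 (by
            intro x hx
            obtain ⟨p, -, rfl⟩ := List.mem_map.1 hx
            exact hP p p.2)
          simpa using this
        rw [List.length_take, min_eq_left hLs.le, smul_eq_mul] at h1
        rw [hr, hR, List.map_append, List.sum_append]
        omega
      have hdd : small.dedup.length ≤ K + 1 := by
        have h1 := Finset.card_le_card_of_injOn (s := small.toFinset)
          (t := Finset.range (K + 1)) (fun p : P => (p : ℕ)) (by
            intro p hp
            have := hsm p (List.mem_toFinset.1 hp)
            simp only [Finset.coe_range, Set.mem_Iio]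
            omega) (fun p _ p' _ h => Subtype.ext h)
        rwa [Finset.card_range, List.card_toFinset] at h1
      have h := meanLogZ_edgeFactors_le_of_mem ζ hP hκ hΘ s u hL small.dedup
        (fun p hp => hsm p (List.mem_dedup.1 hp)) q'
        (fun p hp => List.mem_dedup.2 (List.mem_of_mem_drop hp)) (l := []) (by simp) (by
          rw [totalArity_nil]; omega)
      have h2 : (small.dedup.length : ℝ) * (2 * κ * L) ≤ (K + 1) * (2 * κ * L) := by
        gcongr
        exact_mod_cast hdd
      simp only [List.nil_append] at h
      linarith
  have h3 : 3 * κ * (K : ℝ) ^ 2 * q'.length / L ≤ 3 * κ * (K : ℝ) ^ 2 * q.length / L := by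
    gcongr
  have h4 : (r : ℝ) ≤ ((big.map fun p : P => (p : ℕ)).sum : ℕ) + K * L := by exact_mod_cast hr1
  have h5 : 3 * κ * (r : ℝ) ≤ 3 * κ * (((big.map fun p : P => (p : ℕ)).sum : ℕ) + K * L) := by
    gcongr
  have h6 := (abs_le.1 hRbulk).2
  rw [hsum']
  linarith

end Interpolation

/-! ### Simultaneous placement of a family of factors -/

section MultiPlacement

variable {ι H : Type*} [Fintype ι] [DecidableEq ι] [Fintype H] [DecidableEq H]

/-- The placements of a family of factors of arities `r` on distinct half-edges outside `A`. -/
def multiPlaces {I : Type*} [Fintype I] [DecidableEq I] (A : Finset H) (r : I → ℕ) :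
    Finset ((i : I) → Fin (r i) → H) :=
  Finset.univ.filter fun v =>
    Function.Injective (fun x : (i : I) × Fin (r i) => v x.1 x.2) ∧ ∀ i j, v i j ∉ A

theorem mem_multiPlaces {I : Type*} [Fintype I] [DecidableEq I] {A : Finset H} {r : I → ℕ}
    {v : (i : I) → Fin (r i) → H} : v ∈ multiPlaces A r ↔
      Function.Injective (fun x : (i : I) × Fin (r i) => v x.1 x.2) ∧ ∀ i j, v i j ∉ A := by
  simp [multiPlaces]

theorem card_multiPlaces {I : Type*} [Fintype I] [DecidableEq I] (A : Finset H) (r : I → ℕ) :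
    (multiPlaces A r).card = (Fintype.card H - A.card).descFactorial (∑ i, r i) := by
  have e : {v : (i : I) → Fin (r i) → H // Function.Injective
        (fun x : (i : I) × Fin (r i) => v x.1 x.2) ∧ ∀ i j, v i j ∉ A} ≃
      (((i : I) × Fin (r i)) ↪ {h // h ∉ A}) :=
    { toFun := fun v => ⟨fun x => ⟨v.1 x.1 x.2, v.2.2 x.1 x.2⟩,
        fun i j hij => v.2.1 (congrArg Subtype.val hij)⟩
      invFun := fun w => ⟨fun i j => (w ⟨i, j⟩).1, fun i j hij => w.2 (Subtype.ext hij),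
        fun i j => (w ⟨i, j⟩).2⟩
      left_inv := fun v => rfl
      right_inv := fun w => rfl }
  rw [multiPlaces, ← Fintype.card_subtype, Fintype.card_congr e, Fintype.card_embedding_eq,
    Fintype.card_sigma, Fintype.card_subtype_compl]
  simp

/-- The energy `u` with a family of interactions added. -/
def attachAll {I : Type*} [Fintype I] (s : H → ι) (u : (ι → Spin) → ℝ) {r : I → ℕ}
    (v : (i : I) → Fin (r i) → H) (θ : (i : I) → Interaction (r i)) : (ι → Spin) → ℝ :=
  fun σ => u σ + ∑ i, θ i fun j => σ (s (v i j))

theorem continuous_logZ : Continuous (logZ : ((ι → Spin) → ℝ) → ℝ) :=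
  continuous_of_abs_sub_le fun _ _ _ h => abs_logZ_sub_le h

theorem continuous_logZ_attachAll {ι H I : Type*} [Fintype ι] [DecidableEq ι] [Fintype I]
    (s : H → ι) (u : (ι → Spin) → ℝ)
    {r : I → ℕ} (v : (i : I) → Fin (r i) → H) :
    Continuous fun θ : (i : I) → Interaction (r i) => logZ (attachAll s u v θ) := by
  refine continuous_logZ.comp ?_
  unfold attachAll
  fun_prop

theorem ae_pi_forall {I : Type*} [Fintype I] {X : I → Type*} [∀ i, MeasurableSpace (X i)]
    (μ : (i : I) → Measure (X i)) [∀ i, IsProbabilityMeasure (μ i)] {p : (i : I) → X i → Prop}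
    (h : ∀ i, ∀ᵐ x ∂μ i, p i x) : ∀ᵐ x ∂Measure.pi μ, ∀ i, p i (x i) :=
  ae_all_iff.2 fun i => (measurePreserving_eval μ i).quasiMeasurePreserving.ae (h i)

theorem integrable_logZ_attachAll {ι H I : Type*} [Fintype ι] [DecidableEq ι] [Fintype I] {κ : ℝ}
    (t : I → Factor)
    (ht : ∀ i, (t i).IsBounded κ) (s : H → ι) (u : (ι → Spin) → ℝ)
    (v : (i : I) → Fin (t i).arity → H) :
    Integrable (fun θ => logZ (attachAll s u v θ)) (Measure.pi fun i => (t i).law) := by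
  have := fun i => (ht i).1
  refine Integrable.of_bound (continuous_logZ_attachAll s u v).measurable.aestronglyMeasurable
    (|logZ u| + Fintype.card I * κ) ?_
  filter_upwards [ae_pi_forall (fun i => (t i).law) fun i => (ht i).2] with θ hθ
  have h1 : |logZ (attachAll s u v θ) - logZ u| ≤ Fintype.card I * κ := by
    refine abs_logZ_sub_le fun σ => ?_
    rw [attachAll, add_sub_cancel_left]
    calc _ ≤ ∑ i, |θ i fun j => σ (s (v i j))| := Finset.abs_sum_le_sum_abs _ _
      _ ≤ ∑ _i : I, κ := Finset.sum_le_sum fun i _ => hθ i _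
      _ = _ := by simp
  rw [Real.norm_eq_abs]
  have h2 := abs_sub_abs_le_abs_sub (logZ (attachAll s u v θ)) (logZ u)
  linarith

theorem integral_pi_succ {n : ℕ} {X : Fin (n + 1) → Type} [∀ i, MeasurableSpace (X i)]
    (μ : (i : Fin (n + 1)) → Measure (X i)) [∀ i, IsProbabilityMeasure (μ i)]
    (F : ((i : Fin (n + 1)) → X i) → ℝ) (hF : Integrable F (Measure.pi μ)) :
    ∫ x, F x ∂Measure.pi μ = ∫ x₀, ∫ x' : (i : Fin n) → X i.succ, F (Fin.cons x₀ x')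
      ∂(Measure.pi fun i => μ i.succ) ∂μ 0 := by
  have h := (measurePreserving_piFinSuccAbove μ 0).symm
  have e : ∀ z : X 0 × ((i : Fin n) → X i.succ),
      (MeasurableEquiv.piFinSuccAbove X 0).symm z = Fin.cons z.1 z.2 := by
    intro z
    exact Fin.insertNth_zero (α := X) z.1 z.2
  rw [← h.integral_comp', integral_prod]
  · exact integral_congr_ae (Eventually.of_forall fun x₀ =>
      integral_congr_ae (Eventually.of_forall fun x' => congrArg F (e (x₀, x'))))
  · exact (h.integrable_comp_emb (MeasurableEquiv.measurableEmbedding _)).2 hF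

theorem meanLogZ_ofFn (s : H → ι) {κ : ℝ} {n : ℕ} (t : Fin n → Factor)
    (ht : ∀ i, (t i).IsBounded κ) (A : Finset H) (u : (ι → Spin) → ℝ) :
    meanLogZ s (List.ofFn t) A u
      = (∑ v ∈ multiPlaces A fun i => (t i).arity,
          ∫ θ, logZ (attachAll s u v θ) ∂(Measure.pi fun i => (t i).law))
        / (((Fintype.card H - A.card).descFactorial (∑ i, (t i).arity) : ℕ) : ℝ) := by
  induction n generalizing A u with
  | zero =>
    have h1 : multiPlaces A (fun i => (t i).arity) = {fun i => i.elim0} := by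
      ext v
      simp only [mem_multiPlaces, Finset.mem_singleton]
      constructor
      · intro _; funext i; exact i.elim0
      · intro _; exact ⟨fun x => x.1.elim0, fun i => i.elim0⟩
    have h2 : ∀ (v : (i : Fin 0) → Fin (t i).arity → H) (θ : (i : Fin 0) → Interaction (t i).arity),
        attachAll s u v θ = u := by
      intro v θ; funext σ; simp [attachAll]
    have := fun i => (ht i).1
    simp [h1, h2, meanLogZ]
  | succ n ih =>
    have pt := fun i => (ht i).1
    rw [List.ofFn_succ, meanLogZ]
    have h1 : ∀ v ∈ places A (t 0).arity,
        ∫ θ, meanLogZ s (List.ofFn fun i : Fin n => t i.succ) (A ∪ Finset.univ.image v)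
          (attach s u v θ) ∂(t 0).law
        = (∑ v' ∈ multiPlaces (A ∪ Finset.univ.image v) fun i : Fin n => (t i.succ).arity,
            ∫ θ, ∫ θ', logZ (attachAll s (attach s u v θ) v' θ')
              ∂(Measure.pi fun i : Fin n => (t i.succ).law) ∂(t 0).law)
          / (((Fintype.card H - A.card - (t 0).arity).descFactorial
              (∑ i : Fin n, (t i.succ).arity) : ℕ) : ℝ) := by
      intro v hv
      simp_rw [ih (fun i => t i.succ) (fun i => ht i.succ)]
      rw [integral_div, card_union_image hv, Nat.sub_add_eq, integral_finsetSum]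
      intro v' _
      have hL : ∀ u u' : (ι → Spin) → ℝ, ∀ c : ℝ, (∀ σ, |u σ - u' σ| ≤ c) →
          |(∫ θ', logZ (attachAll s u v' θ') ∂(Measure.pi fun i : Fin n => (t i.succ).law))
            - ∫ θ', logZ (attachAll s u' v' θ')
              ∂(Measure.pi fun i : Fin n => (t i.succ).law)| ≤ c := by
        intro u u' c h
        rw [← integral_sub
          (integrable_logZ_attachAll (fun i : Fin n => t i.succ) (fun i => ht i.succ) s u v')
          (integrable_logZ_attachAll (fun i : Fin n => t i.succ) (fun i => ht i.succ) s u' v'),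
          ← Real.norm_eq_abs]
        refine (norm_integral_le_of_norm_le_const (C := c)
          (Eventually.of_forall fun θ => ?_)).trans (by simp)
        refine abs_logZ_sub_le fun σ => ?_
        simpa [attachAll] using h σ
      exact integrable_comp_attach hL (ht 0) s u v
    rw [Finset.sum_congr rfl h1, ← Finset.sum_div, div_div, card_places, Fin.sum_univ_succ,
      ← Nat.cast_mul]
    have h' := Nat.descFactorial_mul_descFactorial (n := Fintype.card H - A.card)
      (Nat.le_add_right (t 0).arity (∑ i : Fin n, (t i.succ).arity))
    rw [Nat.add_sub_cancel_left] at h'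
    rw [h', Finset.sum_sigma']
    congr 1
    refine Finset.sum_bij (fun x _ => (Fin.cons x.1 x.2 : (i : Fin (n + 1)) → Fin (t i).arity → H))
      ?_ ?_ ?_ ?_
    · rintro ⟨v, v'⟩ hx
      rw [Finset.mem_sigma, mem_places, mem_multiPlaces] at hx
      simp only [Finset.mem_union, Finset.mem_image, Finset.mem_univ, true_and, not_or,
        not_exists] at hx
      obtain ⟨⟨h₁, h₂⟩, h₃, h₄⟩ := hx
      rw [mem_multiPlaces]
      constructor
      · rintro ⟨i, k⟩ ⟨i', k'⟩ hik
        induction i using Fin.cases with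
        | zero =>
          induction i' using Fin.cases with
          | zero =>
            simp only [Fin.cons_zero] at hik
            rw [h₁ hik]
          | succ i' =>
            simp only [Fin.cons_zero, Fin.cons_succ] at hik
            exact absurd hik ((h₄ i' k').2 k)
        | succ i =>
          induction i' using Fin.cases with
          | zero =>
            simp only [Fin.cons_zero, Fin.cons_succ] at hik
            exact absurd hik.symm ((h₄ i k).2 k')
          | succ i' =>
            simp only [Fin.cons_succ] at hik
            have := h₃ (a₁ := ⟨i, k⟩) (a₂ := ⟨i', k'⟩) hik
            rw [Sigma.mk.injEq] at this
            obtain ⟨rfl, hk⟩ := this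
            rw [eq_of_heq hk]
      · intro i k
        induction i using Fin.cases with
        | zero => exact h₂ k
        | succ i => exact (h₄ i k).1
    · rintro ⟨v, v'⟩ - ⟨w, w'⟩ - h
      obtain ⟨rfl, rfl⟩ := Fin.cons_injective2 h
      rfl
    · intro w hw
      rw [mem_multiPlaces] at hw
      refine ⟨⟨w 0, fun i => w i.succ⟩, ?_, Fin.cons_self_tail w⟩
      rw [Finset.mem_sigma, mem_places, mem_multiPlaces]
      simp only [Finset.mem_union, Finset.mem_image, Finset.mem_univ, true_and, not_or,
        not_exists]
      refine ⟨⟨fun k k' h => ?_, hw.2 0⟩, fun x x' h => ?_, fun i k => ⟨hw.2 _ _, fun k' h => ?_⟩⟩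
      · have := hw.1 (a₁ := ⟨0, k⟩) (a₂ := ⟨0, k'⟩) h
        simpa using this
      · have := hw.1 (a₁ := ⟨x.1.succ, x.2⟩) (a₂ := ⟨x'.1.succ, x'.2⟩) h
        rw [Sigma.mk.injEq] at this
        obtain ⟨x1, x2⟩ := x
        obtain ⟨y1, y2⟩ := x'
        have h1 := Fin.succ_injective _ this.1
        subst h1
        simpa using this.2
      · have := hw.1 (a₁ := ⟨0, k'⟩) (a₂ := ⟨i.succ, k⟩) h
        rw [Sigma.mk.injEq] at this
        exact Fin.succ_ne_zero i this.1.symm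
    · rintro ⟨v, v'⟩ -
      rw [integral_pi_succ _ _ (integrable_logZ_attachAll t ht s u _)]
      refine integral_congr_ae (Eventually.of_forall fun θ =>
        integral_congr_ae (Eventually.of_forall fun θ' => ?_))
      simp only
      congr 1
      funext σ
      simp only [attachAll, attach, Fin.sum_univ_succ, Fin.cons_zero, Fin.cons_succ, add_assoc]

/-- Placing the factors one after the other or simultaneously amounts to the same. -/
theorem meanLogZ_eq_average (s : H → ι) {κ : ℝ} {I : Type*} [Fintype I] [DecidableEq I]
    (t : I → Factor) (ht : ∀ i, (t i).IsBounded κ) {l : List Factor}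
    (hl : (l : Multiset Factor) = Finset.univ.val.map t) (A : Finset H) (u : (ι → Spin) → ℝ) :
    meanLogZ s l A u
      = (∑ v ∈ multiPlaces A fun i => (t i).arity,
          ∫ θ, logZ (attachAll s u v θ) ∂(Measure.pi fun i => (t i).law))
        / (((Fintype.card H - A.card).descFactorial (∑ i, (t i).arity) : ℕ) : ℝ) := by
  have pt := fun i => (ht i).1
  set e : Fin (Fintype.card I) ≃ I := (Fintype.equivFin I).symm
  have hperm : l.Perm (List.ofFn fun k => t (e k)) := by
    rw [← Multiset.coe_eq_coe, hl, List.ofFn_eq_map, ← Multiset.map_coe]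
    have : (Finset.univ : Finset I).val = Multiset.map e (List.finRange (Fintype.card I)) := by
      have h1 := congrArg Finset.val (Finset.map_univ_equiv e)
      rw [← h1, Finset.map_val]
      rfl
    rw [this, Multiset.map_map]
    rfl
  have hl' : ∀ x ∈ l, x.IsBounded κ := by
    intro x hx
    have : x ∈ (l : Multiset Factor) := hx
    rw [hl, Multiset.mem_map] at this
    obtain ⟨i, -, rfl⟩ := this
    exact ht i
  rw [meanLogZ_perm s hperm hl', meanLogZ_ofFn s (fun k => t (e k)) (fun k => ht (e k)),
    Equiv.sum_comp e fun i => (t i).arity]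
  congr 1
  symm
  refine Finset.sum_bij (fun w _ k => w (e k)) ?_ ?_ ?_ ?_
  · intro w hw
    rw [mem_multiPlaces] at hw ⊢
    refine ⟨fun x x' h => ?_, fun k j => hw.2 _ _⟩
    have := hw.1 (a₁ := ⟨e x.1, x.2⟩) (a₂ := ⟨e x'.1, x'.2⟩) h
    obtain ⟨x1, x2⟩ := x
    obtain ⟨y1, y2⟩ := x'
    rw [Sigma.mk.injEq] at this
    have h1 := e.injective this.1
    subst h1
    simpa using this.2
  · intro w _ w' _ h
    exact (Equiv.piCongrLeft (fun i => Fin (t i).arity → H) e).symm.injective h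
  · intro w hw
    obtain ⟨w', hw'⟩ := (Equiv.piCongrLeft (fun i => Fin (t i).arity → H) e).symm.surjective w
    have hw'' : (fun k => w' (e k)) = w := hw'
    refine ⟨w', ?_, hw''⟩
    rw [mem_multiPlaces] at hw ⊢
    subst hw''
    refine ⟨fun x x' h => ?_, fun i j => ?_⟩
    · obtain ⟨i, j⟩ := x
      obtain ⟨i', j'⟩ := x'
      obtain ⟨k, rfl⟩ := e.surjective i
      obtain ⟨k', rfl⟩ := e.surjective i'
      have := hw.1 (a₁ := ⟨k, j⟩) (a₂ := ⟨k', j'⟩) h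
      rw [Sigma.mk.injEq] at this
      obtain ⟨rfl, h2⟩ := this
      rw [eq_of_heq h2]
    · obtain ⟨k, rfl⟩ := e.surjective i
      exact hw.2 k j
  · intro w _
    have h := (measurePreserving_piCongrLeft (fun i => (t i).law) e).symm
    rw [← h.integral_comp']
    refine integral_congr_ae (Eventually.of_forall fun θ => ?_)
    simp only
    congr 1
    funext σ
    simp only [attachAll]
    congr 1
    exact (Equiv.sum_comp e fun i => θ i fun j => σ (s (w i j))).symm

end MultiPlacement

/-! ### The free energy of the configuration model -/

/-- If the factors occupy all the half-edges, then their placements are the matchings. -/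
theorem average_multiPlaces_eq {H I J : Type*} [Fintype H] [DecidableEq H] [Fintype I]
    [DecidableEq I] [Fintype J] [DecidableEq J] (r : I → ℕ) (c : J ≃ (i : I) × Fin (r i))
    (hH : Fintype.card H = ∑ i, r i) (F : ((i : I) → Fin (r i) → H) → ℝ) :
    (∑ v ∈ multiPlaces ∅ r, F v)
        / (((Fintype.card H - (∅ : Finset H).card).descFactorial (∑ i, r i) : ℕ) : ℝ)
      = (∑ m : J ≃ H, F fun i j => m (c.symm ⟨i, j⟩)) / (Fintype.card (J ≃ H) : ℝ) := by
  have key : ∀ F : ((i : I) → Fin (r i) → H) → ℝ,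
      ∑ v ∈ multiPlaces ∅ r, F v = ∑ m : J ≃ H, F fun i j => m (c.symm ⟨i, j⟩) := by
    intro F
    symm
    refine Finset.sum_bij (fun m _ i j => m (c.symm ⟨i, j⟩)) ?_ ?_ ?_ fun _ _ => rfl
    · intro m _
      rw [mem_multiPlaces]
      exact ⟨fun x y h => c.symm.injective (m.injective h), fun _ _ => Finset.notMem_empty _⟩
    · intro m _ m' _ h
      ext x
      obtain ⟨⟨i, j⟩, rfl⟩ := c.symm.surjective x
      exact congrFun (congrFun h i) j
    · intro v hv
      rw [mem_multiPlaces] at hv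
      have hb : Function.Bijective fun x : (i : I) × Fin (r i) => v x.1 x.2 :=
        (Fintype.bijective_iff_injective_and_card _).2 ⟨hv.1, by simp [hH]⟩
      refine ⟨c.trans (Equiv.ofBijective _ hb), Finset.mem_univ _, ?_⟩
      funext i j
      simp
  have h1 : ((multiPlaces (∅ : Finset H) r).card : ℝ) = Fintype.card (J ≃ H) := by
    have := key fun _ => 1
    simpa using this
  rw [key, ← card_multiPlaces, h1]

section FreeEnergy

variable {P : Set ℕ} {N : ℕ}

/-- The sizes of all the edges. -/
noncomputable def edgeSizes (E : P →₀ ℕ) : List P :=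
  (Finset.univ : Finset (Edge E)).toList.map fun e => (e.1 : P)

theorem coe_edgeSizes (E : P →₀ ℕ) : (edgeSizes E : Multiset P)
    = (Finset.univ : Finset (Edge E)).val.map fun e => (e.1 : P) := by
  rw [edgeSizes, ← Multiset.map_coe, Finset.coe_toList]

theorem sum_map_edgeSizes {M : Type*} [AddCommMonoid M] (E : P →₀ ℕ) (g : P → M) :
    ((edgeSizes E).map g).sum = ∑ e : Edge E, g e.1 := by
  rw [edgeSizes, List.map_map]
  exact Finset.sum_map_toList _ fun e : Edge E => g e.1

/-- The energy of the external fields. -/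
def fieldEnergy (h : Fin N → Spin → ℝ) (σ : Fin N → Spin) : ℝ := ∑ i, h i (σ i)

theorem continuous_fieldEnergy : Continuous (fieldEnergy : (Fin N → Spin → ℝ) → _) := by
  unfold fieldEnergy; fun_prop

theorem card_edgeHalf (E : P →₀ ℕ) :
    Fintype.card (EdgeHalf E) = ∑ e : Edge E, ((e.1 : P) : ℕ) := by
  rw [Fintype.card_sigma]; simp

theorem card_edgeHalf_eq_sum (E : P →₀ ℕ) :
    Fintype.card (EdgeHalf E) = E.sum fun p n => (p : ℕ) * n := by
  rw [card_edgeHalf, Fintype.sum_sigma, Finsupp.sum,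
    ← Finset.sum_coe_sort E.support fun p : P => (p : ℕ) * E p]
  simp [mul_comm]

theorem card_vertexHalf (d : Fin N → ℕ) : Fintype.card (VertexHalf d) = ∑ i, d i := by
  rw [Fintype.card_sigma]; simp

theorem abs_fieldEnergy_le {κ : ℝ} {h : Fin N → Spin → ℝ} (hh : ∀ i, ∀ s, |h i s| ≤ κ)
    (σ : Fin N → Spin) : |fieldEnergy h σ| ≤ N * κ := by
  calc |fieldEnergy h σ| ≤ ∑ i, |h i (σ i)| := Finset.abs_sum_le_sum_abs _ _
    _ ≤ ∑ _i : Fin N, κ := Finset.sum_le_sum fun i _ => hh i _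
    _ = _ := by simp

theorem integrable_comp_fieldEnergy {f : ((Fin N → Spin) → ℝ) → ℝ}
    (hf : ∀ u u' c, (∀ σ, |u σ - u' σ| ≤ c) → |f u - f u'| ≤ c) {κ : ℝ}
    (η : Measure (Spin → ℝ)) [IsProbabilityMeasure η] (hη : ∀ᵐ h ∂η, ∀ s, |h s| ≤ κ) :
    Integrable (fun h => f (fieldEnergy h)) (Measure.pi fun _ : Fin N => η) := by
  refine Integrable.of_bound ((continuous_of_abs_sub_le hf).comp
    continuous_fieldEnergy).measurable.aestronglyMeasurable (|f 0| + N * κ) ?_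
  filter_upwards [ae_pi_forall (fun _ : Fin N => η) fun _ => hη] with h hh
  have h1 := hf (fieldEnergy h) 0 (N * κ) fun σ => by
    simpa using abs_fieldEnergy_le hh σ
  rw [Real.norm_eq_abs]
  have h2 := abs_sub_abs_le_abs_sub (f (fieldEnergy h)) (f 0)
  linarith

theorem coe_edgeFactors_edgeSizes (Θ : (p : P) → Measure (Interaction p)) (E : P →₀ ℕ) :
    (edgeFactors Θ (edgeSizes E) : Multiset Factor)
      = (Finset.univ : Finset (Edge E)).val.map fun e => edgeFactor (Θ e.1) := by
  rw [edgeFactors, ← Multiset.map_coe, coe_edgeSizes, Multiset.map_map]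
  rfl

/-- The free energy is the mean log-partition function for the edges as factors. -/
theorem freeEnergy_eq {κ : ℝ} (Θ : (p : P) → Measure (Interaction p))
    (hΘ : ∀ p, (edgeFactor (Θ p)).IsBounded κ) (η : Measure (Spin → ℝ)) [IsProbabilityMeasure η]
    (hη : ∀ᵐ h ∂η, ∀ s, |h s| ≤ κ) (d : Fin N → ℕ) (E : P →₀ ℕ)
    (hdeg : ∑ i, d i = E.sum fun p n => (p : ℕ) * n) :
    freeEnergy Θ η d E = (1 / (N : ℝ)) * ∫ h, meanLogZ (Sigma.fst : VertexHalf d → Fin N)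
      (edgeFactors Θ (edgeSizes E)) ∅ (fieldEnergy h) ∂(Measure.pi fun _ : Fin N => η) := by
  have pΘ : ∀ p, IsProbabilityMeasure (Θ p) := fun p => (hΘ p).1
  have hcard : Fintype.card (VertexHalf d) = ∑ e : Edge E, (edgeFactor (Θ e.1)).arity := by
    rw [card_vertexHalf, hdeg, ← card_edgeHalf_eq_sum, card_edgeHalf]
    rfl
  set t : Edge E → Factor := fun e => edgeFactor (Θ e.1) with ht
  have e1 : ∀ h : Fin N → Spin → ℝ, meanLogZ (Sigma.fst : VertexHalf d → Fin N)
      (edgeFactors Θ (edgeSizes E)) ∅ (fieldEnergy h)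
      = (∑ m : Matching d E, ∫ θ, logZ (attachAll (Sigma.fst : VertexHalf d → Fin N)
          (fieldEnergy h) (fun e j => m ⟨e, j⟩) θ) ∂(Measure.pi fun e => (t e).law))
        / (Fintype.card (Matching d E) : ℝ) := by
    intro h
    rw [meanLogZ_eq_average _ t (fun e => hΘ e.1) (coe_edgeFactors_edgeSizes Θ E)]
    exact average_multiPlaces_eq (fun e => (t e).arity) (Equiv.refl (EdgeHalf E)) hcard _
  have : OpensMeasurableSpace (((e : Edge E) → Interaction e.size) × (Fin N → Spin → ℝ)) :=
    Prod.opensMeasurableSpace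
  have hint : ∀ m : Matching d E, Integrable (fun w : ((e : Edge E) → Interaction e.size) ×
      (Fin N → Spin → ℝ) => logZ (attachAll (Sigma.fst : VertexHalf d → Fin N)
          (fieldEnergy w.2) (r := fun e => e.size) (fun e j => m ⟨e, j⟩) w.1))
      ((Measure.pi fun e : Edge E => Θ e.1).prod (Measure.pi fun _ : Fin N => η)) := by
    intro m
    have hc : Continuous fun w : ((e : Edge E) → Interaction e.size) × (Fin N → Spin → ℝ) =>
        logZ (attachAll (Sigma.fst : VertexHalf d → Fin N)
          (fieldEnergy w.2) (r := fun e => e.size) (fun e j => m ⟨e, j⟩) w.1) := by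
      refine continuous_logZ.comp ?_
      unfold attachAll fieldEnergy
      fun_prop
    refine Integrable.of_bound hc.measurable.aestronglyMeasurable
      (|logZ (0 : (Fin N → Spin) → ℝ)| + (N * κ + Fintype.card (Edge E) * κ)) ?_
    have q₁ : Measure.QuasiMeasurePreserving Prod.fst ((Measure.pi fun e : Edge E => Θ e.1).prod
      (Measure.pi fun _ : Fin N => η)) _ := Measure.quasiMeasurePreserving_fst
    have q₂ : Measure.QuasiMeasurePreserving Prod.snd ((Measure.pi fun e : Edge E => Θ e.1).prod
      (Measure.pi fun _ : Fin N => η)) _ := Measure.quasiMeasurePreserving_snd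
    filter_upwards [q₁.ae (ae_pi_forall (fun e : Edge E => Θ e.1) fun e => (hΘ e.1).2),
      q₂.ae (ae_pi_forall (fun _ : Fin N => η) fun _ => hη)] with w hw1 hw2
    have h1 := abs_logZ_sub_le (u := attachAll (Sigma.fst : VertexHalf d → Fin N)
          (fieldEnergy w.2) (r := fun e => e.size) (fun e j => m ⟨e, j⟩) w.1) (u' := 0)
          (c := N * κ + Fintype.card (Edge E) * κ) fun σ => by
      rw [Pi.zero_apply, sub_zero, attachAll]
      refine (abs_add_le _ _).trans (add_le_add (abs_fieldEnergy_le hw2 σ) ?_)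
      calc _ ≤ ∑ e : Edge E, |w.1 e fun j => σ (m ⟨e, j⟩).1| := Finset.abs_sum_le_sum_abs _ _
        _ ≤ ∑ _e : Edge E, κ := Finset.sum_le_sum fun e _ => hw1 e _
        _ = _ := by simp
    rw [Real.norm_eq_abs]
    have h2 := abs_sub_abs_le_abs_sub (logZ (attachAll (Sigma.fst : VertexHalf d → Fin N)
          (fieldEnergy w.2) (r := fun e => e.size) (fun e j => m ⟨e, j⟩) w.1))
          (logZ (0 : (Fin N → Spin) → ℝ))
    linarith
  rw [freeEnergy]
  simp only [e1]
  rw [integral_div, integral_finsetSum]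
  · congr 2
    refine Finset.sum_congr rfl fun m _ => ?_
    have h1 := integral_prod_symm _ (hint m)
    refine Eq.trans ?_ h1
    refine integral_congr_ae (Eventually.of_forall fun w => ?_)
    refine congrArg Real.log (Finset.sum_congr rfl fun σ _ => congrArg Real.exp ?_)
    exact add_comm _ _
  · intro m _
    exact (hint m).integral_prod_right

end FreeEnergy

/-! ### Fields at the vertices of the configuration model -/

/-- For a uniform random bijection `X ≃ Y`, the preimages of distinct points form a uniform random
tuple of distinct points. -/
theorem average_equiv_comp {X Y : Type*} [Fintype X] [DecidableEq X] [Fintype Y] [DecidableEq Y]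
    (hXY : Fintype.card X = Fintype.card Y) {k : ℕ} {w : Fin k → Y} (hw : Function.Injective w)
    (G : (Fin k → X) → ℝ) :
    (∑ m : X ≃ Y, G fun j => m.symm (w j)) / (Fintype.card (X ≃ Y) : ℝ)
      = (∑ v ∈ places ∅ k, G v) / ((places (∅ : Finset X) k).card : ℝ) := by
  obtain ⟨m₀⟩ : Nonempty (X ≃ Y) := ⟨Fintype.equivOfCardEq hXY⟩
  set v₀ : Fin k → X := fun j => m₀.symm (w j) with hv₀
  have hinj : ∀ m : X ≃ Y, Function.Injective fun j => m.symm (w j) :=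
    fun m => m.symm.injective.comp hw
  have hconst : ∀ v : Fin k → X, Function.Injective v →
      ∑ τ : Equiv.Perm X, G (fun j => τ (v j)) = ∑ τ : Equiv.Perm X, G fun j => τ (v₀ j) := by
    intro v hv
    obtain ⟨π, hπ⟩ := Equiv.Perm.exists_smul_eq_embedding (⟨v₀, hinj m₀⟩ : Fin k ↪ X) ⟨v, hv⟩
    have hπ' : ∀ j, π (v₀ j) = v j := fun j => DFunLike.congr_fun hπ j
    refine (Fintype.sum_equiv (Equiv.mulRight π) _ _ fun τ => ?_)
    simp [← hπ']
  set c := ∑ τ : Equiv.Perm X, G fun j => τ (v₀ j) with hc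
  have hp : (0 : ℝ) < Fintype.card (Equiv.Perm X) := by exact_mod_cast Fintype.card_pos
  have hm : ∀ τ : Equiv.Perm X, ∑ m : X ≃ Y, G (fun j => τ (m.symm (w j)))
      = ∑ m : X ≃ Y, G fun j => m.symm (w j) := fun τ =>
    Fintype.sum_equiv (τ.equivCongr (Equiv.refl Y)) _ _ fun m => by
      simp [Equiv.equivCongr]
  have hpl : ∀ τ : Equiv.Perm X, ∑ v ∈ places ∅ k, G (fun j => τ (v j))
      = ∑ v ∈ places ∅ k, G v := by
    intro τ
    refine Finset.sum_bij (fun v _ j => τ (v j)) ?_ ?_ ?_ fun _ _ => rfl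
    · intro v hv
      rw [mem_places] at hv ⊢
      exact ⟨τ.injective.comp hv.1, fun _ => Finset.notMem_empty _⟩
    · intro v _ v' _ h
      funext j
      exact τ.injective (congrFun h j)
    · intro v hv
      rw [mem_places] at hv
      refine ⟨fun j => τ.symm (v j), ?_, by simp⟩
      rw [mem_places]
      exact ⟨τ.symm.injective.comp hv.1, fun _ => Finset.notMem_empty _⟩
  have h1 : (Fintype.card (Equiv.Perm X) : ℝ) * ∑ m : X ≃ Y, G (fun j => m.symm (w j))
      = Fintype.card (X ≃ Y) * c := by
    calc _ = ∑ τ : Equiv.Perm X, ∑ m : X ≃ Y, G (fun j => τ (m.symm (w j))) := by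
          simp only [hm, Finset.sum_const, Finset.card_univ, nsmul_eq_mul]
      _ = ∑ m : X ≃ Y, c := by
          rw [Finset.sum_comm]
          exact Finset.sum_congr rfl fun m _ => hconst _ (hinj m)
      _ = _ := by rw [Finset.sum_const, Finset.card_univ, nsmul_eq_mul]
  have h2 : (Fintype.card (Equiv.Perm X) : ℝ) * ∑ v ∈ places ∅ k, G v
      = (places (∅ : Finset X) k).card * c := by
    calc _ = ∑ τ : Equiv.Perm X, ∑ v ∈ places ∅ k, G (fun j => τ (v j)) := by
          simp only [hpl, Finset.sum_const, Finset.card_univ, nsmul_eq_mul]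
      _ = ∑ v ∈ places (∅ : Finset X) k, c := by
          rw [Finset.sum_comm]
          exact Finset.sum_congr rfl fun v hv => hconst _ (mem_places.1 hv).1
      _ = _ := by rw [Finset.sum_const, nsmul_eq_mul]
  have h3 : (0 : ℝ) < Fintype.card (X ≃ Y) := by exact_mod_cast Fintype.card_pos_iff.2 ⟨m₀⟩
  have h4 : (0 : ℝ) < (places (∅ : Finset X) k).card := by
    rw [Nat.cast_pos, Finset.card_pos]
    exact ⟨v₀, mem_places.2 ⟨hinj m₀, fun _ => Finset.notMem_empty _⟩⟩
  rw [div_eq_div_iff h3.ne' h4.ne']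
  refine mul_left_cancel₀ hp.ne' ?_
  linear_combination (places (∅ : Finset X) k).card * h1 - Fintype.card (X ≃ Y) * h2

/-- The coordinates of a product measure at distinct indices are independent. -/
theorem measurePreserving_comp_injective {X K : Type*} [Fintype X] [Fintype K] {Z : X → Type*}
    [∀ x, MeasurableSpace (Z x)] (μ : (x : X) → Measure (Z x)) [∀ x, IsProbabilityMeasure (μ x)]
    {v : K → X} (hv : Function.Injective v) :
    MeasurePreserving (fun (θ : (x : X) → Z x) j => θ (v j)) (Measure.pi μ)
      (Measure.pi fun j => μ (v j)) := by
  refine ⟨by fun_prop, ?_⟩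
  have h := (iIndepFun_pi (μ := μ) (X := fun _ z => z) fun _ => aemeasurable_id).precomp hv
  rw [iIndepFun_iff_map_fun_eq_pi_map fun _ => (measurable_pi_apply _).aemeasurable] at h
  rw [h]
  congr 1
  funext j
  exact (measurePreserving_eval μ (v j)).map_eq

/-- The log-partition function of one spin with the external field `y` and the fields `φ`. -/
noncomputable def siteLogZ {k : ℕ} (y : Spin → ℝ) (φ : Fin k → Interaction 1) : ℝ :=
  Real.log (∑ s : Spin, Real.exp ((∑ j, φ j fun _ => s) + y s))

theorem siteLogZ_eq_logZ {k : ℕ} (y : Spin → ℝ) (φ : Fin k → Interaction 1) :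
    siteLogZ y φ = logZ fun σ : Unit → Spin => (∑ j, φ j fun _ => σ ()) + y (σ ()) := by
  rw [siteLogZ, logZ]
  refine congrArg Real.log ?_
  exact Fintype.sum_equiv (Equiv.funUnique Unit Spin).symm _ _ fun s => rfl

theorem abs_siteLogZ_sub_le {k k' : ℕ} {y y' : Spin → ℝ} {φ : Fin k → Interaction 1}
    {φ' : Fin k' → Interaction 1} {c : ℝ}
    (h : ∀ s, |((∑ j, φ j fun _ => s) + y s) - ((∑ j, φ' j fun _ => s) + y' s)| ≤ c) :
    |siteLogZ y φ - siteLogZ y' φ'| ≤ c := by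
  rw [siteLogZ_eq_logZ, siteLogZ_eq_logZ]
  exact abs_logZ_sub_le fun σ => h _

theorem continuous_siteLogZ {k : ℕ} :
    Continuous fun z : (Spin → ℝ) × (Fin k → Interaction 1) => siteLogZ z.1 z.2 := by
  simp only [siteLogZ_eq_logZ]
  exact continuous_logZ.comp (by fun_prop)

/-- Without interactions of several spins, the partition function factorizes over the sites. -/
theorem logZ_sum {N : ℕ} (ψ : Fin N → Spin → ℝ) :
    logZ (fun σ : Fin N → Spin => ∑ i, ψ i (σ i)) = ∑ i, Real.log (∑ s, Real.exp (ψ i s)) := by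
  rw [← Real.log_prod fun i _ => (Finset.sum_pos (fun _ _ => Real.exp_pos _)
    Finset.univ_nonempty).ne', logZ]
  congr 1
  rw [Finset.prod_univ_sum, Fintype.piFinset_univ]
  exact Finset.sum_congr rfl fun σ _ => Real.exp_sum _ _

theorem integrable_siteLogZ {κ : ℝ} {k : ℕ} (y : Spin → ℝ) (μ : Fin k → Measure (Interaction 1))
    [∀ j, IsProbabilityMeasure (μ j)] (hμ : ∀ j, ∀ᵐ φ ∂μ j, ∀ σ, |φ σ| ≤ κ) :
    Integrable (fun φ => siteLogZ y φ) (Measure.pi μ) := by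
  refine Integrable.of_bound (continuous_siteLogZ.comp (by fun_prop : Continuous fun φ :
    Fin k → Interaction 1 => (y, φ))).measurable.aestronglyMeasurable
    (|siteLogZ y (0 : Fin k → Interaction 1)| + k * κ) ?_
  filter_upwards [ae_pi_forall μ hμ] with φ hφ
  have h1 := abs_siteLogZ_sub_le (k' := k) (y := y) (y' := y) (φ := φ) (φ' := 0)
    (c := k * κ) fun s => by
    rw [add_sub_add_right_eq_sub]
    simp only [Pi.zero_apply, Finset.sum_const_zero, sub_zero]
    calc _ ≤ ∑ j, |φ j fun _ => s| := Finset.abs_sum_le_sum_abs _ _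
      _ ≤ ∑ _j : Fin k, κ := Finset.sum_le_sum fun j _ => hφ j _
      _ = _ := by simp
  rw [Real.norm_eq_abs]
  have h2 := abs_sub_abs_le_abs_sub (siteLogZ y φ) (siteLogZ y (0 : Fin k → Interaction 1))
  linarith

section Fields

variable {P : Set ℕ} {N : ℕ}

theorem coe_fieldFactors_edgeSizes (Θ : (p : P) → Measure (Interaction p)) (ζ : Measure ℝ)
    (E : P →₀ ℕ) : (fieldFactors Θ ζ (edgeSizes E) : Multiset Factor)
      = (Finset.univ : Finset (EdgeHalf E)).val.map fun x => fieldFactor (Θ x.1.1) ζ := by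
  rw [fieldFactors, ← Multiset.coe_bind, coe_edgeSizes, Multiset.bind_map]
  have : (Finset.univ : Finset (EdgeHalf E)).val
      = (Finset.univ : Finset (Edge E)).val.sigma fun _ => Finset.univ.val := rfl
  rw [this, Multiset.sigma, Multiset.map_bind]
  congr 1
  funext e
  rw [Multiset.map_map]
  simp [← Multiset.coe_replicate]

/-- The field that an edge would exert on the vertex at one of its half-edges has a law that
depends on the size of the edge; the fields at the vertex `i` belong to a uniform random tuple of
`d i` distinct half-edges. -/
theorem meanLogZ_fieldFactors_eq {κ : ℝ} (Θ : (p : P) → Measure (Interaction p))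
    (hΘ : ∀ p, (edgeFactor (Θ p)).IsBounded κ) (ζ : Measure ℝ) [IsProbabilityMeasure ζ]
    (d : Fin N → ℕ) (E : P →₀ ℕ) (hdeg : ∑ i, d i = E.sum fun p n => (p : ℕ) * n)
    (h : Fin N → Spin → ℝ) :
    meanLogZ (Sigma.fst : VertexHalf d → Fin N) (fieldFactors Θ ζ (edgeSizes E)) ∅ (fieldEnergy h)
      = ∑ i, (∑ v ∈ places (∅ : Finset (EdgeHalf E)) (d i),
          ∫ φ, siteLogZ (h i) φ ∂(Measure.pi fun j => fieldLaw (Θ (v j).1.1) ζ))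
            / ((places (∅ : Finset (EdgeHalf E)) (d i)).card : ℝ) := by
  have hf : ∀ p, (fieldFactor (Θ p) ζ).IsBounded κ := fun p => isBounded_fieldFactor (hΘ p) ζ
  have pf : ∀ p, IsProbabilityMeasure (fieldLaw (Θ p) ζ) := fun p => (hf p).1
  have hcard : Fintype.card (EdgeHalf E) = Fintype.card (VertexHalf d) := by
    rw [card_vertexHalf, hdeg, card_edgeHalf_eq_sum]
  set t : EdgeHalf E → Factor := fun x => fieldFactor (Θ x.1.1) ζ with ht
  rw [meanLogZ_eq_average _ t (fun x => hf _) (coe_fieldFactors_edgeSizes Θ ζ E),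
    average_multiPlaces_eq (fun x => (t x).arity)
      ((Equiv.sigmaUnique (EdgeHalf E) fun _ => Fin 1).symm : EdgeHalf E ≃
        (x : EdgeHalf E) × Fin (t x).arity) (by rw [← hcard]; simp [ht, fieldFactor])]
  have e1 : ∀ m : Matching d E,
      ∫ θ, logZ (attachAll (Sigma.fst : VertexHalf d → Fin N) (fieldEnergy h) (fun x j =>
        m (((Equiv.sigmaUnique (EdgeHalf E) fun _ => Fin 1).symm : EdgeHalf E ≃
        (x : EdgeHalf E) × Fin (t x).arity).symm ⟨x, j⟩)) θ) ∂(Measure.pi fun x => (t x).law)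
      = ∑ i, ∫ φ, siteLogZ (h i) φ
          ∂(Measure.pi fun j : Fin (d i) => fieldLaw (Θ (m.symm ⟨i, j⟩).1.1) ζ) := by
    intro m
    have hmp : ∀ i, MeasurePreserving (fun (θ : EdgeHalf E → Interaction 1) (j : Fin (d i)) =>
        θ (m.symm ⟨i, j⟩)) (Measure.pi fun x : EdgeHalf E => fieldLaw (Θ x.1.1) ζ)
        (Measure.pi fun j : Fin (d i) => fieldLaw (Θ (m.symm ⟨i, j⟩).1.1) ζ) := fun i =>
      measurePreserving_comp_injective (fun x : EdgeHalf E => fieldLaw (Θ x.1.1) ζ)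
        (v := fun j : Fin (d i) => m.symm ⟨i, j⟩) fun j j' hjj => by
          simpa using m.symm.injective hjj
    have hi : ∀ i, Integrable (fun φ => siteLogZ (h i) φ)
        (Measure.pi fun j : Fin (d i) => fieldLaw (Θ (m.symm ⟨i, j⟩).1.1) ζ) := fun i =>
      integrable_siteLogZ _ _ fun j => (hf _).2
    have e2 : ∀ i, ∫ φ, siteLogZ (h i) φ
          ∂(Measure.pi fun j : Fin (d i) => fieldLaw (Θ (m.symm ⟨i, j⟩).1.1) ζ)
        = ∫ θ : EdgeHalf E → Interaction 1, siteLogZ (h i) (fun j => θ (m.symm ⟨i, j⟩))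
          ∂(Measure.pi fun x : EdgeHalf E => fieldLaw (Θ x.1.1) ζ) := by
      intro i
      rw [← (hmp i).map_eq, integral_map (hmp i).aemeasurable]
      rw [(hmp i).map_eq]
      exact (hi i).aestronglyMeasurable
    simp only [e2]
    have e4 := integral_finsetSum (μ := Measure.pi fun x : EdgeHalf E => fieldLaw (Θ x.1.1) ζ)
      Finset.univ fun i _ => (hmp i).integrable_comp_of_integrable (hi i)
    refine Eq.trans ?_ e4
    refine integral_congr_ae (Eventually.of_forall fun θ => ?_)
    change logZ (fun σ : Fin N → Spin => (∑ i, h i (σ i))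
      + ∑ x : EdgeHalf E, (θ x : Interaction 1) fun _ => σ (m x).1) = _
    have e3 : ∀ σ : Fin N → Spin, ∑ x : EdgeHalf E, (θ x : Interaction 1) (fun _ => σ (m x).1)
        = ∑ i, ∑ j : Fin (d i), (θ (m.symm ⟨i, j⟩) : Interaction 1) fun _ => σ i := by
      intro σ
      rw [← Fintype.sum_sigma' fun i (j : Fin (d i)) =>
        (θ (m.symm ⟨i, j⟩) : Interaction 1) fun _ => σ i]
      refine Fintype.sum_equiv m _ _ fun x => ?_
      rw [Sigma.eta, Equiv.symm_apply_apply]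
    simp only [e3, ← Finset.sum_add_distrib]
    rw [logZ_sum fun i s => h i s + ∑ j : Fin (d i), (θ (m.symm ⟨i, j⟩) : Interaction 1) fun _ => s]
    refine Finset.sum_congr rfl fun i _ => ?_
    simp only [siteLogZ, add_comm (h i _)]
    rfl
  refine Eq.trans (congrArg (· / _) (Finset.sum_congr rfl fun m _ => e1 m)) ?_
  rw [Finset.sum_comm, Finset.sum_div]
  refine Finset.sum_congr rfl fun i _ => ?_
  exact average_equiv_comp hcard (w := fun j : Fin (d i) => (⟨i, j⟩ : VertexHalf d))
    (fun j j' hjj => by simpa using hjj) fun v => ∫ φ, siteLogZ (h i) φ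
      ∂(Measure.pi fun j => fieldLaw (Θ (v j).1.1) ζ)

end Fields

/-! ### The mean log-partition function of one site -/

theorem pi_prod_eq_map {I : Type*} [Fintype I] {X Y : I → Type*} [∀ i, MeasurableSpace (X i)]
    [∀ i, MeasurableSpace (Y i)] (μ : (i : I) → Measure (X i)) (ν : (i : I) → Measure (Y i))
    [∀ i, IsProbabilityMeasure (μ i)] [∀ i, IsProbabilityMeasure (ν i)] :
    Measure.pi (fun i => (μ i).prod (ν i))
      = ((Measure.pi μ).prod (Measure.pi ν)).map fun w i => (w.1 i, w.2 i) := by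
  have hm : Measurable fun (w : ((i : I) → X i) × ((i : I) → Y i)) i => (w.1 i, w.2 i) := by
    fun_prop
  refine Measure.pi_eq fun s hs => ?_
  rw [Measure.map_apply hm (MeasurableSet.univ_pi hs),
    Measure.prod_apply (hm (MeasurableSet.univ_pi hs))]
  have h1 : ∀ x : (i : I) → X i, Measure.pi ν (Prod.mk x ⁻¹'
      ((fun (w : ((i : I) → X i) × ((i : I) → Y i)) i => (w.1 i, w.2 i)) ⁻¹' Set.univ.pi s))
      = ∏ i, ν i (Prod.mk (x i) ⁻¹' s i) := by
    intro x
    rw [← Measure.pi_pi]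
    congr 1
  have hg : ∀ i, Measurable fun x : X i => ν i (Prod.mk x ⁻¹' s i) := fun i =>
    measurable_measure_prodMk_left (hs i)
  simp only [h1]
  rw [lintegral_prod_eq_prod_lintegral_of_indepFun Finset.univ
    (fun i (x : (i : I) → X i) => ν i (Prod.mk (x i) ⁻¹' s i))
    (iIndepFun_pi (μ := μ) (X := fun i x => ν i (Prod.mk x ⁻¹' s i)) fun i => (hg i).aemeasurable)
    fun i => (hg i).comp (measurable_pi_apply i)]
  refine Finset.prod_congr rfl fun i _ => ?_
  rw [Measure.prod_apply (hs i), ← (measurePreserving_eval μ i).lintegral_comp (hg i)]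

/-- Independent cavity fields, drawn together. -/
theorem pi_fieldLaw_eq_map {k : ℕ} {n : Fin k → ℕ} (Θ : (j : Fin k) → Measure (Interaction (n j)))
    [∀ j, IsProbabilityMeasure (Θ j)] (ζ : Measure ℝ) [IsProbabilityMeasure ζ] :
    Measure.pi (fun j => fieldLaw (Θ j) ζ)
      = ((Measure.pi Θ).prod (Measure.pi fun j => Measure.pi fun _ : Fin (n j - 1) => ζ)).map
        fun w j ε => siteField (w.1 j) (w.2 j) (ε 0) := by
  have : ∀ j, IsProbabilityMeasure (((Θ j).prod (Measure.pi fun _ : Fin (n j - 1) => ζ)).map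
      fun z (ε : Fin 1 → Spin) => siteField z.1 z.2 (ε 0)) := fun j =>
    Measure.isProbabilityMeasure_map measurable_siteField.aemeasurable
  unfold fieldLaw
  rw [← Measure.pi_map_pi fun j => measurable_siteField.aemeasurable, pi_prod_eq_map,
    Measure.map_map]
  · rfl
  · exact measurable_pi_lambda _ fun j => measurable_siteField.comp (measurable_pi_apply j)
  · fun_prop

theorem integrable_siteLogZ_prod {κ : ℝ} {k : ℕ} (η : Measure (Spin → ℝ)) [IsProbabilityMeasure η]
    (hη : ∀ᵐ y ∂η, ∀ s, |y s| ≤ κ) (μ : Fin k → Measure (Interaction 1))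
    [∀ j, IsProbabilityMeasure (μ j)] (hμ : ∀ j, ∀ᵐ φ ∂μ j, ∀ σ, |φ σ| ≤ κ) :
    Integrable (fun z : (Spin → ℝ) × (Fin k → Interaction 1) => siteLogZ z.1 z.2)
      (η.prod (Measure.pi μ)) := by
  refine Integrable.of_bound continuous_siteLogZ.measurable.aestronglyMeasurable
    (|siteLogZ (0 : Spin → ℝ) (0 : Fin k → Interaction 1)| + (k * κ + κ)) ?_
  have q₁ : Measure.QuasiMeasurePreserving Prod.fst (η.prod (Measure.pi μ)) η :=
    Measure.quasiMeasurePreserving_fst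
  have q₂ : Measure.QuasiMeasurePreserving Prod.snd (η.prod (Measure.pi μ)) (Measure.pi μ) :=
    Measure.quasiMeasurePreserving_snd
  filter_upwards [q₁.ae hη, q₂.ae (ae_pi_forall μ hμ)] with z hy hφ
  have h1 := abs_siteLogZ_sub_le (k' := k) (y := z.1) (y' := 0) (φ := z.2) (φ' := 0)
    (c := k * κ + κ) fun s => by
      simp only [Pi.zero_apply, Finset.sum_const_zero, add_zero, sub_zero]
      refine (abs_add_le _ _).trans (add_le_add ?_ (hy s))
      calc _ ≤ ∑ j, |z.2 j fun _ => s| := Finset.abs_sum_le_sum_abs _ _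
        _ ≤ ∑ _j : Fin k, κ := Finset.sum_le_sum fun j _ => hφ j _
        _ = _ := by simp
  rw [Real.norm_eq_abs]
  have h2 := abs_sub_abs_le_abs_sub (siteLogZ z.1 z.2)
    (siteLogZ (0 : Spin → ℝ) (0 : Fin k → Interaction 1))
  linarith

theorem integrable_siteLogZ_left {κ : ℝ} {k : ℕ} (η : Measure (Spin → ℝ))
    [IsProbabilityMeasure η] (hη : ∀ᵐ y ∂η, ∀ s, |y s| ≤ κ) (φ : Fin k → Interaction 1) :
    Integrable (fun y => siteLogZ y φ) η := by
  refine Integrable.of_bound (continuous_siteLogZ.comp (by fun_prop : Continuous fun y :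
    Spin → ℝ => (y, φ))).measurable.aestronglyMeasurable (|siteLogZ (0 : Spin → ℝ) φ| + κ) ?_
  filter_upwards [hη] with y hy
  have h1 := abs_siteLogZ_sub_le (y := y) (y' := 0) (φ := φ) (φ' := φ) (c := κ) fun s => by
    simpa using hy s
  rw [Real.norm_eq_abs]
  have h2 := abs_sub_abs_le_abs_sub (siteLogZ y φ) (siteLogZ (0 : Spin → ℝ) φ)
  linarith

/-- The mean over the fields at a vertex is the one over the interactions, the cavity fields and the
external field in the order in which `siteTerm` integrates them. -/
theorem integral_siteLogZ_eq {κ : ℝ} {k : ℕ} {n : Fin k → ℕ} (η : Measure (Spin → ℝ))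
    [IsProbabilityMeasure η] (hη : ∀ᵐ y ∂η, ∀ s, |y s| ≤ κ)
    (Θ : (j : Fin k) → Measure (Interaction (n j))) (hΘ : ∀ j, (edgeFactor (Θ j)).IsBounded κ)
    (ζ : Measure ℝ) [IsProbabilityMeasure ζ] :
    ∫ y, ∫ φ, siteLogZ y φ ∂(Measure.pi fun j => fieldLaw (Θ j) ζ) ∂η
      = ∫ ϑ : (j : Fin k) → Interaction (n j), ∫ x : (j : Fin k) → Fin (n j - 1) → ℝ,
        ∫ y : Spin → ℝ, siteLogZ y (fun j (ε : Fin 1 → Spin) => siteField (ϑ j) (x j) (ε 0))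
        ∂η ∂(Measure.pi fun _ => Measure.pi fun _ => ζ) ∂(Measure.pi Θ) := by
  have pΘ : ∀ j, IsProbabilityMeasure (Θ j) := fun j => (hΘ j).1
  have hf : ∀ j, (fieldFactor (Θ j) ζ).IsBounded κ := fun j => isBounded_fieldFactor (hΘ j) ζ
  have pf : ∀ j, IsProbabilityMeasure (fieldLaw (Θ j) ζ) := fun j => (hf j).1
  have hint := integrable_siteLogZ_prod η hη (fun j => fieldLaw (Θ j) ζ) fun j => (hf j).2
  have hm : Measurable fun (w : ((j : Fin k) → Interaction (n j)) ×
      ((j : Fin k) → Fin (n j - 1) → ℝ)) (j : Fin k) (ε : Fin 1 → Spin) =>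
      siteField (w.1 j) (w.2 j) (ε 0) := by
    refine measurable_pi_lambda _ fun j => ?_
    have hj : Measurable fun w : ((j : Fin k) → Interaction (n j)) ×
      ((j : Fin k) → Fin (n j - 1) → ℝ) => (w.1 j, w.2 j) := by fun_prop
    have hj' := (measurable_siteField (n := n j)).comp hj
    simp only [Function.comp_def] at hj'
    exact hj'
  have hint' : Integrable (fun φ : Fin k → Interaction 1 => ∫ y, siteLogZ y φ ∂η)
      (Measure.pi fun j => fieldLaw (Θ j) ζ) := hint.integral_prod_right
  rw [integral_integral_swap hint]
  rw [pi_fieldLaw_eq_map] at hint' ⊢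
  rw [integral_map hm.aemeasurable hint'.aestronglyMeasurable]
  exact integral_prod _ (hint'.comp_measurable hm)

theorem abs_integral_siteLogZ_sub_le {κ : ℝ} {k : ℕ} (y : Spin → ℝ)
    (μ : Fin k → Measure (Interaction 1)) [∀ j, IsProbabilityMeasure (μ j)]
    (hμ : ∀ j, ∀ᵐ φ ∂μ j, ∀ σ, |φ σ| ≤ κ) :
    |∫ φ, siteLogZ y φ ∂(Measure.pi μ) - siteLogZ y (0 : Fin k → Interaction 1)| ≤ κ * k := by
  have h0 : siteLogZ y (0 : Fin k → Interaction 1)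
      = ∫ _φ, siteLogZ y (0 : Fin k → Interaction 1) ∂(Measure.pi μ) := by simp
  rw [h0, ← integral_sub (integrable_siteLogZ y μ hμ) (integrable_const _), ← Real.norm_eq_abs]
  refine (norm_integral_le_of_norm_le_const (C := κ * k) ?_).trans (by simp)
  filter_upwards [ae_pi_forall μ hμ] with φ hφ
  refine abs_siteLogZ_sub_le fun s => ?_
  rw [add_sub_add_right_eq_sub]
  simp only [Pi.zero_apply, Finset.sum_const_zero, sub_zero]
  calc _ ≤ ∑ j, |φ j fun _ => s| := Finset.abs_sum_le_sum_abs _ _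
    _ ≤ ∑ _j : Fin k, κ := Finset.sum_le_sum fun j _ => hφ j _
    _ = _ := by simp [mul_comm]

/-- Removing one of the fields changes the mean log-partition function by at most `κ`. -/
theorem abs_integral_siteLogZ_sub_removeNth_le {κ : ℝ} {k : ℕ} (y : Spin → ℝ)
    (μ : Fin (k + 1) → Measure (Interaction 1)) [∀ j, IsProbabilityMeasure (μ j)]
    (hμ : ∀ j, ∀ᵐ φ ∂μ j, ∀ σ, |φ σ| ≤ κ) (j : Fin (k + 1)) :
    |∫ φ, siteLogZ y φ ∂(Measure.pi μ)
      - ∫ φ, siteLogZ y φ ∂(Measure.pi fun i => μ (j.succAbove i))| ≤ κ := by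
  have hmp := measurePreserving_comp_injective μ (Fin.succAbove_right_injective (p := j))
  have hi := integrable_siteLogZ y (fun i => μ (j.succAbove i)) fun i => hμ _
  have h1 : ∫ φ, siteLogZ y φ ∂(Measure.pi fun i => μ (j.succAbove i))
      = ∫ φ, siteLogZ y (fun i => φ (j.succAbove i)) ∂(Measure.pi μ) := by
    rw [← hmp.map_eq, integral_map hmp.aemeasurable]
    rw [hmp.map_eq]
    exact hi.aestronglyMeasurable
  have hi' : Integrable (fun φ : Fin (k + 1) → Interaction 1 =>
      siteLogZ y fun i => φ (j.succAbove i)) (Measure.pi μ) := hmp.integrable_comp_of_integrable hi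
  rw [h1, ← integral_sub (integrable_siteLogZ y μ hμ) hi', ← Real.norm_eq_abs]
  refine (norm_integral_le_of_norm_le_const (C := κ) ?_).trans (by simp)
  filter_upwards [ae_pi_forall μ hμ] with φ hφ
  refine abs_siteLogZ_sub_le fun s => ?_
  rw [add_sub_add_right_eq_sub, Fin.sum_univ_succAbove _ j, add_sub_cancel_right]
  exact hφ j _

section Site

variable {P : Set ℕ} (Θ : (p : P) → Measure (Interaction p)) (η : Measure (Spin → ℝ))
  (ζ : Measure ℝ)

/-- The mean log-partition function of a site with fields coming from edges of the sizes `p`. -/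
noncomputable def meanSite {k : ℕ} (p : Fin k → P) : ℝ :=
  ∫ y, ∫ φ, siteLogZ y φ ∂(Measure.pi fun j => fieldLaw (Θ (p j)) ζ) ∂η

/-- The mean log-partition function of a site without edges. -/
noncomputable def isolatedSite : ℝ := ∫ y : Spin → ℝ, Real.log (∑ s, Real.exp (y s)) ∂η

variable {Θ η} {κ : ℝ} [IsProbabilityMeasure ζ] [IsProbabilityMeasure η]

theorem siteTerm_eq (hΘ : ∀ p, (edgeFactor (Θ p)).IsBounded κ) (hη : ∀ᵐ y ∂η, ∀ s, |y s| ≤ κ)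
    (μ : PMF ℕ) (ρ : PMF P) : siteTerm Θ η μ ρ ζ
      = ∫ k : ℕ, ∫ p : Fin k → P, meanSite Θ η ζ p ∂(Measure.pi fun _ => ρ.toMeasure)
        ∂μ.toMeasure := by
  unfold siteTerm
  refine integral_congr_ae (Eventually.of_forall fun k =>
    integral_congr_ae (Eventually.of_forall fun p => ?_))
  exact (integral_siteLogZ_eq η hη (fun j => Θ (p j)) (fun j => hΘ (p j)) ζ).symm

theorem abs_meanSite_sub_isolatedSite_le (hΘ : ∀ p, (edgeFactor (Θ p)).IsBounded κ)
    (hη : ∀ᵐ y ∂η, ∀ s, |y s| ≤ κ) {k : ℕ} (p : Fin k → P) :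
    |meanSite Θ η ζ p - isolatedSite η| ≤ κ * k := by
  have hf : ∀ p, (fieldFactor (Θ p) ζ).IsBounded κ := fun p => isBounded_fieldFactor (hΘ p) ζ
  have pf : ∀ p, IsProbabilityMeasure (fieldLaw (Θ p) ζ) := fun p => (hf p).1
  have hint := integrable_siteLogZ_prod η hη (fun j => fieldLaw (Θ (p j)) ζ) fun j => (hf (p j)).2
  have h0 : isolatedSite η = ∫ y, siteLogZ y (0 : Fin k → Interaction 1) ∂η := by
    simp [isolatedSite, siteLogZ]
  rw [h0, meanSite, ← integral_sub hint.integral_prod_left (integrable_siteLogZ_left η hη _),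
    ← Real.norm_eq_abs]
  refine (norm_integral_le_of_norm_le_const (C := κ * k)
    (Eventually.of_forall fun y => ?_)).trans (by simp)
  exact abs_integral_siteLogZ_sub_le y _ fun j => (hf (p j)).2

/-- Changing the size of one of the edges changes the mean log-partition function by at most
`2 * κ`. -/
theorem abs_meanSite_sub_le (hΘ : ∀ p, (edgeFactor (Θ p)).IsBounded κ)
    (hη : ∀ᵐ y ∂η, ∀ s, |y s| ≤ κ) {k : ℕ} (p p' : Fin k → P) (j : Fin k)
    (hp : ∀ i, i ≠ j → p i = p' i) :
    |meanSite Θ η ζ p - meanSite Θ η ζ p'| ≤ 2 * κ := by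
  have hf : ∀ p, (fieldFactor (Θ p) ζ).IsBounded κ := fun p => isBounded_fieldFactor (hΘ p) ζ
  have pf : ∀ p, IsProbabilityMeasure (fieldLaw (Θ p) ζ) := fun p => (hf p).1
  have hint := fun p : Fin k → P =>
    integrable_siteLogZ_prod η hη (fun j => fieldLaw (Θ (p j)) ζ) fun j => (hf (p j)).2
  rw [meanSite, meanSite, ← integral_sub (hint p).integral_prod_left (hint p').integral_prod_left,
    ← Real.norm_eq_abs]
  refine (norm_integral_le_of_norm_le_const (C := 2 * κ)
    (Eventually.of_forall fun y => ?_)).trans (by simp)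
  cases k with
  | zero => exact j.elim0
  | succ k =>
    have h1 := abs_integral_siteLogZ_sub_removeNth_le y (fun i => fieldLaw (Θ (p i)) ζ)
      (fun i => (hf (p i)).2) j
    have h2 := abs_integral_siteLogZ_sub_removeNth_le y (fun i => fieldLaw (Θ (p' i)) ζ)
      (fun i => (hf (p' i)).2) j
    have h3 : (fun i => fieldLaw (Θ (p (j.succAbove i))) ζ)
        = fun i => fieldLaw (Θ (p' (j.succAbove i))) ζ :=
      funext fun i => by rw [hp _ (Fin.succAbove_ne j i)]
    rw [h3] at h1
    rw [Real.norm_eq_abs]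
    rw [abs_sub_comm] at h2
    have h4 := abs_sub_le (∫ φ, siteLogZ y φ ∂(Measure.pi fun i => fieldLaw (Θ (p i)) ζ))
      (∫ φ, siteLogZ y φ ∂(Measure.pi fun i => fieldLaw (Θ (p' (j.succAbove i))) ζ))
      (∫ φ, siteLogZ y φ ∂(Measure.pi fun i => fieldLaw (Θ (p' i)) ζ))
    linarith

end Site

/-! ### Convergence of the degrees and of the edge sizes -/

/-- Replacing the independent inputs of a function of bounded differences `c` one at a time. -/
theorem abs_integral_pi_sub_le {X Y : Type} [Finite X] [MeasurableSpace X]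
    [MeasurableSingletonClass X] [Countable Y] [MeasurableSpace Y] [MeasurableSingletonClass Y]
    (U : Measure X) [IsProbabilityMeasure U] (ρ : Measure Y) [IsProbabilityMeasure ρ] (τ : X → Y)
    {c T : ℝ} (hT : ∀ G : Y → ℝ, (∀ a b, |G a - G b| ≤ c) →
      |∫ x, G (τ x) ∂U - ∫ y, G y ∂ρ| ≤ c * T) (k : ℕ) (F : (Fin k → Y) → ℝ) {B : ℝ}
    (hB : ∀ p, |F p| ≤ B)
    (hF : ∀ (j : Fin k) (p p' : Fin k → Y), (∀ i, i ≠ j → p i = p' i) → |F p - F p'| ≤ c) :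
    |∫ v, F (fun j => τ (v j)) ∂(Measure.pi fun _ : Fin k => U)
      - ∫ p, F p ∂(Measure.pi fun _ : Fin k => ρ)| ≤ k * (c * T) := by
  induction k with
  | zero =>
    have h : ∀ p : Fin 0 → Y, F p = F fun j => j.elim0 := fun p =>
      congrArg F (Subsingleton.elim _ _)
    simp [h]
  | succ k ih =>
    have hi : ∀ {Z : Type} [Countable Z] [MeasurableSpace Z] [MeasurableSingletonClass Z]
        (m : Measure Z) [IsProbabilityMeasure m] (g : Z → ℝ) (B : ℝ), (∀ z, |g z| ≤ B) →
        Integrable g m := fun m _ g B h =>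
      Integrable.of_bound (measurable_of_countable g).aestronglyMeasurable B
        (Eventually.of_forall h)
    have hb : ∀ {Z : Type} [MeasurableSpace Z] (m : Measure Z) [IsProbabilityMeasure m] (g : Z → ℝ)
        (B : ℝ), (∀ z, |g z| ≤ B) → |∫ z, g z ∂m| ≤ B := by
      intro Z _ m _ g B h
      have h1 : ∀ᵐ z ∂m, ‖g z‖ ≤ B := Eventually.of_forall h
      simpa using norm_integral_le_of_norm_le_const h1
    set G₁ : Y → ℝ := fun p₀ => ∫ v : Fin k → X, F (Fin.cons p₀ fun j => τ (v j))
      ∂(Measure.pi fun _ => U) with hG₁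
    set G₂ : Y → ℝ := fun p₀ => ∫ p' : Fin k → Y, F (Fin.cons p₀ p') ∂(Measure.pi fun _ => ρ)
      with hG₂
    have e₁ : ∫ v, F (fun j => τ (v j)) ∂(Measure.pi fun _ : Fin (k + 1) => U)
        = ∫ x, G₁ (τ x) ∂U := by
      rw [integral_pi_succ (fun _ => U) _ (hi _ _ B fun v => hB _)]
      refine integral_congr_ae (Eventually.of_forall fun x => integral_congr_ae
        (Eventually.of_forall fun v => congrArg F ?_))
      funext j
      induction j using Fin.cases <;> simp
    have e₂ : ∫ p, F p ∂(Measure.pi fun _ : Fin (k + 1) => ρ) = ∫ y, G₂ y ∂ρ :=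
      integral_pi_succ (fun _ => ρ) _ (hi _ _ B hB)
    have h1 : ∀ p₀, |G₁ p₀ - G₂ p₀| ≤ k * (c * T) := by
      intro p₀
      refine ih (fun p' => F (Fin.cons p₀ p')) (fun p' => hB _) fun j p p' h => ?_
      refine hF j.succ _ _ fun i hi => ?_
      induction i using Fin.cases with
      | zero => simp
      | succ i => simpa using h i fun hij => hi (congrArg Fin.succ hij)
    have h2 : ∀ a b, |G₂ a - G₂ b| ≤ c := by
      intro a b
      rw [hG₂]
      dsimp only
      rw [← integral_sub (hi _ _ B fun _ => hB _) (hi _ _ B fun _ => hB _)]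
      refine hb _ _ _ fun p' => hF 0 _ _ fun i hi => ?_
      obtain ⟨i, rfl⟩ := Fin.exists_succ_eq.2 hi
      simp
    have h3 := hT G₂ h2
    have i₁ : Integrable (fun x => G₁ (τ x)) U := hi _ _ B fun x => hb _ _ _ fun _ => hB _
    have i₂ : Integrable (fun x => G₂ (τ x)) U := hi _ _ B fun x => hb _ _ _ fun _ => hB _
    have h4 : |∫ x, G₁ (τ x) ∂U - ∫ x, G₂ (τ x) ∂U| ≤ k * (c * T) := by
      rw [← integral_sub i₁ i₂]
      exact hb _ _ _ fun x => h1 _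
    rw [e₁, e₂]
    have h5 := abs_sub_le (∫ x, G₁ (τ x) ∂U) (∫ x, G₂ (τ x) ∂U) (∫ y, G₂ y ∂ρ)
    push_cast
    linarith

section Degrees

variable {N : ℕ} (d : Fin N → ℕ) (μ : PMF ℕ)

theorem hasSum_degreeFreq_mul (g : ℕ → ℝ) :
    HasSum (fun k => degreeFreq d k * g k) ((1 / (N : ℝ)) * ∑ i, g (d i)) := by
  have h : ∀ i ∈ (Finset.univ : Finset (Fin N)),
      HasSum (fun k => (if d i = k then (1 : ℝ) else 0) * g k) (g (d i)) := by
    intro i _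
    convert! hasSum_ite_eq (d i) (g (d i)) using 2 with k
    by_cases hk : d i = k
    · subst hk; simp
    · simp [hk, Ne.symm hk]
  have h1 := (hasSum_sum h).mul_left (1 / (N : ℝ))
  convert! h1 using 2 with k
  rw [degreeFreq, mul_assoc, Finset.sum_mul]

variable {μ}

theorem tsum_mul_ne_top_of_sq (hμ2 : ∑' n : ℕ, (n : ℝ≥0∞) ^ 2 * μ n ≠ ⊤) :
    ∑' n : ℕ, (n : ℝ≥0∞) * μ n ≠ ⊤ := by
  refine ne_top_of_le_ne_top hμ2 (ENNReal.tsum_le_tsum fun n => ?_)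
  gcongr
  rw [sq]
  exact_mod_cast Nat.le_mul_self n

/-- A function of linear growth has nearly the same mean under the empirical distribution of the
degrees and under its limit. -/
theorem abs_degree_average_sub_le (hμ2 : ∑' n : ℕ, (n : ℝ≥0∞) ^ 2 * μ n ≠ ⊤) {g : ℕ → ℝ} {c : ℝ}
    (hc : 0 ≤ c) (hg : ∀ k, |g k| ≤ c * k) :
    Integrable g μ.toMeasure ∧ |(1 / (N : ℝ)) * ∑ i, g (d i) - ∫ k, g k ∂μ.toMeasure|
      ≤ c * ∑' k : ℕ, (k : ℝ) * |degreeFreq d k - (μ k).toReal| := by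
  have hμ1 := tsum_mul_ne_top_of_sq hμ2
  have hs : Summable fun k : ℕ => (k : ℝ) * (μ k).toReal := by
    simpa using ENNReal.summable_toReal hμ1
  have hN := (hasSum_degreeFreq_mul d fun k => (k : ℝ)).summable
  have hsg : Summable fun k => (μ k).toReal * g k := by
    refine Summable.of_norm_bounded (hs.mul_left c) fun k => ?_
    rw [Real.norm_eq_abs, abs_mul, ENNReal.abs_toReal]
    nlinarith [hg k, ENNReal.toReal_nonneg (a := μ k)]
  have hi : Integrable g μ.toMeasure := by
    refine ⟨(measurable_of_countable g).aestronglyMeasurable, ?_⟩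
    rw [HasFiniteIntegral, lintegral_countable']
    have h1 : ∀ k, ‖g k‖ₑ * μ.toMeasure {k} ≤ ENNReal.ofReal c * ((k : ℝ≥0∞) * μ k) := by
      intro k
      rw [PMF.toMeasure_apply_singleton _ _ (measurableSet_singleton k), ← mul_assoc]
      gcongr
      rw [← ofReal_norm, Real.norm_eq_abs, ← ENNReal.ofReal_natCast k,
        ← ENNReal.ofReal_mul hc]
      exact ENNReal.ofReal_le_ofReal (hg k)
    refine (ENNReal.tsum_le_tsum h1).trans_lt ?_
    rw [ENNReal.tsum_mul_left]
    exact ENNReal.mul_lt_top ENNReal.ofReal_lt_top hμ1.lt_top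
  refine ⟨hi, ?_⟩
  have h1 : ∫ k, g k ∂μ.toMeasure = ∑' k, (μ k).toReal * g k := PMF.integral_eq_tsum μ g hi
  have hd : Summable fun k : ℕ => (k : ℝ) * |degreeFreq d k - (μ k).toReal| := by
    have h2 := (hN.sub (hs.congr fun k => mul_comm _ _)).abs
    refine h2.congr fun k => ?_
    rw [← sub_mul, abs_mul, Nat.abs_cast, mul_comm]
  have hgN := hasSum_degreeFreq_mul d g
  rw [h1, ← hgN.tsum_eq, ← hgN.summable.tsum_sub hsg, ← tsum_mul_left, ← Real.norm_eq_abs]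
  refine tsum_of_norm_bounded (hd.mul_left c).hasSum fun k => ?_
  rw [Real.norm_eq_abs, ← sub_mul, abs_mul]
  nlinarith [hg k, abs_nonneg (degreeFreq d k - (μ k).toReal)]

end Degrees

section Sizes

variable {P : Set ℕ} (E : P →₀ ℕ) (ν : PMF P)

/-- The distance of the empirical distribution of the edge sizes to `ν`. -/
noncomputable def sizeDist : ℝ := ∑' p : P, ((p : ℕ) : ℝ) * |sizeFreq E p - (ν p).toReal|

theorem sum_edgeHalf (G : P → ℝ) :
    ∑ x : EdgeHalf E, G x.1.1 = ∑ p ∈ E.support, ((p : ℕ) : ℝ) * E p * G p := by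
  rw [Fintype.sum_sigma, Fintype.sum_sigma,
    ← Finset.sum_coe_sort E.support fun p : P => ((p : ℕ) : ℝ) * E p * G p]
  refine Finset.sum_congr rfl fun p _ => ?_
  simp only [Finset.sum_const, Finset.card_univ, Fintype.card_fin, nsmul_eq_mul, Edge.size]
  ring

/-- A function of bounded oscillation has nearly the same mean over the half-edges and under the
size-biased law. -/
theorem abs_size_average_sub_le (hP : ∀ p ∈ P, 2 ≤ p)
    (hν1 : ∑' p : P, ((p : ℕ) : ℝ≥0∞) * ν p ≠ ⊤) (hE : E ≠ 0)
    (G : P → ℝ) {c : ℝ} (hG : ∀ a b, |G a - G b| ≤ c) :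
    |(∑ x : EdgeHalf E, G x.1.1) / Fintype.card (EdgeHalf E)
      - ∫ p, G p ∂(sizeBiased hP ν hν1).toMeasure| ≤ c * sizeDist E ν := by
  obtain ⟨p₀, hp₀⟩ := Finsupp.support_nonempty_iff.2 hE
  have hc : 0 ≤ c := (abs_nonneg _).trans (hG p₀ p₀)
  set n : ℝ := ∑ q ∈ E.support, (E q : ℝ) with hn
  have hn0 : 0 < n := Finset.sum_pos (fun p hp =>
    Nat.cast_pos.2 (Nat.pos_of_ne_zero (Finsupp.mem_support_iff.1 hp))) ⟨p₀, hp₀⟩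
  have hz : ∀ p ∉ E.support, sizeFreq E p = 0 := fun p hp => by
    rw [sizeFreq, Finsupp.notMem_support_iff.1 hp, Nat.cast_zero, zero_div]
  have hp2 : ∀ p : P, (2 : ℝ) ≤ (p : ℕ) := fun p => by exact_mod_cast hP p p.2
  have hs : Summable fun p : P => ((p : ℕ) : ℝ) * (ν p).toReal := by
    simpa using ENNReal.summable_toReal hν1
  set m : ℝ := ∑' p : P, ((p : ℕ) : ℝ) * (ν p).toReal with hm
  have hm' : (∑' p : P, ((p : ℕ) : ℝ≥0∞) * ν p).toReal = m := by
    rw [ENNReal.tsum_toReal_eq fun p => ENNReal.ne_top_of_tsum_ne_top hν1 p]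
    simp [hm]
  have hm0 : 0 < m := by
    rw [← hm']
    exact ENNReal.toReal_pos (mean_ne_zero hP ν) hν1
  have hsN : ∀ g : P → ℝ, HasSum (fun p : P => ((p : ℕ) : ℝ) * sizeFreq E p * g p)
      (∑ p ∈ E.support, ((p : ℕ) : ℝ) * sizeFreq E p * g p) := fun g =>
    hasSum_sum_of_ne_finset_zero fun p hp => by rw [hz p hp]; ring
  set mN : ℝ := ∑ p ∈ E.support, ((p : ℕ) : ℝ) * sizeFreq E p with hmN
  have hmN2 : 2 ≤ mN := by
    have h1 : ∑ p ∈ E.support, sizeFreq E p = 1 := by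
      simp only [sizeFreq]
      rw [← Finset.sum_div, div_self hn0.ne']
    calc (2 : ℝ) = ∑ p ∈ E.support, 2 * sizeFreq E p := by rw [← Finset.mul_sum, h1, mul_one]
      _ ≤ mN := Finset.sum_le_sum fun p _ => mul_le_mul_of_nonneg_right (hp2 p)
          (div_nonneg (Nat.cast_nonneg _) hn0.le)
  have hsum : ∀ g : P → ℝ, ∑ x : EdgeHalf E, g x.1.1
      = n * ∑ p ∈ E.support, ((p : ℕ) : ℝ) * sizeFreq E p * g p := by
    intro g
    rw [sum_edgeHalf, Finset.mul_sum]
    refine Finset.sum_congr rfl fun p _ => ?_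
    rw [sizeFreq, ← hn]
    field_simp
  have hcard : (Fintype.card (EdgeHalf E) : ℝ) = n * mN := by
    have h1 := hsum fun _ => 1
    simpa using h1
  -- the difference to a constant is bounded, which the function itself need not be a priori
  set g : P → ℝ := fun p => G p - G p₀ with hg
  have hgc : ∀ p, |g p| ≤ c := fun p => hG p p₀
  have hρ : IsProbabilityMeasure (sizeBiased hP ν hν1).toMeasure := inferInstance
  have hgi : Integrable g (sizeBiased hP ν hν1).toMeasure :=
    Integrable.of_bound (measurable_of_countable g).aestronglyMeasurable c
      (Eventually.of_forall hgc)
  set X : ℝ := ∑ p ∈ E.support, ((p : ℕ) : ℝ) * sizeFreq E p * g p with hX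
  set Y : ℝ := ∑' p : P, ((p : ℕ) : ℝ) * (ν p).toReal * g p with hY
  have e₁ : (∑ x : EdgeHalf E, G x.1.1) / Fintype.card (EdgeHalf E) = X / mN + G p₀ := by
    have h1 : ∑ x : EdgeHalf E, G x.1.1
        = (∑ x : EdgeHalf E, g x.1.1) + Fintype.card (EdgeHalf E) * G p₀ := by
      simp [hg]
    rw [h1, hsum, ← hX, hcard]
    field_simp
  have e₂ : ∫ p, G p ∂(sizeBiased hP ν hν1).toMeasure = Y / m + G p₀ := by
    have h1 : ∫ p, G p ∂(sizeBiased hP ν hν1).toMeasure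
        = ∫ p, (g p + G p₀) ∂(sizeBiased hP ν hν1).toMeasure := by simp [hg]
    rw [h1, integral_add hgi (integrable_const _), PMF.integral_eq_tsum _ _ hgi, hY,
      div_eq_mul_inv, ← tsum_mul_right]
    congr 1
    · refine tsum_congr fun p => ?_
      rw [sizeBiased, PMF.normalize_apply, ENNReal.toReal_mul, ENNReal.toReal_inv, hm',
        ENNReal.toReal_mul, ENNReal.toReal_natCast, smul_eq_mul]
      ring
    · simp
  have hd : Summable fun p : P => ((p : ℕ) : ℝ) * |sizeFreq E p - (ν p).toReal| := by
    have h2 := ((hsN fun _ => 1).summable.sub hs).abs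
    refine h2.congr fun p => ?_
    rw [mul_one, ← mul_sub, abs_mul, Nat.abs_cast]
  have hYs : Summable fun p : P => ((p : ℕ) : ℝ) * (ν p).toReal * g p := by
    refine Summable.of_norm_bounded (hs.mul_left c) fun p => ?_
    have h0 : 0 ≤ ((p : ℕ) : ℝ) * (ν p).toReal := by positivity
    rw [Real.norm_eq_abs, abs_mul, abs_of_nonneg h0]
    nlinarith [hgc p]
  have hdiff : ∀ (g : P → ℝ) (c : ℝ), (∀ p, |g p| ≤ c) →
      Summable (fun p : P => ((p : ℕ) : ℝ) * (ν p).toReal * g p) →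
      |∑ p ∈ E.support, ((p : ℕ) : ℝ) * sizeFreq E p * g p
        - ∑' p : P, ((p : ℕ) : ℝ) * (ν p).toReal * g p| ≤ c * sizeDist E ν := by
    intro g c hgc hgs
    rw [← (hsN g).tsum_eq, ← (hsN g).summable.tsum_sub hgs, sizeDist, ← tsum_mul_left,
      ← Real.norm_eq_abs]
    refine tsum_of_norm_bounded (hd.mul_left c).hasSum fun p => ?_
    have h0 : 0 ≤ ((p : ℕ) : ℝ) * |sizeFreq E p - (ν p).toReal| := by positivity
    rw [Real.norm_eq_abs, ← sub_mul, ← mul_sub, abs_mul, abs_mul, Nat.abs_cast]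
    nlinarith [hgc p]
  have h1 : |X - Y| ≤ c * sizeDist E ν := hdiff g c hgc hYs
  have h2 : |mN - m| ≤ sizeDist E ν := by
    have := hdiff (fun _ => 1) 1 (by simp) (by simpa using hs)
    simpa using this
  have h3 : |Y| ≤ c * m := by
    rw [hY, hm, ← tsum_mul_left, ← Real.norm_eq_abs]
    refine tsum_of_norm_bounded (hs.mul_left c).hasSum fun p => ?_
    have h0 : 0 ≤ ((p : ℕ) : ℝ) * (ν p).toReal := by positivity
    rw [Real.norm_eq_abs, abs_mul, abs_of_nonneg h0]
    nlinarith [hgc p]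
  have hmN0 : 0 < mN := by linarith
  rw [e₁, e₂, add_sub_add_right_eq_sub]
  have e₃ : X / mN - Y / m = ((X - Y) - Y / m * (mN - m)) / mN := by
    field_simp
    ring
  have h4 : |Y / m| ≤ c := by
    rw [abs_div, abs_of_pos hm0, div_le_iff₀ hm0]
    exact h3
  have h5 : |Y / m * (mN - m)| ≤ c * sizeDist E ν := by
    rw [abs_mul]
    exact mul_le_mul h4 h2 (abs_nonneg _) hc
  have h6 := abs_sub (X - Y) (Y / m * (mN - m))
  have h7 : 0 ≤ c * sizeDist E ν := (abs_nonneg _).trans h1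
  rw [e₃, abs_div, abs_of_pos hmN0, div_le_iff₀ hmN0]
  nlinarith

end Sizes

/-! ### The fields at a vertex are nearly independent -/

/-- Sampling without replacement from a large population is close to sampling from the law `ρ`. -/
theorem abs_average_places_comp_sub_le {X Y : Type} [Fintype X] [DecidableEq X] [Nonempty X]
    [Countable Y] [MeasurableSpace Y] [MeasurableSingletonClass Y] (ρ : Measure Y)
    [IsProbabilityMeasure ρ] (τ : X → Y) {κ T : ℝ}
    (hT : ∀ G : Y → ℝ, (∀ a b, |G a - G b| ≤ 2 * κ) →
      |(∑ x, G (τ x)) / Fintype.card X - ∫ y, G y ∂ρ| ≤ 2 * κ * T)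
    {k : ℕ} (hk : k ≤ Fintype.card X) (F : (Fin k → Y) → ℝ) (Z : ℝ)
    (hZ : ∀ p, |F p - Z| ≤ κ * k)
    (hF : ∀ (j : Fin k) (p p' : Fin k → Y), (∀ i, i ≠ j → p i = p' i) → |F p - F p'| ≤ 2 * κ) :
    |(∑ v ∈ places (∅ : Finset X) k, F fun j => τ (v j)) / ((places (∅ : Finset X) k).card : ℝ)
      - ∫ p, F p ∂(Measure.pi fun _ : Fin k => ρ)|
      ≤ 2 * κ * min (k : ℝ) ((k : ℝ) ^ 3 / Fintype.card X) + k * (2 * κ * T) := by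
  let _ : MeasurableSpace X := ⊤
  have : MeasurableSingletonClass X := ⟨fun _ => trivial⟩
  obtain ⟨x₀⟩ := ‹Nonempty X›
  have hcard : 0 < (∅ᶜ : Finset X).card := by
    rw [Finset.compl_empty, Finset.card_univ]; exact Fintype.card_pos_iff.2 ⟨x₀⟩
  have hunif := integral_uniform (Finset.univ : Finset X) ⟨x₀, Finset.mem_univ _⟩
  have hunif' := integral_pi_uniform (Finset.univ : Finset X) ⟨x₀, Finset.mem_univ _⟩ k
  set U := (PMF.uniformOfFinset (Finset.univ : Finset X) ⟨x₀, Finset.mem_univ _⟩).toMeasure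
  set f : (Fin k → X) → ℝ := fun v => (F fun j => τ (v j)) - Z with hf
  have hfb : ∀ v, |f v| ≤ κ * k := fun v => hZ _
  have hkc : 0 ≤ κ * k := (abs_nonneg _).trans (hfb fun _ => x₀)
  have hpl : (0 : ℝ) < (places (∅ : Finset X) k).card := by
    rw [card_places, Nat.cast_pos]
    exact Nat.descFactorial_pos.2 (by simpa using hk)
  have e₁ : (∑ v ∈ places (∅ : Finset X) k, F fun j => τ (v j))
        / ((places (∅ : Finset X) k).card : ℝ)
      = (∑ v ∈ places (∅ : Finset X) k, f v) / ((places (∅ : Finset X) k).card : ℝ) + Z := by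
    rw [hf, Finset.sum_sub_distrib, Finset.sum_const, nsmul_eq_mul]
    field_simp
    ring
  have e₂ : ∫ v, F (fun j => τ (v j)) ∂(Measure.pi fun _ : Fin k => U)
      = (∑ v ∈ Fintype.piFinset fun _ : Fin k => (∅ᶜ : Finset X), f v)
        / ((∅ᶜ : Finset X).card : ℝ) ^ k + Z := by
    have h1 : ∫ v, F (fun j => τ (v j)) ∂(Measure.pi fun _ : Fin k => U)
        = ∫ v, (f v + Z) ∂(Measure.pi fun _ : Fin k => U) := by simp [hf]
    rw [h1, integral_add Integrable.of_finite (integrable_const _), hunif', Finset.compl_empty]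
    simp
  have h1 := abs_average_places_sub_le (∅ : Finset X) k f hfb hcard
  have h1' : |(∑ v ∈ places (∅ : Finset X) k, f v) / ((places (∅ : Finset X) k).card : ℝ)
      - (∑ v ∈ Fintype.piFinset fun _ : Fin k => (∅ᶜ : Finset X), f v)
        / ((∅ᶜ : Finset X).card : ℝ) ^ k| ≤ 2 * κ * k := by
    have h2 := abs_sum_div_card_le (places (∅ : Finset X) k) f hkc fun v _ => hfb v
    have h3 := abs_sum_div_card_le (Fintype.piFinset fun _ : Fin k => (∅ᶜ : Finset X)) f hkc
      fun v _ => hfb v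
    have h4 : ((Fintype.piFinset fun _ : Fin k => (∅ᶜ : Finset X)).card : ℝ)
        = ((∅ᶜ : Finset X).card : ℝ) ^ k := by simp
    rw [h4] at h3
    refine (abs_sub _ _).trans ?_
    linarith
  have h2 := abs_integral_pi_sub_le U ρ τ (c := 2 * κ) (T := T) (fun G hG => by
    rw [hunif, Finset.card_univ]; exact hT G hG) k F (B := |Z| + κ * k) (fun p => by
      have := abs_sub_abs_le_abs_sub (F p) Z
      linarith [hZ p]) hF
  have h3 : |(∑ v ∈ places (∅ : Finset X) k, f v) / ((places (∅ : Finset X) k).card : ℝ)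
      - (∑ v ∈ Fintype.piFinset fun _ : Fin k => (∅ᶜ : Finset X), f v)
        / ((∅ᶜ : Finset X).card : ℝ) ^ k|
      ≤ 2 * κ * min (k : ℝ) ((k : ℝ) ^ 3 / Fintype.card X) := by
    rcases min_choice (k : ℝ) ((k : ℝ) ^ 3 / Fintype.card X) with h | h
    · rw [h]; exact h1'
    · rw [h]
      refine h1.trans (le_of_eq ?_)
      rw [Finset.compl_empty, Finset.card_univ]
      ring
  have h4 := abs_sub_le ((∑ v ∈ places (∅ : Finset X) k, F fun j => τ (v j))
    / ((places (∅ : Finset X) k).card : ℝ))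
    (∫ v, F (fun j => τ (v j)) ∂(Measure.pi fun _ : Fin k => U))
    (∫ p, F p ∂(Measure.pi fun _ : Fin k => ρ))
  have h5 : |(∑ v ∈ places (∅ : Finset X) k, F fun j => τ (v j))
    / ((places (∅ : Finset X) k).card : ℝ)
    - ∫ v, F (fun j => τ (v j)) ∂(Measure.pi fun _ : Fin k => U)|
      ≤ 2 * κ * min (k : ℝ) ((k : ℝ) ^ 3 / Fintype.card X) := by
    rw [e₁, e₂, add_sub_add_right_eq_sub]
    exact h3
  linarith

/-- The mean of the errors of sampling without replacement; degrees are bounded by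
`√(C N)`. With `A` the left side and `M` the sum of the degrees, the two arguments of the minimum
give bounds on `A N / M` and `A M`, whose product does not involve `M`, so that `M` may be small
(or zero, with the value `0` of the quotient). -/
theorem average_min_le {N : ℕ} (hN : 1 ≤ N) (d : Fin N → ℕ) {C : ℝ}
    (hC : (1 / (N : ℝ)) * ∑ i, (d i : ℝ) ^ 2 ≤ C) :
    (1 / (N : ℝ)) * ∑ i, min (d i : ℝ) ((d i : ℝ) ^ 3 / (∑ i, (d i : ℝ)))
      ≤ √(C * √(C / N)) := by
  have hN' : (0 : ℝ) < N := by exact_mod_cast hN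
  have hC0 : 0 ≤ C := le_trans (by positivity) hC
  set M : ℝ := ∑ i, (d i : ℝ) with hM
  have hM0 : 0 ≤ M := Finset.sum_nonneg fun _ _ => Nat.cast_nonneg _
  set A := (1 / (N : ℝ)) * ∑ i, min (d i : ℝ) ((d i : ℝ) ^ 3 / M) with hA
  have hA0 : 0 ≤ A := mul_nonneg (by positivity) (Finset.sum_nonneg fun i _ =>
    le_min (Nat.cast_nonneg _) (by positivity))
  have h1 : A * N ≤ M := by
    rw [hA, one_div, mul_comm, ← mul_assoc, mul_inv_cancel₀ hN'.ne', one_mul]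
    exact Finset.sum_le_sum fun i _ => min_le_left _ _
  have hdi : ∀ i, (d i : ℝ) ≤ √(C * N) := by
    intro i
    refine Real.le_sqrt_of_sq_le ?_
    have h2 := Finset.single_le_sum (f := fun i => (d i : ℝ) ^ 2) (fun i _ => by positivity)
      (Finset.mem_univ i)
    rw [one_div, inv_mul_le_iff₀ hN'] at hC
    linarith
  have h2 : A * M ≤ √(C * N) * C := by
    rcases hM0.eq_or_lt with h0 | h0
    · rw [← h0, mul_zero]; positivity
    · calc A * M ≤ ((1 / (N : ℝ)) * ∑ i, (d i : ℝ) ^ 3 / M) * M := by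
            refine mul_le_mul_of_nonneg_right (mul_le_mul_of_nonneg_left ?_ (by positivity)) hM0
            exact Finset.sum_le_sum fun i _ => min_le_right _ _
        _ = (1 / (N : ℝ)) * ∑ i, (d i : ℝ) ^ 3 := by
            rw [← Finset.sum_div]; field_simp
        _ ≤ (1 / (N : ℝ)) * ∑ i, √(C * N) * (d i : ℝ) ^ 2 := by
            gcongr with i
            nlinarith [hdi i, sq_nonneg (d i : ℝ)]
        _ = √(C * N) * ((1 / (N : ℝ)) * ∑ i, (d i : ℝ) ^ 2) := by
            rw [← Finset.mul_sum]; ring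
        _ ≤ _ := by gcongr
  refine Real.le_sqrt_of_sq_le ?_
  have h3 : √(C * N) = √(C / N) * N := by
    rw [show C * N = C / N * (N : ℝ) ^ 2 by field_simp, Real.sqrt_mul (by positivity),
      Real.sqrt_sq hN'.le]
  rw [h3] at h2
  have h4 : A * (A * N) ≤ A * M := mul_le_mul_of_nonneg_left h1 hA0
  nlinarith

/-! ### The bound for a given number of vertices -/

section Bound

variable {P : Set ℕ} {Θ : (p : P) → Measure (Interaction p)} {η : Measure (Spin → ℝ)}
  (ζ : Measure ℝ) {κ : ℝ} [IsProbabilityMeasure ζ] [IsProbabilityMeasure η] {N : ℕ}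

theorem integral_meanLogZ_fieldFactors (hΘ : ∀ p, (edgeFactor (Θ p)).IsBounded κ)
    (hη : ∀ᵐ y ∂η, ∀ s, |y s| ≤ κ) (d : Fin N → ℕ) (E : P →₀ ℕ)
    (hdeg : ∑ i, d i = E.sum fun p n => (p : ℕ) * n) :
    ∫ h, meanLogZ (Sigma.fst : VertexHalf d → Fin N) (fieldFactors Θ ζ (edgeSizes E)) ∅
        (fieldEnergy h) ∂(Measure.pi fun _ : Fin N => η)
      = ∑ i, (∑ v ∈ places (∅ : Finset (EdgeHalf E)) (d i),
          meanSite Θ η ζ fun j => ((v j).1.1 : P))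
            / ((places (∅ : Finset (EdgeHalf E)) (d i)).card : ℝ) := by
  have hf : ∀ p, (fieldFactor (Θ p) ζ).IsBounded κ := fun p => isBounded_fieldFactor (hΘ p) ζ
  have pf : ∀ p, IsProbabilityMeasure (fieldLaw (Θ p) ζ) := fun p => (hf p).1
  have hint : ∀ {k : ℕ} (p : Fin k → P), Integrable (fun y =>
      ∫ φ, siteLogZ y φ ∂(Measure.pi fun j => fieldLaw (Θ (p j)) ζ)) η := fun p =>
    (integrable_siteLogZ_prod η hη (fun j => fieldLaw (Θ (p j)) ζ)
      fun j => (hf (p j)).2).integral_prod_left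
  have hev := fun i : Fin N => measurePreserving_eval (fun _ : Fin N => η) i
  have hint' : ∀ (i : Fin N) {k : ℕ} (p : Fin k → P), Integrable (fun h : Fin N → Spin → ℝ =>
      ∫ φ, siteLogZ (h i) φ ∂(Measure.pi fun j => fieldLaw (Θ (p j)) ζ))
      (Measure.pi fun _ : Fin N => η) := fun i _ p =>
    (hev i).integrable_comp_of_integrable (hint p)
  simp only [meanLogZ_fieldFactors_eq Θ hΘ ζ d E hdeg]
  rw [integral_finsetSum]
  · refine Finset.sum_congr rfl fun i _ => ?_
    rw [integral_div, integral_finsetSum _ fun v _ => hint' i fun j => ((v j).1.1 : P)]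
    congr 1
    refine Finset.sum_congr rfl fun v _ => ?_
    exact integral_comp_eval (μ := fun _ : Fin N => η) (i := i)
      (hint fun j => ((v j).1.1 : P)).aestronglyMeasurable
  · intro i _
    exact (integrable_finsetSum _ fun v _ => hint' i fun j => ((v j).1.1 : P)).div_const _

/-- The contribution of the edges to the bound, per half-edge. -/
noncomputable def edgeContribution (Θ : (p : P) → Measure (Interaction p)) (ζ : Measure ℝ)
    (p : P) : ℝ := ((((p : ℕ) : ℝ) - 1) / ((p : ℕ) : ℝ)) * bulkTerm (Θ p) ζ

theorem edgeTerm_eq {P : Set ℕ} (Θ : (p : P) → Measure (Interaction p)) (ζ : Measure ℝ)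
    (ρ : PMF P) : edgeTerm Θ ρ ζ = ∫ p, edgeContribution Θ ζ p ∂ρ.toMeasure := by
  unfold edgeTerm edgeContribution bulkTerm
  simp only [integral_const_mul]

theorem abs_edgeContribution_le (hP : ∀ p ∈ P, 2 ≤ p)
    (hΘ : ∀ p, (edgeFactor (Θ p)).IsBounded κ) (p : P) : |edgeContribution Θ ζ p| ≤ κ := by
  have h1 := abs_bulkTerm_le (hΘ p) ζ
  have h2 : (2 : ℝ) ≤ (p : ℕ) := by exact_mod_cast hP p p.2
  have h3 : |(((p : ℕ) : ℝ) - 1) / ((p : ℕ) : ℝ)| ≤ 1 := by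
    rw [abs_of_nonneg (div_nonneg (by linarith) (by linarith)), div_le_one (by linarith)]
    linarith
  rw [edgeContribution, abs_mul]
  exact (mul_le_mul h3 h1 (abs_nonneg _) zero_le_one).trans (one_mul κ).le

theorem sum_edge_eq_sum_edgeHalf (E : P →₀ ℕ) (G : P → ℝ) :
    ∑ e : Edge E, ((e.1 : P) : ℕ) * G e.1 = ∑ x : EdgeHalf E, G x.1.1 := by
  have h := Fintype.sum_sigma fun x : EdgeHalf E => G x.1.1
  rw [h]
  simp only [Finset.sum_const, Finset.card_univ, Fintype.card_fin, nsmul_eq_mul, Edge.size]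

/-- The interpolation bound for the free energy, in terms of the half-edges of the edges. -/
theorem freeEnergy_le_sum (hP : ∀ p ∈ P, 2 ≤ p) (hκ : 0 ≤ κ)
    (hΘ : ∀ p, ∃ β φ, IsProductLaw κ (Θ p) β φ) (hη : ∀ᵐ y ∂η, ∀ s, |y s| ≤ κ)
    (d : Fin N → ℕ) (E : P →₀ ℕ) (hdeg : ∑ i, d i = E.sum fun p n => (p : ℕ) * n) (K : ℕ) {L : ℕ}
    (hL : 1 ≤ L) :
    freeEnergy Θ η d E ≤ (1 / (N : ℝ)) * (∑ i, (∑ v ∈ places (∅ : Finset (EdgeHalf E)) (d i),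
          meanSite Θ η ζ fun j => ((v j).1.1 : P))
            / ((places (∅ : Finset (EdgeHalf E)) (d i)).card : ℝ)
      - ∑ x : EdgeHalf E, edgeContribution Θ ζ x.1.1
      + (3 * κ * ((∑ x : EdgeHalf E, if K < ((x.1.1 : P) : ℕ) then (1 : ℝ) else 0) + K * L)
      + (K + 1) * (2 * κ * L) + 3 * κ * (K : ℝ) ^ 2 * Fintype.card (EdgeHalf E) / L)) := by
  have hbd : ∀ p, (edgeFactor (Θ p)).IsBounded κ := fun p => by
    obtain ⟨β, φ, h⟩ := hΘ p; exact h.isBounded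
  have hcard : ((edgeSizes E).map fun p : P => (p : ℕ)).sum = Fintype.card (EdgeHalf E) := by
    rw [sum_map_edgeSizes, card_edgeHalf]
  have hfit : ((edgeSizes E).map fun p : P => (p : ℕ)).sum ≤ Fintype.card (VertexHalf d) := by
    rw [hcard, card_vertexHalf, hdeg, card_edgeHalf_eq_sum]
  have hlen : (edgeSizes E).length ≤ Fintype.card (EdgeHalf E) := by
    rw [← hcard]
    have h1 := List.sum_le_sum (l := edgeSizes E) (f := fun _ => 1) (g := fun p : P => (p : ℕ))
      fun p _ => le_trans one_le_two (hP p p.2)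
    simpa using h1
  have hbulk : ((edgeSizes E).map fun p : P => (((p : ℕ) : ℝ) - 1) * bulkTerm (Θ p) ζ).sum
      = ∑ x : EdgeHalf E, edgeContribution Θ ζ x.1.1 := by
    rw [sum_map_edgeSizes, ← sum_edge_eq_sum_edgeHalf]
    refine Finset.sum_congr rfl fun e _ => ?_
    have h2 : (((e.1 : P) : ℕ) : ℝ) ≠ 0 := by
      have := hP (e.1 : P) (e.1 : P).2
      exact_mod_cast (by omega : ((e.1 : P) : ℕ) ≠ 0)
    rw [edgeContribution]
    field_simp
  have htail : (((((edgeSizes E).filter fun p : P => K < (p : ℕ)).map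
      fun p : P => (p : ℕ)).sum : ℕ) : ℝ)
      = ∑ x : EdgeHalf E, if K < ((x.1.1 : P) : ℕ) then (1 : ℝ) else 0 := by
    have h1 := List.sum_map_ite (fun p : P => K < (p : ℕ)) (fun p : P => (p : ℕ)) (fun _ => 0)
      (edgeSizes E)
    rw [List.map_const', List.sum_replicate, smul_zero, add_zero] at h1
    rw [← h1, sum_map_edgeSizes, ← sum_edge_eq_sum_edgeHalf E fun p : P =>
      if K < (p : ℕ) then (1 : ℝ) else 0, Nat.cast_sum]
    refine Finset.sum_congr rfl fun e _ => ?_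
    split_ifs <;> simp
  have hL' : (0 : ℝ) < L := by exact_mod_cast hL
  set s : VertexHalf d → Fin N := Sigma.fst with hs
  have hbe := isBounded_edgeFactors hbd (edgeSizes E)
  have hbf := isBounded_fieldFactors ζ hbd (edgeSizes E)
  have hie := integrable_comp_fieldEnergy
    (abs_meanLogZ_sub_le s hbe (∅ : Finset (VertexHalf d))) η hη
  have hif := integrable_comp_fieldEnergy
    (abs_meanLogZ_sub_le s hbf (∅ : Finset (VertexHalf d))) η hη
  rw [freeEnergy_eq Θ hbd η hη d E hdeg, ← integral_meanLogZ_fieldFactors ζ hbd hη d E hdeg]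
  refine mul_le_mul_of_nonneg_left ?_ (by positivity)
  set c : ℝ := - ∑ x : EdgeHalf E, edgeContribution Θ ζ x.1.1
      + (3 * κ * ((∑ x : EdgeHalf E, if K < ((x.1.1 : P) : ℕ) then (1 : ℝ) else 0) + K * L)
      + (K + 1) * (2 * κ * L) + 3 * κ * (K : ℝ) ^ 2 * Fintype.card (EdgeHalf E) / L) with hc
  have h1 : ∀ h : Fin N → Spin → ℝ, meanLogZ s (edgeFactors Θ (edgeSizes E)) ∅ (fieldEnergy h)
      ≤ meanLogZ s (fieldFactors Θ ζ (edgeSizes E)) ∅ (fieldEnergy h) + c := by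
    intro h
    have h2 := meanLogZ_edgeFactors_le ζ hP hκ hΘ s (fieldEnergy h) K hL (edgeSizes E) hfit
    rw [hbulk, htail] at h2
    have h3 : 3 * κ * (K : ℝ) ^ 2 * (edgeSizes E).length / L
        ≤ 3 * κ * (K : ℝ) ^ 2 * Fintype.card (EdgeHalf E) / L := by
      gcongr
    linarith
  have h2 := integral_mono hie (hif.add (integrable_const c)) h1
  have h3 : ∫ h, (meanLogZ s (fieldFactors Θ ζ (edgeSizes E)) ∅ (fieldEnergy h) + c)
      ∂(Measure.pi fun _ : Fin N => η)
      = (∫ h, meanLogZ s (fieldFactors Θ ζ (edgeSizes E)) ∅ (fieldEnergy h)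
      ∂(Measure.pi fun _ : Fin N => η)) + c := by
    rw [integral_add hif (integrable_const c)]; simp
  refine h2.trans (le_of_eq ?_)
  refine Eq.trans h3 ?_
  rw [hc]
  ring

/-- The difference between the free energy and the replica symmetric functional, in terms of the
distances of the empirical distributions to their limits. -/
theorem freeEnergy_le (hP : ∀ p ∈ P, 2 ≤ p) (hκ : 0 ≤ κ)
    (hΘ : ∀ p, ∃ β φ, IsProductLaw κ (Θ p) β φ) (hη : ∀ᵐ y ∂η, ∀ s, |y s| ≤ κ)
    (hN : 1 ≤ N) (d : Fin N → ℕ) (E : P →₀ ℕ) (hE : E ≠ 0)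
    (hdeg : ∑ i, d i = E.sum fun p n => (p : ℕ) * n) {C : ℝ}
    (hC : (1 / (N : ℝ)) * ∑ i, (d i : ℝ) ^ 2 ≤ C) (μ : PMF ℕ) (ν : PMF P)
    (hμ2 : ∑' n : ℕ, (n : ℝ≥0∞) ^ 2 * μ n ≠ ⊤) (hν1 : ∑' p : P, ((p : ℕ) : ℝ≥0∞) * ν p ≠ ⊤)
    (K : ℕ) {L : ℕ} (hL : 1 ≤ L) {m δ ε t : ℝ} (hm : m = (1 / (N : ℝ)) * ∑ i, (d i : ℝ))
    (hδ : δ = sizeDist E ν) (hε : ε = ∑' k : ℕ, (k : ℝ) * |degreeFreq d k - (μ k).toReal|)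
    (ht : t = ∫ p : P, (if K < (p : ℕ) then (1 : ℝ) else 0) ∂(sizeBiased hP ν hν1).toMeasure) :
    freeEnergy Θ η d E ≤ rsFunctional Θ η μ (sizeBiased hP ν hν1) ζ
      + (2 * κ * √(C * √(C / N)) + 4 * κ * δ * m + 2 * κ * ε + 3 * κ * m * (t + δ)
        + 3 * κ * K * (L / N) + (K + 1) * (2 * κ) * (L / N)
        + 3 * κ * (K : ℝ) ^ 2 * m * (1 / L)) := by
  have hbd : ∀ p, (edgeFactor (Θ p)).IsBounded κ := fun p => by
    obtain ⟨β, φ, h⟩ := hΘ p; exact h.isBounded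
  have hN' : (0 : ℝ) < N := by exact_mod_cast hN
  have hL' : (0 : ℝ) < L := by exact_mod_cast hL
  have hM : (Fintype.card (EdgeHalf E) : ℝ) = m * N := by
    rw [card_edgeHalf_eq_sum, ← hdeg, hm]
    push_cast
    field_simp
  have hsum : ∑ i, (d i : ℝ) = m * N := by rw [hm]; field_simp
  have hle : ∀ i, d i ≤ Fintype.card (EdgeHalf E) := fun i => by
    rw [card_edgeHalf_eq_sum, ← hdeg]
    exact Finset.single_le_sum (fun _ _ => Nat.zero_le _) (Finset.mem_univ i)
  have hne : Nonempty (EdgeHalf E) := by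
    obtain ⟨p, hp⟩ := Finsupp.support_nonempty_iff.2 hE
    exact ⟨⟨⟨⟨p, hp⟩, ⟨0, Nat.pos_of_ne_zero (Finsupp.mem_support_iff.1 hp)⟩⟩,
      ⟨0, lt_of_lt_of_le two_pos (hP p p.2)⟩⟩⟩
  have hM0 : (0 : ℝ) < Fintype.card (EdgeHalf E) := by exact_mod_cast Fintype.card_pos
  have hm0 : 0 ≤ m := by
    rw [hm]; exact mul_nonneg (by positivity) (Finset.sum_nonneg fun _ _ => Nat.cast_nonneg _)
  set ρ := sizeBiased hP ν hν1 with hρ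
  have hsize := fun (G : P → ℝ) (c : ℝ) => abs_size_average_sub_le E ν hP hν1 hE G (c := c)
  rw [← hδ, ← hρ] at hsize
  set S : Fin N → ℝ := fun i => (∑ v ∈ places (∅ : Finset (EdgeHalf E)) (d i),
    meanSite Θ η ζ fun j => ((v j).1.1 : P)) / ((places (∅ : Finset (EdgeHalf E)) (d i)).card : ℝ)
    with hS
  set Ψ : ℕ → ℝ := fun k => ∫ p : Fin k → P, meanSite Θ η ζ p
    ∂(Measure.pi fun _ => ρ.toMeasure) with hΨ
  -- the fields at a vertex are compared with independent ones of the law `ρ`, and then the degrees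
  -- with the law `μ`
  have hsite : ∀ i, S i ≤ Ψ (d i)
      + (2 * κ * min (d i : ℝ) ((d i : ℝ) ^ 3 / ∑ i, (d i : ℝ)) + d i * (2 * κ * δ)) := by
    intro i
    have h1 := abs_average_places_comp_sub_le ρ.toMeasure (fun x : EdgeHalf E => (x.1.1 : P))
      (κ := κ) (T := δ) (fun G hG => hsize G (2 * κ) hG) (hle i) (meanSite Θ η ζ) (isolatedSite η)
      (fun p => abs_meanSite_sub_isolatedSite_le ζ hbd hη p)
      fun j p p' h => abs_meanSite_sub_le ζ hbd hη p p' j h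
    rw [hM, ← hsum] at h1
    linarith [(abs_le.1 h1).2]
  have hΨb : ∀ k, |Ψ k - isolatedSite η| ≤ κ * k := by
    intro k
    have hb := fun p : Fin k → P => abs_meanSite_sub_isolatedSite_le (κ := κ) ζ hbd hη p
    have hi : Integrable (fun p : Fin k → P => meanSite Θ η ζ p)
        (Measure.pi fun _ => ρ.toMeasure) := by
      refine Integrable.of_bound (measurable_of_countable _).aestronglyMeasurable
        (|isolatedSite η| + κ * k) (Eventually.of_forall fun p => ?_)
      have := abs_sub_abs_le_abs_sub (meanSite Θ η ζ p) (isolatedSite η)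
      rw [Real.norm_eq_abs]
      linarith [hb p]
    have h1 : Ψ k - isolatedSite η = ∫ p : Fin k → P, (meanSite Θ η ζ p - isolatedSite η)
        ∂(Measure.pi fun _ => ρ.toMeasure) := by
      rw [integral_sub hi (integrable_const _)]; simp [hΨ]
    rw [h1]
    have h2 : ∀ᵐ p : Fin k → P ∂(Measure.pi fun _ => ρ.toMeasure),
        ‖meanSite Θ η ζ p - isolatedSite η‖ ≤ κ * k := Eventually.of_forall hb
    simpa using norm_integral_le_of_norm_le_const h2
  have hdegΨ := abs_degree_average_sub_le d hμ2 hκ hΨb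
  have hdeg1 := abs_degree_average_sub_le d hμ2 zero_le_one (g := fun k => (k : ℝ)) fun k => by simp
  rw [← hε] at hdegΨ hdeg1
  have hsiteTerm : siteTerm Θ η μ ρ ζ
      = (∫ k, (Ψ k - isolatedSite η) ∂μ.toMeasure) + isolatedSite η := by
    rw [siteTerm_eq ζ hbd hη]
    have h1 : ∫ k, Ψ k ∂μ.toMeasure
        = ∫ k, ((Ψ k - isolatedSite η) + isolatedSite η) ∂μ.toMeasure := by simp
    refine Eq.trans h1 ?_
    rw [integral_add hdegΨ.1 (integrable_const _)]
    simp
  have hsites : (1 / (N : ℝ)) * ∑ i, S i ≤ siteTerm Θ η μ ρ ζ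
      + (2 * κ * √(C * √(C / N)) + 2 * κ * δ * m + κ * ε) := by
    have h1 : (1 / (N : ℝ)) * ∑ i, S i ≤ (1 / (N : ℝ)) * ∑ i, (Ψ (d i)
        + (2 * κ * min (d i : ℝ) ((d i : ℝ) ^ 3 / ∑ i, (d i : ℝ)) + d i * (2 * κ * δ))) :=
      mul_le_mul_of_nonneg_left (Finset.sum_le_sum fun i _ => hsite i) (by positivity)
    have h2 : (1 / (N : ℝ)) * ∑ i, (Ψ (d i)
        + (2 * κ * min (d i : ℝ) ((d i : ℝ) ^ 3 / ∑ i, (d i : ℝ)) + d i * (2 * κ * δ)))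
        = ((1 / (N : ℝ)) * ∑ i, (Ψ (d i) - isolatedSite η)) + isolatedSite η
          + 2 * κ * ((1 / (N : ℝ)) * ∑ i, min (d i : ℝ) ((d i : ℝ) ^ 3 / ∑ i, (d i : ℝ)))
          + 2 * κ * δ * m := by
      rw [hm]
      simp only [Finset.sum_add_distrib, Finset.sum_sub_distrib, ← Finset.mul_sum,
        ← Finset.sum_mul, Finset.sum_const, Finset.card_univ, Fintype.card_fin, nsmul_eq_mul]
      field_simp
      ring
    have h3 := mul_le_mul_of_nonneg_left (average_min_le hN d hC) (by linarith : 0 ≤ 2 * κ)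
    have h4 := (abs_le.1 hdegΨ.2).2
    rw [hsiteTerm]
    linarith
  -- the sum over the half-edges is `m * N` times a mean over them, and `m` tends to the mean of `μ`
  set G := edgeContribution Θ ζ with hG
  have hGb := abs_edgeContribution_le ζ hP hbd
  have hedge : -((1 / (N : ℝ)) * ∑ x : EdgeHalf E, G x.1.1)
      ≤ -((∫ k : ℕ, (k : ℝ) ∂μ.toMeasure) * edgeTerm Θ ρ ζ) + (2 * κ * δ * m + κ * ε) := by
    have h1 := hsize G (2 * κ) fun a b => by
      have := abs_sub (G a) (G b)
      linarith [hGb a, hGb b]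
    rw [edgeTerm_eq]
    set I := ∫ p, G p ∂ρ.toMeasure with hI
    have hIb : |I| ≤ κ := by
      have h2 : ∀ᵐ p ∂ρ.toMeasure, ‖G p‖ ≤ κ := Eventually.of_forall hGb
      simpa using norm_integral_le_of_norm_le_const h2
    set D := ∫ k : ℕ, (k : ℝ) ∂μ.toMeasure with hD
    have h3 : |m - D| ≤ 1 * ε := by rw [hm]; exact hdeg1.2
    have h4 : (1 / (N : ℝ)) * ∑ x : EdgeHalf E, G x.1.1
        = m * ((∑ x : EdgeHalf E, G x.1.1) / Fintype.card (EdgeHalf E)) := by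
      have hm1 : m ≠ 0 := by
        rintro rfl
        rw [zero_mul] at hM
        exact hM0.ne' hM
      rw [hM]
      field_simp
    rw [h4]
    have h5 := mul_le_mul_of_nonneg_left (abs_le.1 h1).1 hm0
    have h6 : |(m - D) * I| ≤ ε * κ := by
      rw [abs_mul, ← one_mul ε]
      exact mul_le_mul h3 hIb (abs_nonneg _) ((abs_nonneg _).trans h3)
    linarith [(abs_le.1 h6).1]
  -- half-edges of edges of size greater than `K` are rare, uniformly in `N`
  have htail : (∑ x : EdgeHalf E, if K < ((x.1.1 : P) : ℕ) then (1 : ℝ) else 0)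
      ≤ m * N * (t + δ) := by
    have h1 := hsize (fun p : P => if K < (p : ℕ) then (1 : ℝ) else 0) 1 fun a b => by
      split_ifs <;> simp
    rw [← ht, one_mul] at h1
    have h2 := (abs_le.1 h1).2
    rw [sub_le_iff_le_add, div_le_iff₀ hM0, hM] at h2
    linarith
  have hmain := freeEnergy_le_sum ζ hP hκ hΘ hη d E hdeg K hL
  have hsplit : (1 / (N : ℝ)) * (∑ i, S i - ∑ x : EdgeHalf E, G x.1.1
      + (3 * κ * ((∑ x : EdgeHalf E, if K < ((x.1.1 : P) : ℕ) then (1 : ℝ) else 0) + K * L)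
      + (K + 1) * (2 * κ * L) + 3 * κ * (K : ℝ) ^ 2 * Fintype.card (EdgeHalf E) / L))
      = (1 / (N : ℝ)) * ∑ i, S i - (1 / (N : ℝ)) * ∑ x : EdgeHalf E, G x.1.1
      + 3 * κ * ((∑ x : EdgeHalf E, if K < ((x.1.1 : P) : ℕ) then (1 : ℝ) else 0) / N)
      + 3 * κ * K * (L / N) + (K + 1) * (2 * κ) * (L / N) + 3 * κ * (K : ℝ) ^ 2 * m * (1 / L) := by
    rw [hM]
    field_simp
    ring
  rw [hsplit] at hmain
  have htail' : 3 * κ * ((∑ x : EdgeHalf E, if K < ((x.1.1 : P) : ℕ) then (1 : ℝ) else 0) / N)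
      ≤ 3 * κ * m * (t + δ) := by
    rw [mul_assoc (3 * κ)]
    refine mul_le_mul_of_nonneg_left ?_ (by linarith)
    rw [div_le_iff₀ hN']
    linarith
  rw [rsFunctional]
  linarith

end Bound

/-! ### The limit -/

theorem tendsto_integral_tail {P : Set ℕ} (ρ : PMF P) : Tendsto
    (fun K : ℕ => ∫ p : P, (if K < (p : ℕ) then (1 : ℝ) else 0) ∂ρ.toMeasure) atTop (𝓝 0) := by
  have h := tendsto_integral_of_dominated_convergence (μ := ρ.toMeasure)
    (F := fun (K : ℕ) (p : P) => if K < (p : ℕ) then (1 : ℝ) else 0) (f := fun _ => 0)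
    (fun _ => 1) (fun K => (measurable_of_countable _).aestronglyMeasurable) (integrable_const _)
    (fun K => Eventually.of_forall fun p => by split_ifs <;> simp)
    (Eventually.of_forall fun p => by
      refine tendsto_const_nhds.congr' ?_
      filter_upwards [eventually_ge_atTop (p : ℕ)] with K hK
      rw [if_neg (not_lt.2 hK)])
  simpa using h

theorem tendsto_sqrt_add_one_div : Tendsto (fun N : ℕ => ((N.sqrt + 1 : ℕ) : ℝ) / N) atTop
    (𝓝 0) := by
  have h1 : Tendsto (fun N : ℕ => (√(N : ℝ))⁻¹ + (N : ℝ)⁻¹) atTop (𝓝 0) := by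
    have h2 : Tendsto (fun N : ℕ => (√(N : ℝ))⁻¹) atTop (𝓝 0) :=
      tendsto_inv_atTop_zero.comp (Real.tendsto_sqrt_atTop.comp tendsto_natCast_atTop_atTop)
    simpa using h2.add tendsto_inv_atTop_nhds_zero_nat
  refine squeeze_zero (fun N => by positivity) (fun N => ?_) h1
  rcases Nat.eq_zero_or_pos N with rfl | hN
  · simp
  · have hN' : (0 : ℝ) < N := by exact_mod_cast hN
    have h2 : (√(N : ℝ))⁻¹ = √(N : ℝ) / N := by
      rw [Real.sqrt_div_self', one_div]
    rw [h2, ← one_div, ← add_div]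
    push_cast
    gcongr
    exact Real.nat_sqrt_le_real_sqrt

theorem tendsto_one_div_sqrt_add_one :
    Tendsto (fun N : ℕ => 1 / ((N.sqrt + 1 : ℕ) : ℝ)) atTop (𝓝 0) := by
  have h1 : Tendsto (fun N : ℕ => (√(N : ℝ))⁻¹) atTop (𝓝 0) :=
    tendsto_inv_atTop_zero.comp (Real.tendsto_sqrt_atTop.comp tendsto_natCast_atTop_atTop)
  refine squeeze_zero' (Eventually.of_forall fun N => by positivity) ?_ h1
  filter_upwards [eventually_ge_atTop 1] with N hN
  have hN' : (0 : ℝ) < N := by exact_mod_cast hN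
  rw [one_div]
  gcongr
  push_cast
  exact Real.real_sqrt_le_nat_sqrt_succ

/-- The edges cannot be absent for large `N`, since otherwise the empirical distribution of their
sizes would vanish identically. -/
theorem eventually_ne_zero {P : Set ℕ} (hP : ∀ p ∈ P, 2 ≤ p) {ν : PMF P} {E : ℕ → (P →₀ ℕ)}
    (hν1 : ∑' p : P, ((p : ℕ) : ℝ≥0∞) * ν p ≠ ⊤)
    (hE : Tendsto (fun N => sizeDist (E N) ν) atTop (𝓝 0)) : ∀ᶠ N in atTop, E N ≠ 0 := by
  have hpos : 0 < sizeDist 0 ν := by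
    have h1 : sizeDist 0 ν = (∑' p : P, ((p : ℕ) : ℝ≥0∞) * ν p).toReal := by
      rw [ENNReal.tsum_toReal_eq fun p => ENNReal.ne_top_of_tsum_ne_top hν1 p]
      simp [sizeDist, sizeFreq]
    rw [h1]
    exact ENNReal.toReal_pos (mean_ne_zero hP ν) hν1
  filter_upwards [hE.eventually_lt_const hpos] with N hN h0
  rw [h0] at hN
  exact lt_irrefl _ hN

/-- The bound in the limit, for interactions and fields given by their laws. The error is the
positive part of the difference of both sides. -/
theorem exists_error {P : Set ℕ} (Θ : (p : P) → Measure (Interaction p))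
    (η : Measure (Spin → ℝ)) (ζ : Measure ℝ) {κ : ℝ} [IsProbabilityMeasure ζ]
    [IsProbabilityMeasure η] (hP : ∀ p ∈ P, 2 ≤ p) (hκ : 0 ≤ κ)
    (hΘ : ∀ p, ∃ β φ, IsProductLaw κ (Θ p) β φ) (hη : ∀ᵐ y ∂η, ∀ s, |y s| ≤ κ)
    (d : (N : ℕ) → Fin N → ℕ) (E : ℕ → (P →₀ ℕ)) (μ : PMF ℕ) (ν : PMF P)
    (hdeg : ∀ N, ∑ i, d N i = (E N).sum fun p n => (p : ℕ) * n)
    (hdμ : Tendsto (fun N => ∑' k : ℕ, (k : ℝ) * |degreeFreq (d N) k - (μ k).toReal|) atTop (𝓝 0))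
    (hEν : Tendsto (fun N => sizeDist (E N) ν) atTop (𝓝 0))
    {C : ℝ} (hC : ∀ N : ℕ, 1 ≤ N → (1 / (N : ℝ)) * ∑ i, (d N i : ℝ) ^ 2 ≤ C)
    (hμ2 : ∑' n : ℕ, (n : ℝ≥0∞) ^ 2 * μ n ≠ ⊤)
    (hν1 : ∑' p : P, ((p : ℕ) : ℝ≥0∞) * ν p ≠ ⊤) :
    ∃ r : ℕ → ℝ, Tendsto r atTop (𝓝 0) ∧ ∀ N : ℕ, 1 ≤ N →
      freeEnergy Θ η (d N) (E N) ≤ rsFunctional Θ η μ (sizeBiased hP ν hν1) ζ + r N := by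
  set R := rsFunctional Θ η μ (sizeBiased hP ν hν1) ζ with hR
  refine ⟨fun N => max (freeEnergy Θ η (d N) (E N) - R) 0, ?_, fun N _ => by
    linarith [le_max_left (freeEnergy Θ η (d N) (E N) - R) 0]⟩
  set D := ∫ k : ℕ, (k : ℝ) ∂μ.toMeasure with hD
  set m : ℕ → ℝ := fun N => (1 / (N : ℝ)) * ∑ i, (d N i : ℝ) with hm
  have hmD : Tendsto m atTop (𝓝 D) := by
    rw [tendsto_iff_dist_tendsto_zero]
    refine squeeze_zero (fun _ => dist_nonneg) (fun N => ?_) hdμ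
    have h1 := (abs_degree_average_sub_le (d N) hμ2 zero_le_one (g := fun k => (k : ℝ))
      fun k => by simp).2
    rwa [one_mul] at h1
  set t : ℕ → ℝ := fun K => ∫ p : P, (if K < (p : ℕ) then (1 : ℝ) else 0)
    ∂(sizeBiased hP ν hν1).toMeasure with ht
  have hsq : Tendsto (fun N : ℕ => √(C * √(C / N))) atTop (𝓝 0) := by
    have h1 : Tendsto (fun N : ℕ => C / (N : ℝ)) atTop (𝓝 0) :=
      tendsto_const_div_atTop_nhds_zero_nat C
    have h2 := ((h1.sqrt).const_mul C).sqrt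
    simpa using h2
  rw [Metric.tendsto_atTop]
  intro e he
  -- the edges of size greater than `K` are negligible
  obtain ⟨K, hK⟩ : ∃ K, 3 * κ * D * t K < e := by
    have h1 : Tendsto (fun K => 3 * κ * D * t K) atTop (𝓝 0) := by
      simpa using (tendsto_integral_tail (sizeBiased hP ν hν1)).const_mul (3 * κ * D)
    exact (h1.eventually_lt_const he).exists
  have hlim : Tendsto (fun N : ℕ => 2 * κ * √(C * √(C / N)) + 4 * κ * sizeDist (E N) ν * m N
      + 2 * κ * (∑' k : ℕ, (k : ℝ) * |degreeFreq (d N) k - (μ k).toReal|)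
      + 3 * κ * m N * (t K + sizeDist (E N) ν) + 3 * κ * K * (((N.sqrt + 1 : ℕ) : ℝ) / N)
      + (K + 1) * (2 * κ) * (((N.sqrt + 1 : ℕ) : ℝ) / N)
      + 3 * κ * (K : ℝ) ^ 2 * m N * (1 / ((N.sqrt + 1 : ℕ) : ℝ))) atTop
      (𝓝 (2 * κ * 0 + 4 * κ * 0 * D + 2 * κ * 0 + 3 * κ * D * (t K + 0) + 3 * κ * K * 0
        + (K + 1) * (2 * κ) * 0 + 3 * κ * (K : ℝ) ^ 2 * D * 0)) := by
    refine ((((((?_ : Tendsto _ _ _).add ?_).add ?_).add ?_).add ?_).add ?_).add ?_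
    · exact hsq.const_mul _
    · exact (hEν.const_mul _).mul hmD
    · exact hdμ.const_mul _
    · exact (hmD.const_mul _).mul (hEν.const_add _)
    · exact tendsto_sqrt_add_one_div.const_mul _
    · exact tendsto_sqrt_add_one_div.const_mul _
    · exact (hmD.const_mul _).mul tendsto_one_div_sqrt_add_one
  have hlt := hlim.eventually_lt_const (u := e) (by
    simp only [mul_zero, zero_mul, add_zero, zero_add]
    exact hK)
  have hev : ∀ᶠ N in atTop, dist (max (freeEnergy Θ η (d N) (E N) - R) 0) 0 < e := by
    filter_upwards [hlt, eventually_ne_zero hP hν1 hEν, eventually_ge_atTop 1] with N h1 h2 h3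
    have h4 := freeEnergy_le ζ hP hκ hΘ hη h3 (d N) (E N) h2 (hdeg N) (hC N h3) μ ν hμ2 hν1 K
      (L := N.sqrt + 1) (Nat.le_add_left 1 _) (m := m N) rfl rfl rfl rfl
    rw [Real.dist_eq, sub_zero, abs_of_nonneg (le_max_right _ _), max_lt_iff]
    exact ⟨by linarith, he⟩
  exact eventually_atTop.1 hev

end DilutedSpinGlass

theorem theorem1 {Ω : Type*} [MeasurableSpace Ω] (Pr : Measure Ω) [IsProbabilityMeasure Pr]
    -- the edge sizes, the random functions and their assumptions
    (P : Set ℕ) (hP : ∀ p ∈ P, 2 ≤ p)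
    (θ : (p : P) → Ω → DilutedSpinGlass.Interaction p)
    (h : Ω → DilutedSpinGlass.Spin → ℝ) (hh : Measurable h)
    (a b : P → Ω → ℝ) (f : (p : P) → Fin p → Ω → DilutedSpinGlass.Spin → ℝ)
    (hθ : ∀ p : P, DilutedSpinGlass.IsPTInteraction Pr p (θ p) (a p) (b p) (f p))
    (κ : ℝ) (hκ : 0 < κ)
    (hθκ : ∀ p : P, ∀ᵐ ω ∂Pr, ∀ σ, |θ p ω σ| ≤ κ)
    (hhκ : ∀ᵐ ω ∂Pr, ∀ s, |h ω s| ≤ κ)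
    -- the degrees, the edge numbers and their limits
    (d : (N : ℕ) → Fin N → ℕ) (E : ℕ → (P →₀ ℕ)) (μ : PMF ℕ) (ν : PMF P)
    (hdeg : ∀ N, ∑ i, d N i = (E N).sum fun p n => (p : ℕ) * n)
    (hdμ : Tendsto (fun N => ∑' k : ℕ,
      (k : ℝ) * |DilutedSpinGlass.degreeFreq (d N) k - (μ k).toReal|) atTop (𝓝 0))
    (hEν : Tendsto (fun N => ∑' p : P,
      ((p : ℕ) : ℝ) * |DilutedSpinGlass.sizeFreq (E N) p - (ν p).toReal|) atTop (𝓝 0))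
    (hd2 : ∃ C : ℝ, ∀ N : ℕ, 1 ≤ N → (1 / (N : ℝ)) * ∑ i, (d N i : ℝ) ^ 2 ≤ C)
    (hμ2 : ∑' n : ℕ, (n : ℝ≥0∞) ^ 2 * μ n ≠ ⊤)
    (hν1 : ∑' p : P, ((p : ℕ) : ℝ≥0∞) * ν p ≠ ⊤)
    -- the parameter of the bound
    (ζ : Measure ℝ) [IsProbabilityMeasure ζ] :
    ∃ r : ℕ → ℝ, Tendsto r atTop (𝓝 0) ∧ ∀ N : ℕ, 1 ≤ N →
      DilutedSpinGlass.freeEnergy (fun p => Pr.map (θ p)) (Pr.map h) (d N) (E N) ≤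
        DilutedSpinGlass.rsFunctional (fun p => Pr.map (θ p)) (Pr.map h) μ
          (DilutedSpinGlass.sizeBiased hP ν hν1) ζ + r N := by
  have pη : IsProbabilityMeasure (Pr.map h) := Measure.isProbabilityMeasure_map hh.aemeasurable
  obtain ⟨C, hC⟩ := hd2
  refine DilutedSpinGlass.exists_error (fun p => Pr.map (θ p)) (Pr.map h) ζ hP hκ.le (fun p => ?_)
    ?_ d E μ ν hdeg hdμ hEν hC hμ2 hν1
  · exact (hθ p).exists_isProductLaw (one_le_two.trans (hP p p.2)) (hθκ p)
  · have hm : MeasurableSet {y : DilutedSpinGlass.Spin → ℝ | ∀ s, |y s| ≤ κ} := by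
      have : {y : DilutedSpinGlass.Spin → ℝ | ∀ s, |y s| ≤ κ} = ⋂ s, {y | ‖y s‖ ≤ κ} := by
        ext y; simp
      rw [this]
      exact MeasurableSet.iInter fun s =>
        measurableSet_le (measurable_pi_apply s).norm measurable_const
    exact (ae_map_iff hh.aemeasurable hm).2 hhκ
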